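/- **Setting.** Write $W=(\rho,\rho u_x,\rho u_y,\rho E)^T$, $p=(\gamma-1)(\rho E-\tfrac12\rho\|U\|^2)$ with $\gamma>1$, $c=\sqrt{\gamma p/\rho}$, let $F_x,F_y$ be the 2-D Euler fluxes, $A,B$ their Jacobians and $\mathbf F(W)\cdot S=S_xF_x(W)+S_yF_y(W)$. Let $(\xi,\eta)\mapsto(x,y)$ be a $C^\infty$ mapping of $[0,1]^2$ (smooth up to the boundary) with $x_\xi y_\eta-x_\eta y_\xi>0$; the side $\xi=0$ is an inviscid wall. The mesh has $N\times M$ cells $(i,j)$, with $\Delta\xi=1/N$, $\Delta\eta=1/M$, $\xi(i)=(i-\tfrac12)\Delta\xi$, $\eta(j)=(j-\tfrac12)\Delta\eta$ (half-integer indices are faces, so the wall faces $i=\tfrac12$ lie on $\xi=0$), and with face vectors $$S_{i+1/2,j}=\big(y|_{(i+1/2,j-1/2)}^{(i+1/2,j+1/2)},\,-x|_{(i+1/2,j-1/2)}^{(i+1/2,j+1/2)}\big),\qquad S_{i,j+1/2}=\big(-y|_{(i-1/2,j+1/2)}^{(i+1/2,j+1/2)},\,x|_{(i-1/2,j+1/2)}^{(i+1/2,j+1/2)}\big).$$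 **Scheme.** The residual is $R_{(i,j)}=F_{i+1/2,j}-F_{i-1/2,j}+F_{i,j+1/2}-F_{i,j-1/2}$. Along each mesh line (second index dropped) the JST flux is $$F_{i+1/2}=\tfrac12(\mathbf F(W_i)+\mathbf F(W_{i+1}))\cdot S_{i+1/2}-k^2\nu_{i+1/2}\kappa_{i+1/2}(W_{i+1}-W_i)+\overline{k^4}_{i+1/2}\kappa_{i+1/2}(W_{i+2}-3W_{i+1}+3W_i-W_{i-1}),$$ $$\nu_i=\frac{|p_{i+1}-2p_i+p_{i-1}|}{p_{i+1}+2p_i+p_{i-1}},\quad \nu_{i+1/2}=\max(\nu_i,\nu_{i+1}),\quad \overline{k^4}_{i+1/2}=\max(0,k^4-\nu_{i+1/2}k^2),\quad \kappa_{i+1/2}=|U_{i+1/2}\cdot S_{i+1/2}|+c_{i+1/2}\|S_{i+1/2}\|,$$ where $k^2,k^4\ge0$ are constants (the superscripts are labels), and $U_{i+1/2},c_{i+1/2}$ are evaluated at a fixed $C^1$ mean of $W_i,W_{i+1}$: it maps physical states ($\rho,p>0$) to physical states, is the identity on equal states, and its velocity lies between the two velocities. At a boundary face $F_{1/2}=\mathbf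 F(W_b)\cdot S_{1/2}$; here $W_b$ is a $C^1$ function of the adjacent state $W_1$ and the unit face normal, has values in the physical states, satisfies the Dirichlet-like boundary conditions of that side (at the wall, exactly $U_b\cdot n=0$), and equals $W_1$ if $W_1$ already satisfies them; in $\nu_1$ one takes $p_0=2p_b-p_1$. At the second face, $F^{JST_a}_{3/2},F^{JST_b}_{3/2},F^{JST_c}_{3/2}$ are obtained by replacing the difference that multiplies $\overline{k^4}\kappa$ by, respectively, $$W_3-3W_2+2W_1,\qquad W_3-2W_2+W_1,\qquad W_3-3W_2+3W_1-W_g\quad (W_g=2W_b-W_1).$$ Mirrored formulas are used at the other end of each line; all four sides are treated in this way, and one choice a, b or c is made for all of them. The functional is the force on the wall in a direction $d=(d_x,d_y)$, $J=\sum_j p(W_{b(1/2,j)})\,(-S_{1/2,j}\cdot d)$. **Consistency.** Let $W$ (physical, satisfying the boundary conditions on the four sides) and $\Lambda$ be $C^\infty$ fields on $[0,1]^2$, sampled at the cell centres. For a cell $m$ in which the scheme is differentiable (every $R_k$ is a differentiable function of $W_m$ at the sampled flow; this excludes the marginal cells where a max or an absolute value makes the scheme non-differentiable) put $$\mathcal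 A_m=\sum_k\Lambda_k^T\frac{\partial R_k}{\partial W_m}+\frac{\partial J}{\partial W_m},\qquad \mathcal L=-\Lambda_\xi^T(y_\eta A-x_\eta B)-\Lambda_\eta^T(-y_\xi A+x_\xi B),$$ so that $\mathcal A_m=0$ is the exact discrete adjoint equation in cell $m$ and $\mathcal L=0$ is the continuous adjoint equation. The discrete adjoint is *consistent with the continuous adjoint equation* in a class of cells if, for all such mappings, boundary treatments of the sides other than the wall, fields $W,\Lambda$ and directions $d$, the truncation error $\mathcal A_m/(\Delta\xi\Delta\eta)-\mathcal L(\xi_m,\eta_m)$ tends to $0$, uniformly over the cells $m$ of the class in which the scheme is differentiable, as $\Delta\xi,\Delta\eta\to0$ with $\Delta\xi/\Delta\eta$ and $\Delta\eta/\Delta\xi$ bounded. **Lemma.** For every choice of $\gamma,k^2,k^4$, interface mean and wall state as above: 1. With each of $F^{JST_a}_{3/2},F^{JST_b}_{3/2},F^{JST_c}_{3/2}$, the discrete adjoint is consistent with the continuous adjoint equation in the interior cells ($3\le i\le N-2$, $3\le j\le M-2$). 2. In the penultimate cells with respect to any of the four sides (for the wall: $i=2$, $3\le j\le M-2$) it is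 consistent with the continuous adjoint equation if $F^{JST_b}_{3/2}$ is used, and, provided $k^4>0$, inconsistent if $F^{JST_a}_{3/2}$ or $F^{JST_c}_{3/2}$ is used. More precisely, with a or c, for all fields the difference between the truncation error and $k^4\,(|U\cdot s|+c\|s\|)\,\partial_{in}\Lambda^T$ at the cell centre tends to $0$ in the same uniform sense, where $\partial_{in}$ is the inward coordinate derivative at the side ($\partial_\xi$ at $\xi=0$, $-\partial_\xi$ at $\xi=1$, $\partial_\eta$ at $\eta=0$, $-\partial_\eta$ at $\eta=1$) and $s=(y_\eta,-x_\eta)$ for the sides $\xi=0,1$, $s=(-y_\xi,x_\xi)$ for the sides $\eta=0,1$. 3. With each of the three formulas, the discrete adjoint is consistent in the wall-adjacent cells with the continuous adjoint wall condition $\Lambda_2y_\eta-\Lambda_3x_\eta+(y_\eta d_x-x_\eta d_y)=0$: with $g_j=\partial p(W_b)/\partial W_{(1,j)}$, $$\frac{1}{\Delta\eta}\mathcal A_{(1,j)}+\big[\Lambda_2y_\eta-\Lambda_3x_\eta+(y_\eta d_x-x_\eta d_y)\big](0,\eta_j)\;g_j\longrightarrow0$$ in the same uniform sense for $3\le j\le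 M-2$ (again in the cells where the scheme is differentiable), and $\|g_j\|$ is bounded below by a positive constant that does not depend on the mesh, for all sufficiently fine meshes. -/

import Mathlib

open scoped Matrix ContDiff

namespace JST

noncomputable section

/-! ### Two-dimensional Euler equations for an ideal gas -/

/-- Conservative variables `(ρ, ρ u_x, ρ u_y, ρ E)`; also used for adjoint vectors. -/
abbrev State := Fin 4 → ℝ

/-- Static pressure `(γ - 1) (ρ E - ρ ‖U‖² / 2)`. -/
def pressure (γ : ℝ) (W : State) : ℝ :=
  (γ - 1) * (W 3 - (W 1 ^ 2 + W 2 ^ 2) / (2 * W 0))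

/-- States with positive density and positive pressure. -/
def physical (γ : ℝ) : Set State := {W | 0 < W 0 ∧ 0 < pressure γ W}

/-- Fluid velocity `(u_x, u_y)`. -/
def velocity (W : State) : ℝ × ℝ := (W 1 / W 0, W 2 / W 0)

/-- Speed of sound. -/
def soundSpeed (γ : ℝ) (W : State) : ℝ := Real.sqrt (γ * pressure γ W / W 0)

/-- Euler flux in the `x`-direction (note `ρ u_x H = u_x (ρ E + p)`). -/
def fluxX (γ : ℝ) (W : State) : State :=
  ![W 1, W 1 ^ 2 / W 0 + pressure γ W, W 1 * W 2 / W 0, W 1 / W 0 * (W 3 + pressure γ W)]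

/-- Euler flux in the `y`-direction. -/
def fluxY (γ : ℝ) (W : State) : State :=
  ![W 2, W 1 * W 2 / W 0, W 2 ^ 2 / W 0 + pressure γ W, W 2 / W 0 * (W 3 + pressure γ W)]

/-- `𝐅(W) · S`. -/
def flux (γ : ℝ) (W : State) (S : ℝ × ℝ) : State := S.1 • fluxX γ W + S.2 • fluxY γ W

/-- Jacobian matrix `∂F/∂W` of a vector function of the state. -/
def jacobian (F : State → State) (W : State) : Matrix (Fin 4) (Fin 4) ℝ :=
  Matrix.of fun a b => fderiv ℝ F W (Pi.single b 1) a

/-- Row vector `∂f/∂W` of a scalar function of the state. -/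
def grad (f : State → ℝ) (W : State) : State := fun b => fderiv ℝ f W (Pi.single b 1)

/-! ### Plane vectors -/

/-- Scalar product in the plane. -/
def dot (a b : ℝ × ℝ) : ℝ := a.1 * b.1 + a.2 * b.2

/-- Euclidean length. -/
def len (a : ℝ × ℝ) : ℝ := Real.sqrt (dot a a)

/-- Unit vector in the direction of `a`. -/
def unit (a : ℝ × ℝ) : ℝ × ℝ := (len a)⁻¹ • a

/-- Spectral radius `|U · S| + c ‖S‖` of the flux Jacobian in the direction `S`. -/
def spectralRadius (γ : ℝ) (W : State) (S : ℝ × ℝ) : ℝ :=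
  |dot (velocity W) S| + soundSpeed γ W * len S

/-! ### Interface means and boundary states -/

/-- A mean of two states, used to evaluate the velocity and the speed of sound at an interface
(arithmetic mean of the conservative variables, Roe mean, ...). -/
structure InterfaceMean (γ : ℝ) where
  toFun : State → State → State
  contDiffOn : ContDiffOn ℝ 1 (fun q : State × State => toFun q.1 q.2)
    (physical γ ×ˢ physical γ)
  physical_mem : ∀ V ∈ physical γ, ∀ W ∈ physical γ, toFun V W ∈ physical γ
  self : ∀ W ∈ physical γ, toFun W W = W
  velocity_mem : ∀ V ∈ physical γ, ∀ W ∈ physical γ,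
    velocity (toFun V W) ∈ segment ℝ (velocity V) (velocity W)

/-- A boundary treatment. `conditions n` is the set of states that satisfy all Dirichlet-like
boundary conditions on a face with normal `n`; `state W n` is the boundary state `W_b`, a function
of the state `W` of the adjacent cell and of the normal only. It satisfies the boundary conditions,
and it is `W` itself if `W` already satisfies them. -/
structure BoundaryState (γ : ℝ) where
  conditions : ℝ × ℝ → Set State
  state : State → ℝ × ℝ → State
  contDiffOn : ContDiffOn ℝ 1 (fun q : State × (ℝ × ℝ) => state q.1 q.2)
    (physical γ ×ˢ {n | n ≠ 0})
  physical_mem : ∀ W ∈ physical γ, ∀ n : ℝ × ℝ, n ≠ 0 → state W n ∈ physical γ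
  state_mem : ∀ W ∈ physical γ, ∀ n : ℝ × ℝ, n ≠ 0 → state W n ∈ conditions n
  state_eq_self : ∀ W ∈ physical γ, ∀ n : ℝ × ℝ, n ≠ 0 → W ∈ conditions n → state W n = W

/-- At an inviscid wall the only Dirichlet-like condition is slip, `U · n = 0`. -/
def BoundaryState.IsWall {γ : ℝ} (B : BoundaryState γ) : Prop :=
  ∀ n : ℝ × ℝ, n ≠ 0 → B.conditions n = {W | dot (velocity W) n = 0}

/-! ### The JST fluxes along one line of cells -/

/-- The three formulas for the numerical flux at the second faces from the boundaries. -/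
inductive Closure
  | a
  | b
  | c

/-- The difference multiplied by `k̄⁴ κ` in `F_{3/2}`, where `W₁, W₂, W₃` are the first three states
counted from the boundary and `Wg` is the mirror state of `W₁`. -/
def Closure.difference (v : Closure) (W₁ W₂ W₃ Wg : State) : State :=
  match v with
  | .a => W₃ - (3 : ℝ) • W₂ + (2 : ℝ) • W₁
  | .b => W₃ - (2 : ℝ) • W₂ + W₁
  | .c => W₃ - (3 : ℝ) • W₂ + (3 : ℝ) • W₁ - Wg

/-- What determines the JST fluxes along a line of cells `1, …, n`. `S k` is the surface vector of
face `k + 1/2`, for `k = 0, …, n`, oriented towards increasing indices. `first` and `last` are the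
boundary treatments at the faces `1/2` and `n + 1/2`. -/
structure Line (γ : ℝ) where
  k₂ : ℝ
  k₄ : ℝ
  mean : InterfaceMean γ
  closure : Closure
  first : BoundaryState γ
  last : BoundaryState γ
  n : ℤ
  S : ℤ → ℝ × ℝ

namespace Line

variable {γ : ℝ} (L : Line γ) (w : ℤ → State)

/-- Boundary state at face `1/2`. -/
def firstState : State := L.first.state (w 1) (unit (L.S 0))

/-- Boundary state at face `n + 1/2`. -/
def lastState : State := L.last.state (w L.n) (unit (L.S L.n))

/-- Cell pressures, extended by `p₀ = 2 p_b - p₁` and likewise at the other end. -/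
def press (i : ℤ) : ℝ :=
  if i = 0 then 2 * pressure γ (L.firstState w) - pressure γ (w 1)
  else if i = L.n + 1 then 2 * pressure γ (L.lastState w) - pressure γ (w L.n)
  else pressure γ (w i)

/-- Sensor `ν_i` of a cell. -/
def sensor (i : ℤ) : ℝ :=
  |L.press w (i + 1) - 2 * L.press w i + L.press w (i - 1)| /
    (L.press w (i + 1) + 2 * L.press w i + L.press w (i - 1))

/-- Sensor `ν_{k+1/2}` of a face. -/
def faceSensor (k : ℤ) : ℝ := max (L.sensor w k) (L.sensor w (k + 1))

/-- The coefficient `k̄⁴_{k+1/2}`. -/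
def kBar (k : ℤ) : ℝ := max 0 (L.k₄ - L.faceSensor w k * L.k₂)

/-- The spectral radius `κ_{k+1/2}`. -/
def kappa (k : ℤ) : ℝ := spectralRadius γ (L.mean.toFun (w k) (w (k + 1))) (L.S k)

/-- The higher difference of the states at face `k + 1/2`. The formula at the second face from the
far end is the mirror image of the one at face `3/2`. The mirror states are `W_g = 2 W_b - W`. -/
def difference (k : ℤ) : State :=
  if k = 1 then
    L.closure.difference (w 1) (w 2) (w 3) ((2 : ℝ) • L.firstState w - w 1)
  else if k = L.n - 1 then
    -L.closure.difference (w L.n) (w (L.n - 1)) (w (L.n - 2)) ((2 : ℝ) • L.lastState w - w L.n)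
  else
    w (k + 2) - (3 : ℝ) • w (k + 1) + (3 : ℝ) • w k - w (k - 1)

/-- The numerical flux through face `k + 1/2`. -/
def numFlux (k : ℤ) : State :=
  if k = 0 then flux γ (L.firstState w) (L.S 0)
  else if k = L.n then flux γ (L.lastState w) (L.S L.n)
  else
    (1 / 2 : ℝ) • (flux γ (w k) (L.S k) + flux γ (w (k + 1)) (L.S k))
      - (L.k₂ * L.faceSensor w k * L.kappa w k) • (w (k + 1) - w k)
      + (L.kBar w k * L.kappa w k) • L.difference w k

end Line

/-! ### Meshes, flow and adjoint fields -/

/-- The data of the scheme that stay fixed when the mesh is refined: the dissipation constants, the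
interface mean and the boundary state at the wall. -/
structure Scheme (γ : ℝ) where
  k₂ : ℝ
  k₄ : ℝ
  mean : InterfaceMean γ
  wall : BoundaryState γ

/-- A mapping `(x, y)` from the coordinates `(ξ, η)` of the unit square to physical space, a flow
field `W`, an adjoint field `Λ`, the direction `d` of the force, and the boundary treatments on the
sides `ξ = 1`, `η = 0` and `η = 1` (the wall is the side `ξ = 0`). -/
structure Config (γ : ℝ) where
  x : ℝ × ℝ → ℝ
  y : ℝ × ℝ → ℝ
  W : ℝ × ℝ → State
  Λ : ℝ × ℝ → State
  d : ℝ × ℝ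
  right : BoundaryState γ
  bottom : BoundaryState γ
  top : BoundaryState γ

/-- `∂f/∂ξ` -/
def dξ {E : Type*} [NormedAddCommGroup E] [NormedSpace ℝ E] (f : ℝ × ℝ → E) (P : ℝ × ℝ) : E :=
  fderiv ℝ f P (1, 0)

/-- `∂f/∂η` -/
def dη {E : Type*} [NormedAddCommGroup E] [NormedSpace ℝ E] (f : ℝ × ℝ → E) (P : ℝ × ℝ) : E :=
  fderiv ℝ f P (0, 1)

/-- The closed unit square. -/
def square : Set (ℝ × ℝ) := Set.Icc 0 1 ×ˢ Set.Icc 0 1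

namespace Config

variable {γ : ℝ} (C : Config γ)

/-- The normal `(y_η, -x_η)` to the lines of constant `ξ`. -/
def normalξ (P : ℝ × ℝ) : ℝ × ℝ := (dη C.y P, -dη C.x P)

/-- The normal `(-y_ξ, x_ξ)` to the lines of constant `η`. -/
def normalη (P : ℝ × ℝ) : ℝ × ℝ := (-dξ C.y P, dξ C.x P)

/-- Smooth regular right-handed mapping, smooth physical flow field that satisfies the boundary
conditions on the four sides, smooth adjoint field. -/
structure Admissible (D : Scheme γ) : Prop where
  smooth_x : ContDiff ℝ ∞ C.x
  smooth_y : ContDiff ℝ ∞ C.y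
  smooth_W : ContDiff ℝ ∞ C.W
  smooth_Λ : ContDiff ℝ ∞ C.Λ
  jacobian_pos : ∀ P ∈ square, 0 < dξ C.x P * dη C.y P - dη C.x P * dξ C.y P
  physical_W : ∀ P ∈ square, C.W P ∈ physical γ
  wall_cond : ∀ η ∈ Set.Icc (0 : ℝ) 1, C.W (0, η) ∈ D.wall.conditions (unit (C.normalξ (0, η)))
  right_cond : ∀ η ∈ Set.Icc (0 : ℝ) 1, C.W (1, η) ∈ C.right.conditions (unit (C.normalξ (1, η)))
  bottom_cond : ∀ ξ ∈ Set.Icc (0 : ℝ) 1, C.W (ξ, 0) ∈ C.bottom.conditions (unit (C.normalη (ξ, 0)))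
  top_cond : ∀ ξ ∈ Set.Icc (0 : ℝ) 1, C.W (ξ, 1) ∈ C.top.conditions (unit (C.normalη (ξ, 1)))

/-- The left-hand side of the continuous adjoint equation in transformed coordinates, a row vector:
`-Λ_ξᵀ (y_η A - x_η B) - Λ_ηᵀ (-y_ξ A + x_ξ B)`. -/
def contAdjoint (P : ℝ × ℝ) : State :=
  -(dξ C.Λ P ᵥ* (dη C.y P • jacobian (fluxX γ) (C.W P) - dη C.x P • jacobian (fluxY γ) (C.W P)))
    - dη C.Λ P ᵥ* (-dξ C.y P • jacobian (fluxX γ) (C.W P) + dξ C.x P • jacobian (fluxY γ) (C.W P))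

/-- The left-hand side of the continuous adjoint wall condition,
`Λ₂ y_η - Λ₃ x_η + (y_η d_x - x_η d_y)`. -/
def contWall (P : ℝ × ℝ) : ℝ :=
  C.Λ P 1 * dη C.y P - C.Λ P 2 * dη C.x P + (dη C.y P * C.d.1 - dη C.x P * C.d.2)

/-! The mesh has `N × M` cells `(i, j)`, `1 ≤ i ≤ N`, `1 ≤ j ≤ M`, and is the image of the uniform
mesh of the unit square with steps `Δξ = 1 / N` and `Δη = 1 / M`. -/

/-- Centre of the cell `(i, j)` in the unit square. -/
def centre (N M : ℕ) (q : ℤ × ℤ) : ℝ × ℝ := (((q.1 : ℝ) - 1 / 2) / N, ((q.2 : ℝ) - 1 / 2) / M)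

/-- The mesh node of indices `(k + 1/2, l + 1/2)` in the unit square. -/
def node (N M : ℕ) (k l : ℤ) : ℝ × ℝ := ((k : ℝ) / N, (l : ℝ) / M)

/-- Surface vector of face `(k + 1/2, j)`. -/
def faceξ (N M : ℕ) (k j : ℤ) : ℝ × ℝ :=
  (C.y (node N M k j) - C.y (node N M k (j - 1)),
    -C.x (node N M k j) + C.x (node N M k (j - 1)))

/-- Surface vector of face `(i, l + 1/2)`. -/
def faceη (N M : ℕ) (i l : ℤ) : ℝ × ℝ :=
  (-C.y (node N M i l) + C.y (node N M (i - 1) l),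
    C.x (node N M i l) - C.x (node N M (i - 1) l))

/-- The line of cells `(1, j), …, (N, j)`. -/
def row (D : Scheme γ) (v : Closure) (N M : ℕ) (j : ℤ) : Line γ where
  k₂ := D.k₂
  k₄ := D.k₄
  mean := D.mean
  closure := v
  first := D.wall
  last := C.right
  n := N
  S := fun k => C.faceξ N M k j

/-- The line of cells `(i, 1), …, (i, M)`. -/
def column (D : Scheme γ) (v : Closure) (N M : ℕ) (i : ℤ) : Line γ where
  k₂ := D.k₂
  k₄ := D.k₄
  mean := D.mean
  closure := v
  first := C.bottom
  last := C.top
  n := M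
  S := fun l => C.faceη N M i l

/-- The residual `R_(i,j)` of the scheme at the discrete flow `U`. -/
def residual (D : Scheme γ) (v : Closure) (N M : ℕ) (U : ℤ × ℤ → State) (q : ℤ × ℤ) : State :=
  (C.row D v N M q.2).numFlux (fun i => U (i, q.2)) q.1
    - (C.row D v N M q.2).numFlux (fun i => U (i, q.2)) (q.1 - 1)
    + (C.column D v N M q.1).numFlux (fun j => U (q.1, j)) q.2
    - (C.column D v N M q.1).numFlux (fun j => U (q.1, j)) (q.2 - 1)

/-- The discrete force on the wall in the direction `d`: the sum of `p(W_b) (-S · d)` over the wall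
faces; `-S` points out of the fluid since `S` is oriented towards increasing `ξ`. -/
def force (D : Scheme γ) (N M : ℕ) (U : ℤ × ℤ → State) : ℝ :=
  ∑ j ∈ Finset.Icc (1 : ℤ) M,
    pressure γ (D.wall.state (U (1, j)) (unit (C.faceξ N M 0 j))) * -dot (C.faceξ N M 0 j) C.d

/-- The discrete flow given by the values of `W` at the cell centres. -/
def sampledFlow (N M : ℕ) (q : ℤ × ℤ) : State := C.W (centre N M q)

/-- The cells of the mesh. -/
def cells (N M : ℕ) : Finset (ℤ × ℤ) := Finset.Icc (1 : ℤ) N ×ˢ Finset.Icc (1 : ℤ) M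

/-- The scheme is differentiable with respect to the state of cell `q`. -/
def DifferentiableInCell (D : Scheme γ) (v : Closure) (N M : ℕ) (q : ℤ × ℤ) : Prop :=
  ∀ k ∈ cells N M, DifferentiableAt ℝ
    (fun w => C.residual D v N M (Function.update (C.sampledFlow N M) q w) k) (C.sampledFlow N M q)

/-- The exact discrete adjoint equation in cell `q`, for the values of `W` and `Λ` at the cell
centres, with all terms on the left-hand side: `∑_k Λ_kᵀ ∂R_k/∂W_q + ∂J/∂W_q`. -/
def discreteAdjoint (D : Scheme γ) (v : Closure) (N M : ℕ) (q : ℤ × ℤ) : State :=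
  ∑ k ∈ cells N M, C.Λ (centre N M k) ᵥ* jacobian
      (fun w => C.residual D v N M (Function.update (C.sampledFlow N M) q w) k)
      (C.sampledFlow N M q)
    + grad (fun w => C.force D N M (Function.update (C.sampledFlow N M) q w)) (C.sampledFlow N M q)

/-- Truncation error of the discrete adjoint equation, divided by `Δξ Δη`, with respect to the
continuous adjoint equation. -/
def truncationError (D : Scheme γ) (v : Closure) (N M : ℕ) (q : ℤ × ℤ) : State :=
  ((1 / N : ℝ) * (1 / M))⁻¹ • C.discreteAdjoint D v N M q - C.contAdjoint (centre N M q)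

/-- The row vector `∂p_b/∂W_(1,j)`, where `p_b` is the pressure of the boundary state. -/
def wallPressureGrad (D : Scheme γ) (N M : ℕ) (j : ℤ) : State :=
  grad (fun w => pressure γ (D.wall.state w (unit (C.faceξ N M 0 j)))) (C.sampledFlow N M (1, j))

end Config

/-! ### Consistency -/

/-- The four sides of the unit square: `ξ = 0` (the wall), `ξ = 1`, `η = 0` and `η = 1`. -/
inductive Side
  | wall
  | right
  | bottom
  | top

/-- Interior cells: all cells except, on each side, the boundary cells and the penultimate ones. -/
def interior (N M : ℕ) : Set (ℤ × ℤ) :=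
  {q | 3 ≤ q.1 ∧ q.1 ≤ N - 2 ∧ 3 ≤ q.2 ∧ q.2 ≤ M - 2}

/-- Penultimate cells with respect to a side (neither boundary cells nor penultimate in the other
direction). -/
def penultimate (s : Side) (N M : ℕ) : Set (ℤ × ℤ) :=
  match s with
  | .wall => {q | q.1 = 2 ∧ 3 ≤ q.2 ∧ q.2 ≤ M - 2}
  | .right => {q | q.1 = N - 1 ∧ 3 ≤ q.2 ∧ q.2 ≤ M - 2}
  | .bottom => {q | q.2 = 2 ∧ 3 ≤ q.1 ∧ q.1 ≤ N - 2}
  | .top => {q | q.2 = M - 1 ∧ 3 ≤ q.1 ∧ q.1 ≤ N - 2}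

/-- For all mappings, flows and adjoint fields, the truncation error, in the cells of the given
class in which the scheme is differentiable, approaches the function `E` uniformly when the mesh is
refined with `Δξ` and `Δη` of the same order of magnitude. -/
def TruncationErrorTendsTo {γ : ℝ} (D : Scheme γ) (v : Closure)
    (cls : ℕ → ℕ → Set (ℤ × ℤ)) (E : Config γ → ℝ × ℝ → State) : Prop :=
  ∀ C : Config γ, C.Admissible D → ∀ r : ℝ, ∀ ε > 0, ∃ n₀ : ℕ, ∀ N M : ℕ, n₀ ≤ N → n₀ ≤ M →
    (N : ℝ) ≤ r * M → (M : ℝ) ≤ r * N → ∀ q ∈ cls N M, C.DifferentiableInCell D v N M q →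
      ‖C.truncationError D v N M q - E C (Config.centre N M q)‖ ≤ ε

/-- Consistency of the discrete adjoint with the continuous adjoint equation in a class of cells. -/
def DualConsistent {γ : ℝ} (D : Scheme γ) (v : Closure) (cls : ℕ → ℕ → Set (ℤ × ℤ)) : Prop :=
  TruncationErrorTendsTo D v cls fun _ _ => 0

/-- `k⁴ κ ∂Λ`, where `∂` is the inward coordinate derivative at the given side and `κ` is the
spectral radius per unit of coordinate length of the faces parallel to that side. -/
def defect {γ : ℝ} (D : Scheme γ) (s : Side) (C : Config γ) (P : ℝ × ℝ) : State :=
  match s with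
  | .wall => (D.k₄ * spectralRadius γ (C.W P) (C.normalξ P)) • dξ C.Λ P
  | .right => -((D.k₄ * spectralRadius γ (C.W P) (C.normalξ P)) • dξ C.Λ P)
  | .bottom => (D.k₄ * spectralRadius γ (C.W P) (C.normalη P)) • dη C.Λ P
  | .top => -((D.k₄ * spectralRadius γ (C.W P) (C.normalη P)) • dη C.Λ P)

/-- Consistency of the discrete adjoint with the continuous adjoint wall condition: in the cells
`(1, j)`, the discrete adjoint equation divided by `Δη` is, up to an error that tends to zero
uniformly, the wall condition at `(0, η_j)` times the row vector `-∂p_b/∂W_(1,j)`, which is bounded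
away from zero. -/
def WallConsistent {γ : ℝ} (D : Scheme γ) (v : Closure) : Prop :=
  ∀ C : Config γ, C.Admissible D → ∀ r : ℝ, ∃ β > 0, ∀ ε > 0, ∃ n₀ : ℕ, ∀ N M : ℕ,
    n₀ ≤ N → n₀ ≤ M → (N : ℝ) ≤ r * M → (M : ℝ) ≤ r * N →
    ∀ j : ℤ, 3 ≤ j → j ≤ M - 2 → C.DifferentiableInCell D v N M (1, j) →
      β ≤ ‖C.wallPressureGrad D N M j‖ ∧
      ‖(1 / M : ℝ)⁻¹ • C.discreteAdjoint D v N M (1, j)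
        - C.contWall (0, (Config.centre N M (1, j)).2) • -C.wallPressureGrad D N M j‖ ≤ ε

end

end JST

/-! The discrete adjoint in a cell `q` is the gradient, with respect to the state of `q`, of the
scalar functional `∑ Λ_k · R_k + J` (`Config.discreteAdjoint_eq_grad`). Only the row and the column
through `q` matter, and summation by parts along a line pairs each flux with the jump of `Λ` across
its face. Only the faces `m - 2, …, m + 1` of a line see the state of its cell `m`
(`Line.balance_update_sub`). After scaling, jumps of `Λ` tend to `Λ_ξ` or `Λ_η` and face vectors to
the coordinate normals. The central fluxes at the two faces of the cell contribute half a flux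
Jacobian each, which gives the continuous adjoint operator.

In the dissipation, the sensors and all differences of states tend to zero on a smooth flow. By the
product rule the second-difference term therefore has a vanishing derivative, and the other term
keeps only `k⁴ κ` times the coefficient of the state of the cell in the higher difference
(`LineLimit.der_innerFlux`). What matters is the sum of these coefficients over the faces: `1 - 3 +
3 - 1 = 0` in an interior cell, and `±(Closure.second + 2)` in a penultimate one. The latter is `0`
for formula b and `∓1` for a and c, which is the defect `k⁴ κ ∂Λ`
(`LineLimit.der_balance_of_position`).

In a wall cell the equation is divided by `Δη` only, so every term carrying a jump of `Λ`
disappears. The wall flux remains; it is a pure pressure flux because the boundary state slips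
exactly, and it combines with the force into the wall condition times the gradient of the boundary
pressure. The energy component of that gradient tends to `γ - 1`, whence the lower bound.

Two devices make this rigorous. Absolute values and maxima prevent a termwise differentiation, so
terms are only shown to be uniformly Lipschitz in the perturbed state (`Reg`) or to have a
derivative up to a small relative error (`Der`); differentiability enters once, for the whole
functional (`Der.tendsto_grad`). Uniformity over cells comes from compactness: a sequence of bad
cells converges, along an ultrafilter, to a point of the square, and the ultrafilter decides whether
the cells stay near a side. If they do, the limit state satisfies the boundary conditions there, so
boundary states share its limit.

Inconsistency of a and c is witnessed by a uniform gas at rest with a linear adjoint field: the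
scheme is differentiable there and the defect is a nonzero constant. -/

namespace JST

open Filter Topology Asymptotics

/-! ### Perturbations of the state of one cell along a filter -/

section Perturbation

set_option linter.unusedSectionVars false

variable {ι : Type*} {E F G : Type*} [NormedAddCommGroup E] [NormedSpace ℝ E]
  [NormedAddCommGroup F] [NormedSpace ℝ F] [NormedAddCommGroup G] [NormedSpace ℝ G]

/-- Pairs `(t, x)` where `t` follows `l` and, for given `t`, the state `x` is close to `x₀ t`. -/
def pert (l : Filter ι) (x₀ : ι → State) : Filter (ι × State) :=
  l.bind fun t => (𝓝 (x₀ t)).map (Prod.mk t)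

/-- The unperturbed point with the same parameter. -/
def base (x₀ : ι → State) (p : ι × State) : ι × State := (p.1, x₀ p.1)

/-- The perturbation. -/
def incr (x₀ : ι → State) (p : ι × State) : State := p.2 - x₀ p.1

variable {l : Filter ι} {x₀ : ι → State}

@[simp] theorem base_fst (p : ι × State) : (base x₀ p).1 = p.1 := rfl

/-- The admissible size of the perturbation may depend on `t`: no common neighbourhood is needed, so
differentiability at each fixed mesh is enough later. -/
theorem eventually_pert {P : ι × State → Prop} :
    (∀ᶠ p in pert l x₀, P p) ↔ ∀ᶠ t in l, ∀ᶠ x in 𝓝 (x₀ t), P (t, x) := by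
  simp [pert, eventually_bind]

theorem tendsto_base : Tendsto (base x₀) (pert l x₀) (pert l x₀) := by
  intro s hs
  have h : ∀ᶠ p in pert l x₀, p ∈ s := hs
  rw [eventually_pert] at h
  change ∀ᶠ p in pert l x₀, base x₀ p ∈ s
  rw [eventually_pert]
  filter_upwards [h] with t ht
  exact Eventually.of_forall fun _ => ht.self_of_nhds

theorem tendsto_fst : Tendsto Prod.fst (pert l x₀) l := by
  intro s hs
  change ∀ᶠ p in pert l x₀, p.1 ∈ s
  rw [eventually_pert]
  filter_upwards [hs] with t ht
  exact Eventually.of_forall fun _ => ht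

theorem tendsto_snd {c : State} (h : Tendsto x₀ l (𝓝 c)) :
    Tendsto Prod.snd (pert l x₀) (𝓝 c) := by
  intro s hs
  obtain ⟨u, hus, hu, hc⟩ := mem_nhds_iff.1 hs
  change ∀ᶠ p in pert l x₀, p.2 ∈ s
  rw [eventually_pert]
  filter_upwards [h (hu.mem_nhds hc)] with t ht
  filter_upwards [hu.mem_nhds ht] with x hx using hus hx

/-- `f` converges to `c` and its dependence on the perturbation is uniformly Lipschitz. -/
structure Reg (l : Filter ι) (x₀ : ι → State) (f : ι × State → E) (c : E) : Prop where
  tendsto : Tendsto f (pert l x₀) (𝓝 c)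
  lip : (fun p => f p - f (base x₀ p)) =O[pert l x₀] incr x₀

theorem Reg.tendsto_base {f : ι × State → E} {c : E} (h : Reg l x₀ f c) :
    Tendsto (fun p => f (base x₀ p)) (pert l x₀) (𝓝 c) :=
  h.tendsto.comp JST.tendsto_base

theorem Reg.of_fst {a : ι → E} {c : E} (h : Tendsto a l (𝓝 c)) :
    Reg l x₀ (fun p => a p.1) c :=
  ⟨h.comp tendsto_fst, by simpa using isBigO_zero _ _⟩

theorem Reg.const (c : E) : Reg l x₀ (fun _ => c) c := Reg.of_fst (a := fun _ => c) tendsto_const_nhds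

theorem Reg.snd {c : State} (h : Tendsto x₀ l (𝓝 c)) : Reg l x₀ Prod.snd c :=
  ⟨tendsto_snd h, isBigO_refl _ _⟩

theorem Reg.congr {f g : ι × State → E} {c : E} (h : Reg l x₀ f c) (e : f =ᶠ[pert l x₀] g) :
    Reg l x₀ g c := by
  refine ⟨h.tendsto.congr' e, h.lip.congr' ?_ EventuallyEq.rfl⟩
  filter_upwards [e, JST.tendsto_base.eventually e] with p h₁ h₂
  rw [h₁, h₂]

theorem Reg.add {f g : ι × State → E} {c d : E} (hf : Reg l x₀ f c) (hg : Reg l x₀ g d) :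
    Reg l x₀ (fun p => f p + g p) (c + d) :=
  ⟨hf.tendsto.add hg.tendsto, (hf.lip.add hg.lip).congr_left fun p => by abel⟩

theorem Reg.sub {f g : ι × State → E} {c d : E} (hf : Reg l x₀ f c) (hg : Reg l x₀ g d) :
    Reg l x₀ (fun p => f p - g p) (c - d) :=
  ⟨hf.tendsto.sub hg.tendsto, (hf.lip.sub hg.lip).congr_left fun p => by abel⟩

theorem Reg.neg {f : ι × State → E} {c : E} (hf : Reg l x₀ f c) :
    Reg l x₀ (fun p => -f p) (-c) := by
  simpa using (Reg.const (l := l) (x₀ := x₀) (0 : E)).sub hf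

theorem Reg.smul {f : ι × State → ℝ} {g : ι × State → E} {c : ℝ} {d : E}
    (hf : Reg l x₀ f c) (hg : Reg l x₀ g d) : Reg l x₀ (fun p => f p • g p) (c • d) := by
  refine ⟨hf.tendsto.smul hg.tendsto, ?_⟩
  have h₁ := (hf.tendsto.isBigO_one ℝ).smul hg.lip
  have h₂ := hf.lip.norm_right.smul (hg.tendsto_base.isBigO_one ℝ)
  have h₁' : (fun p => f p • (g p - g (base x₀ p))) =O[pert l x₀] incr x₀ := by
    simpa using h₁.norm_right
  have h₂' : (fun p => (f p - f (base x₀ p)) • g (base x₀ p)) =O[pert l x₀] incr x₀ := by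
    rw [← isBigO_norm_right]
    refine (h₂.norm_right).congr_right fun p => ?_
    simp
  refine (h₁'.add h₂').congr_left fun p => ?_
  rw [smul_sub, sub_smul]; abel

theorem Reg.mul {f g : ι × State → ℝ} {c d : ℝ}
    (hf : Reg l x₀ f c) (hg : Reg l x₀ g d) : Reg l x₀ (fun p => f p * g p) (c * d) :=
  hf.smul hg

theorem Reg.prodMk {f : ι × State → E} {g : ι × State → F} {c : E} {d : F}
    (hf : Reg l x₀ f c) (hg : Reg l x₀ g d) : Reg l x₀ (fun p => (f p, g p)) (c, d) :=
  ⟨hf.tendsto.prodMk_nhds hg.tendsto, hf.lip.prod_left hg.lip⟩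

/-- Locally Lipschitz functions preserve regularity. This admits `|·|` and `max`, at whose kinks a
derivative would be lost. -/
theorem Reg.comp_lipschitzOn {f : ι × State → E} {c : E} (hf : Reg l x₀ f c) {g : E → F}
    {K : NNReal} {s : Set E} (hs : s ∈ 𝓝 c) (hg : LipschitzOnWith K g s) :
    Reg l x₀ (fun p => g (f p)) (g c) := by
  refine ⟨(hg.continuousOn.continuousAt hs).tendsto.comp hf.tendsto, IsBigO.trans ?_ hf.lip⟩
  refine IsBigO.of_bound K ?_
  filter_upwards [hf.tendsto hs, hf.tendsto_base hs] with p h₁ h₂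
  exact hg.norm_sub_le h₁ h₂

theorem Reg.comp_contDiffAt {f : ι × State → E} {c : E} (hf : Reg l x₀ f c) {g : E → F}
    (hg : ContDiffAt ℝ 1 g c) : Reg l x₀ (fun p => g (f p)) (g c) := by
  obtain ⟨K, s, hs, h⟩ := hg.exists_lipschitzOnWith
  exact hf.comp_lipschitzOn hs h

theorem Reg.abs {f : ι × State → ℝ} {c : ℝ} (hf : Reg l x₀ f c) :
    Reg l x₀ (fun p => |f p|) |c| :=
  hf.comp_lipschitzOn (K := 1) univ_mem
    ((LipschitzWith.of_dist_le_mul fun a b => by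
      simpa [Real.dist_eq] using abs_abs_sub_abs_le a b : LipschitzWith 1 fun a : ℝ => |a|).lipschitzOnWith)

theorem Reg.max {f g : ι × State → ℝ} {c d : ℝ} (hf : Reg l x₀ f c) (hg : Reg l x₀ g d) :
    Reg l x₀ (fun p => max (f p) (g p)) (max c d) := by
  have h := (Reg.const (l := l) (x₀ := x₀) (1 / 2 : ℝ)).mul ((hf.add hg).add (hf.sub hg).abs)
  have e : ∀ a b : ℝ, 1 / 2 * (a + b + |a - b|) = Max.max a b := fun a b => by
    rcases le_total a b with h | h
    · rw [max_eq_right h, abs_of_nonpos (by linarith)]; ring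
    · rw [max_eq_left h, abs_of_nonneg (by linarith)]; ring
  simpa only [e] using h

theorem Reg.div {f g : ι × State → ℝ} {c d : ℝ} (hf : Reg l x₀ f c) (hg : Reg l x₀ g d)
    (hd : d ≠ 0) : Reg l x₀ (fun p => f p / g p) (c / d) := by
  simpa only [div_eq_mul_inv] using hf.mul (hg.comp_contDiffAt (contDiffAt_inv ℝ hd))

/-- The condition depends on the parameter only, so it has the same value at a point and at its base
point. With a common limit for both branches, it need not be settled along the filter. -/
theorem Reg.ite {f g : ι × State → E} {c : E} (a : ι → Prop) [DecidablePred a]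
    (hf : Reg l x₀ f c) (hg : Reg l x₀ g c) :
    Reg l x₀ (fun p => if a p.1 then f p else g p) c := by
  refine ⟨(hf.tendsto.mono_left inf_le_left).if (hg.tendsto.mono_left inf_le_left), ?_⟩
  obtain ⟨A, hA⟩ := hf.lip.bound
  obtain ⟨B, hB⟩ := hg.lip.bound
  refine IsBigO.of_bound (Max.max A B) ?_
  filter_upwards [hA, hB] with p h₁ h₂
  by_cases h : a p.1
  · simp only [base_fst, h, if_true]
    exact h₁.trans (mul_le_mul_of_nonneg_right (le_max_left _ _) (norm_nonneg _))
  · simp only [base_fst, h, if_false]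
    exact h₂.trans (mul_le_mul_of_nonneg_right (le_max_right _ _) (norm_nonneg _))

/-! ### Asymptotic derivatives -/

/-- `f` depends on the perturbation with the derivative `T`, up to a small relative error. -/
def Der (l : Filter ι) (x₀ : ι → State) (f : ι × State → E) (T : State →L[ℝ] E) : Prop :=
  (fun p => f p - f (base x₀ p) - T (incr x₀ p)) =o[pert l x₀] incr x₀

/-- Only increments from the base point enter `Der`, so parts of a functional that do not see the
perturbed state can be dropped. -/
theorem Der.congr_sub {f g : ι × State → E} {T : State →L[ℝ] E} (h : Der l x₀ f T)
    (e : ∀ᶠ p in pert l x₀, f p - f (base x₀ p) = g p - g (base x₀ p)) : Der l x₀ g T := by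
  refine IsLittleO.congr' h ?_ EventuallyEq.rfl
  filter_upwards [e] with p hp
  rw [hp]

theorem Der.add {f g : ι × State → E} {T T' : State →L[ℝ] E} (hf : Der l x₀ f T)
    (hg : Der l x₀ g T') : Der l x₀ (fun p => f p + g p) (T + T') :=
  (IsLittleO.add hf hg).congr_left fun p => by
    simp only [add_apply]; abel

theorem Der.sub {f g : ι × State → E} {T T' : State →L[ℝ] E} (hf : Der l x₀ f T)
    (hg : Der l x₀ g T') : Der l x₀ (fun p => f p - g p) (T - T') :=
  (IsLittleO.sub hf hg).congr_left fun p => by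
    simp only [sub_apply]; abel

theorem Der.const (f : ι → E) : Der l x₀ (fun p => f p.1) 0 := by
  simp [Der]

theorem Der.isBigO {f : ι × State → E} {T : State →L[ℝ] E} (hf : Der l x₀ f T) :
    (fun p => f p - f (base x₀ p)) =O[pert l x₀] incr x₀ := by
  have h := (IsLittleO.isBigO hf).add (T.isBigO_comp (incr x₀) (pert l x₀))
  exact h.congr_left fun p => by simp

/-- A convergent sequence of scalars times a function with a derivative. -/
theorem Der.smul_of_tendsto {a : ι → ℝ} {c : ℝ} (ha : Tendsto a l (𝓝 c)) {f : ι × State → E}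
    {T : State →L[ℝ] E} (hf : Der l x₀ f T) : Der l x₀ (fun p => a p.1 • f p) (c • T) := by
  have h₁ : (fun p : ι × State => (a p.1 - c) • (f p - f (base x₀ p))) =o[pert l x₀] incr x₀ := by
    have h0 : Tendsto (fun p : ι × State => a p.1 - c) (pert l x₀) (𝓝 0) := by
      simpa using (ha.comp tendsto_fst).sub_const c
    have := ((isLittleO_one_iff ℝ).2 h0).smul_isBigO hf.isBigO
    simpa using this.norm_right
  have h₂ : (fun p : ι × State => c • (f p - f (base x₀ p) - T (incr x₀ p))) =o[pert l x₀] incr x₀ :=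
    IsLittleO.const_smul_left hf c
  refine (h₁.add h₂).congr_left fun p => ?_
  simp only [smul_apply, base_fst, smul_sub, sub_smul]
  abel

/-- The linear functional `x ↦ c · x`. -/
noncomputable def covec (c : State) : State →L[ℝ] ℝ :=
  ∑ i, c i • ContinuousLinearMap.proj (R := ℝ) (φ := fun _ : Fin 4 => ℝ) i

theorem covec_apply (c x : State) : covec c x = c ⬝ᵥ x := by
  simp [covec, dotProduct]

/-- Scalar product with convergent coefficients. -/
theorem Der.dotProduct_of_tendsto {a : ι → State} {c : State} (ha : Tendsto a l (𝓝 c))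
    {f : ι × State → State} {T : State →L[ℝ] State} (hf : Der l x₀ f T) :
    Der l x₀ (fun p => a p.1 ⬝ᵥ f p) ((covec c).comp T) := by
  have h : ∀ i, Der l x₀ (fun p => f p i)
      ((ContinuousLinearMap.proj (R := ℝ) (φ := fun _ : Fin 4 => ℝ) i).comp T) := fun i =>
    ((ContinuousLinearMap.proj (R := ℝ) (φ := fun _ : Fin 4 => ℝ) i).isBigO_comp
      (fun p => f p - f (base x₀ p) - T (incr x₀ p)) (pert l x₀)).trans_isLittleO hf
  have h' := fun i => (h i).smul_of_tendsto (tendsto_pi_nhds.1 ha i)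
  have e : (covec c).comp T = ∑ i, c i •
      (ContinuousLinearMap.proj (R := ℝ) (φ := fun _ : Fin 4 => ℝ) i).comp T := by
    ext x; simp [covec]
  rw [e]
  simp only [Fin.sum_univ_four, dotProduct]
  exact (((h' 0).add (h' 1)).add (h' 2)).add (h' 3)

/-- Scalar product of coefficients that tend to zero and a regular vector. -/
theorem Der.dotProduct_of_tendsto_zero {a : ι → State} (ha : Tendsto a l (𝓝 0))
    {f : ι × State → State} {c : State} (hf : Reg l x₀ f c) :
    Der l x₀ (fun p => a p.1 ⬝ᵥ f p) 0 := by
  have h : ∀ i, Der l x₀ (fun p => a p.1 i * f p i) 0 := fun i => by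
    have h₁ : Tendsto (fun p : ι × State => a p.1 i) (pert l x₀) (𝓝 0) :=
      (tendsto_pi_nhds.1 ha i).comp tendsto_fst
    have h₂ := ((ContinuousLinearMap.proj (R := ℝ) (φ := fun _ : Fin 4 => ℝ) i).isBigO_comp
      (fun p => f p - f (base x₀ p)) (pert l x₀)).trans hf.lip
    have h₃ := (((isLittleO_one_iff ℝ).2 h₁).mul_isBigO h₂.norm_right).norm_right
    rw [Der, ← isLittleO_norm_right]
    exact h₃.congr (fun p => by simp [mul_sub]) fun p => by simp
  simp only [dotProduct, Fin.sum_univ_four]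
  simpa using (((h 0).add (h 1)).add (h 2)).add (h 3)

/-- Product of a regular scalar and a regular vector that tends to zero. -/
theorem Reg.der_smul {f : ι × State → ℝ} {g : ι × State → E} {c k : ℝ} {T : State →L[ℝ] E}
    (hf : Reg l x₀ f c) (hg : Reg l x₀ g 0) (h : Der l x₀ g T) (hk : k = c) :
    Der l x₀ (fun p => f p • g p) (k • T) := by
  subst hk
  -- Product rule with the limits split off: `(f - k) Δg`, `k (Δg - T)` and `Δf · g`. The last term
  -- is small because `g` tends to zero, so `f` needs no derivative of its own.
  have h₁ : (fun p : ι × State => (f p - k) • (g p - g (base x₀ p))) =o[pert l x₀] incr x₀ := by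
    have h0 : Tendsto (fun p : ι × State => f p - k) (pert l x₀) (𝓝 0) := by
      simpa using hf.tendsto.sub_const k
    have := ((isLittleO_one_iff ℝ).2 h0).smul_isBigO hg.lip
    simpa using this.norm_right
  have h₂ : (fun p : ι × State => k • (g p - g (base x₀ p) - T (incr x₀ p))) =o[pert l x₀] incr x₀ :=
    IsLittleO.const_smul_left h k
  have h₃ : (fun p : ι × State => (f p - f (base x₀ p)) • g (base x₀ p)) =o[pert l x₀] incr x₀ := by
    have := hf.lip.norm_right.smul_isLittleO ((isLittleO_one_iff ℝ).2 hg.tendsto_base)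
    rw [← isLittleO_norm_right]
    refine (this.norm_right).congr_right fun p => ?_
    simp
  refine ((h₁.add h₂).add h₃).congr_left fun p => ?_
  simp only [smul_apply, smul_sub, sub_smul]
  abel

/-- The base point `x₀ t` moves with the mesh, so the derivative at the limit `c` has to be strict
to control increments taken elsewhere. -/
theorem der_of_hasStrictFDerivAt {f : State → E} {T : State →L[ℝ] E} {c : State}
    (hf : HasStrictFDerivAt f T c) (h : Tendsto x₀ l (𝓝 c)) : Der l x₀ (fun p => f p.2) T := by
  have h₁ : Tendsto (fun p : ι × State => (p.2, x₀ p.1)) (pert l x₀) (𝓝 (c, c)) :=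
    (tendsto_snd h).prodMk_nhds (h.comp tendsto_fst)
  exact hf.isLittleO.comp_tendsto h₁

/-- The gradients of differentiable functions with an asymptotic derivative converge. -/
theorem Der.tendsto_grad {f : ι × State → ℝ} {T : State →L[ℝ] ℝ} (h : Der l x₀ f T)
    (hd : ∀ᶠ t in l, DifferentiableAt ℝ (fun x => f (t, x)) (x₀ t)) :
    Tendsto (fun t => grad (fun x => f (t, x)) (x₀ t)) l (𝓝 fun b => T (Pi.single b 1)) := by
  have key : Tendsto (fun t => fderiv ℝ (fun x => f (t, x)) (x₀ t)) l (𝓝 T) := by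
    rw [tendsto_iff_norm_sub_tendsto_zero, Metric.tendsto_nhds]
    intro ε hε
    have hb := IsLittleO.bound h (half_pos hε)
    rw [eventually_pert] at hb
    filter_upwards [hb, hd] with t ht hdt
    -- Near `x₀ t`, increments of `f (t, ·) - T` from `x₀ t` are at most `ε / 2` times the distance,
    -- which bounds the norm of its derivative there.
    have := (hdt.hasFDerivAt.sub T.hasFDerivAt).le_of_lip' (half_pos hε).le
      (by
        filter_upwards [ht] with x hx
        simp only [incr, base, map_sub, Pi.sub_apply] at hx ⊢
        convert hx using 2
        ring)
    rw [dist_zero_right, norm_norm]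
    linarith
  rw [tendsto_pi_nhds]
  intro b
  exact ((ContinuousLinearMap.apply ℝ ℝ (Pi.single b (1 : ℝ) : State)).continuous.tendsto T).comp key

end Perturbation

/-! ### Regularity of the Euler fluxes -/

section Euler

variable {γ : ℝ}

theorem contDiffAt_pressure {W : State} (h : W 0 ≠ 0) : ContDiffAt ℝ 1 (pressure γ) W := by
  unfold pressure
  have : (2 : ℝ) * W 0 ≠ 0 := mul_ne_zero two_ne_zero h
  fun_prop (disch := assumption)

theorem contDiffAt_velocity {W : State} (h : W 0 ≠ 0) : ContDiffAt ℝ 1 velocity W := by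
  unfold velocity
  fun_prop (disch := assumption)

theorem contDiffAt_fluxX {W : State} (h : W 0 ≠ 0) : ContDiffAt ℝ 1 (fluxX γ) W := by
  have hp := contDiffAt_pressure (γ := γ) h
  rw [contDiffAt_pi]
  intro i
  fin_cases i <;> simp [fluxX] <;> fun_prop (disch := assumption)

theorem contDiffAt_fluxY {W : State} (h : W 0 ≠ 0) : ContDiffAt ℝ 1 (fluxY γ) W := by
  have hp := contDiffAt_pressure (γ := γ) h
  rw [contDiffAt_pi]
  intro i
  fin_cases i <;> simp [fluxY] <;> fun_prop (disch := assumption)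

theorem contDiffAt_soundSpeed (hγ : 1 < γ) {W : State} (h : W ∈ physical γ) :
    ContDiffAt ℝ 1 (soundSpeed γ) W := by
  have h0 := h.1.ne'
  have hp := contDiffAt_pressure (γ := γ) h0
  have : γ * pressure γ W / W 0 ≠ 0 := by
    have := h.1; have := h.2; positivity
  unfold soundSpeed
  fun_prop (disch := assumption)

theorem isOpen_physical : IsOpen (physical γ) := by
  rw [isOpen_iff_mem_nhds]
  intro W hW
  have h0 : Tendsto (fun V : State => V 0) (𝓝 W) (𝓝 (W 0)) := (continuous_apply 0).tendsto W
  have h1 := (contDiffAt_pressure (γ := γ) hW.1.ne').continuousAt.tendsto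
  filter_upwards [h0.eventually_const_lt hW.1, h1.eventually_const_lt hW.2] with V h₁ h₂
  exact ⟨h₁, h₂⟩

theorem InterfaceMean.contDiffAt (m : InterfaceMean γ) {W : State} (h : W ∈ physical γ) :
    ContDiffAt ℝ 1 (fun q : State × State => m.toFun q.1 q.2) (W, W) :=
  m.contDiffOn.contDiffAt ((isOpen_physical.prod isOpen_physical).mem_nhds ⟨h, h⟩)

theorem BoundaryState.contDiffAt (B : BoundaryState γ) {W : State} (h : W ∈ physical γ)
    {n : ℝ × ℝ} (hn : n ≠ 0) :
    ContDiffAt ℝ 1 (fun q : State × (ℝ × ℝ) => B.state q.1 q.2) (W, n) :=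
  B.contDiffOn.contDiffAt ((isOpen_physical.prod isOpen_ne).mem_nhds ⟨h, hn⟩)

theorem flux_smul (W : State) (c : ℝ) (S : ℝ × ℝ) : flux γ W (c • S) = c • flux γ W S := by
  simp [flux, mul_smul]

theorem dot_smul_right (c : ℝ) (a S : ℝ × ℝ) : dot a (c • S) = c * dot a S := by
  simp [dot]; ring

theorem dot_self_nonneg (a : ℝ × ℝ) : 0 ≤ dot a a := by
  unfold dot; nlinarith [mul_self_nonneg a.1, mul_self_nonneg a.2]

theorem len_smul {c : ℝ} (hc : 0 ≤ c) (a : ℝ × ℝ) : len (c • a) = c * len a := by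
  have : dot (c • a) (c • a) = c ^ 2 * dot a a := by simp [dot]; ring
  rw [len, this, Real.sqrt_mul (sq_nonneg c), Real.sqrt_sq hc, len]

theorem len_pos {a : ℝ × ℝ} (ha : a ≠ 0) : 0 < len a := by
  refine Real.sqrt_pos.2 (lt_of_le_of_ne (dot_self_nonneg a) fun h => ha ?_)
  unfold dot at h
  ext
  · exact mul_self_eq_zero.1 (by nlinarith [mul_self_nonneg a.1, mul_self_nonneg a.2])
  · exact mul_self_eq_zero.1 (by nlinarith [mul_self_nonneg a.1, mul_self_nonneg a.2])

theorem continuous_len : Continuous len := by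
  unfold len dot; fun_prop

theorem continuousAt_unit {a : ℝ × ℝ} (ha : a ≠ 0) : ContinuousAt unit a := by
  unfold unit
  exact (continuous_len.continuousAt.inv₀ (len_pos ha).ne').smul continuousAt_id

theorem unit_smul {c : ℝ} (hc : 0 < c) (a : ℝ × ℝ) : unit (c • a) = unit a := by
  rw [unit, unit, len_smul hc.le, smul_smul, mul_inv]
  congr 1
  field_simp

theorem unit_ne_zero {a : ℝ × ℝ} (ha : a ≠ 0) : unit a ≠ 0 :=
  smul_ne_zero (inv_ne_zero (len_pos ha).ne') ha

theorem dot_unit_eq_zero {v a : ℝ × ℝ} (ha : a ≠ 0) : dot v (unit a) = 0 ↔ dot v a = 0 := by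
  rw [unit, dot_smul_right, mul_eq_zero, or_iff_right (inv_ne_zero (len_pos ha).ne')]

theorem spectralRadius_smul (W : State) {c : ℝ} (hc : 0 ≤ c) (S : ℝ × ℝ) :
    spectralRadius γ W (c • S) = c * spectralRadius γ W S := by
  rw [spectralRadius, spectralRadius, dot_smul_right, len_smul hc, abs_mul, abs_of_nonneg hc]
  ring

/-- Flux through a face along which the flow slips. -/
theorem flux_of_slip {W : State} (h0 : W 0 ≠ 0) {S : ℝ × ℝ} (h : dot (velocity W) S = 0) :
    flux γ W S = pressure γ W • ![0, S.1, S.2, 0] := by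
  -- The mass flux vanishes, and every convective part of the flux is a multiple of it.
  have e : W 1 * S.1 + W 2 * S.2 = 0 := by
    simp only [dot, velocity] at h
    field_simp at h
    linarith
  ext i
  fin_cases i <;> simp [flux, fluxX, fluxY] <;> field_simp
  · linear_combination e
  · linear_combination W 1 * e
  · linear_combination W 2 * e
  · linear_combination (W 3 + pressure γ W) * e

/-- Derivative of `W ↦ 𝐅(W) · S`. -/
noncomputable def fluxDeriv (γ : ℝ) (W : State) (S : ℝ × ℝ) : State →L[ℝ] State :=
  S.1 • fderiv ℝ (fluxX γ) W + S.2 • fderiv ℝ (fluxY γ) W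

variable {ι : Type*} {l : Filter ι} {x₀ : ι → State}

theorem Reg.flux {u : ι × State → State} {W : State} (hu : Reg l x₀ u W) (h : W 0 ≠ 0)
    {S : ι → ℝ × ℝ} {s : ℝ × ℝ} (hS : Tendsto S l (𝓝 s)) :
    Reg l x₀ (fun p => flux γ (u p) (S p.1)) (flux γ W s) :=
  ((Reg.of_fst ((continuous_fst.tendsto s).comp hS)).smul
    (hu.comp_contDiffAt (contDiffAt_fluxX h))).add
  ((Reg.of_fst ((continuous_snd.tendsto s).comp hS)).smul
    (hu.comp_contDiffAt (contDiffAt_fluxY h)))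

theorem der_flux {W : State} (hx : Tendsto x₀ l (𝓝 W)) (h : W 0 ≠ 0)
    {S : ι → ℝ × ℝ} {s : ℝ × ℝ} (hS : Tendsto S l (𝓝 s)) :
    Der l x₀ (fun p => JST.flux γ p.2 (S p.1)) (fluxDeriv γ W s) :=
  ((der_of_hasStrictFDerivAt ((contDiffAt_fluxX h).hasStrictFDerivAt one_ne_zero) hx).smul_of_tendsto
    ((continuous_fst.tendsto s).comp hS)).add
  ((der_of_hasStrictFDerivAt ((contDiffAt_fluxY h).hasStrictFDerivAt one_ne_zero) hx).smul_of_tendsto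
    ((continuous_snd.tendsto s).comp hS))

theorem Reg.spectralRadius (hγ : 1 < γ) {u : ι × State → State} {W : State} (hu : Reg l x₀ u W)
    (h : W ∈ physical γ) {S : ι → ℝ × ℝ} {s : ℝ × ℝ} (hS : Tendsto S l (𝓝 s)) :
    Reg l x₀ (fun p => spectralRadius γ (u p) (S p.1)) (spectralRadius γ W s) := by
  have hv := hu.comp_contDiffAt (contDiffAt_velocity h.1.ne')
  have h₁ := hv.comp_contDiffAt (g := Prod.fst) contDiffAt_fst
  have h₂ := hv.comp_contDiffAt (g := Prod.snd) contDiffAt_snd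
  exact ((h₁.mul (Reg.of_fst ((continuous_fst.tendsto s).comp hS))).add
    (h₂.mul (Reg.of_fst ((continuous_snd.tendsto s).comp hS)))).abs.add
    ((hu.comp_contDiffAt (contDiffAt_soundSpeed hγ h)).mul
      (Reg.of_fst ((continuous_len.tendsto s).comp hS)))

theorem Reg.mean (m : InterfaceMean γ) {u v : ι × State → State} {W : State} (hu : Reg l x₀ u W)
    (hv : Reg l x₀ v W) (h : W ∈ physical γ) : Reg l x₀ (fun p => m.toFun (u p) (v p)) W := by
  have := (hu.prodMk hv).comp_contDiffAt (m.contDiffAt h)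
  simpa only [m.self W h] using this

theorem Reg.boundary (B : BoundaryState γ) {u : ι × State → State} {W : State}
    (hu : Reg l x₀ u W) (h : W ∈ physical γ) {n : ι → ℝ × ℝ} {n₀ : ℝ × ℝ}
    (hn : Tendsto n l (𝓝 n₀)) (hn₀ : n₀ ≠ 0) (hc : W ∈ B.conditions n₀) :
    Reg l x₀ (fun p => B.state (u p) (n p.1)) W := by
  have := (hu.prodMk (Reg.of_fst hn)).comp_contDiffAt (B.contDiffAt h hn₀)
  simpa only [B.state_eq_self W h n₀ hn₀ hc] using this

end Euler

/-! ### Fluxes along one line of cells -/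

namespace Line

variable {γ : ℝ}

/-- The same scheme on another line of cells. -/
def on (T : Line γ) (n : ℤ) (S : ℤ → ℝ × ℝ) : Line γ := { T with n := n, S := S }

/-- The flux formula at the faces that are not boundary faces. -/
noncomputable def innerFlux (L : Line γ) (w : ℤ → State) (k : ℤ) : State :=
  (1 / 2 : ℝ) • (flux γ (w k) (L.S k) + flux γ (w (k + 1)) (L.S k))
    - (L.k₂ * L.faceSensor w k * L.kappa w k) • (w (k + 1) - w k)
    + (L.kBar w k * L.kappa w k) • L.difference w k

theorem numFlux_of_inner (L : Line γ) (w : ℤ → State) {k : ℤ} (h : 1 ≤ k ∧ k ≤ L.n - 1) :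
    L.numFlux w k = L.innerFlux w k := by
  rw [numFlux, if_neg (by omega), if_neg (by omega), innerFlux]

/-- The flux through a face depends on four cells. -/
theorem numFlux_congr (L : Line γ) {w w' : ℤ → State} {k : ℤ} (h0 : 0 ≤ k) (hn : k ≤ L.n)
    (hw : ∀ i, k - 1 ≤ i → i ≤ k + 2 → w i = w' i) : L.numFlux w k = L.numFlux w' k := by
  unfold numFlux
  split_ifs with h₁ h₂
  · rw [firstState, firstState, hw 1 (by omega) (by omega)]
  · rw [lastState, lastState, hw L.n (by omega) (by omega)]
  -- The ghost pressures at `0` and `n + 1` are needed only for `k = 1` and `k = n - 1`, whose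
  -- stencils contain the cells `1` and `n` that determine them.
  · have hp : ∀ i, k - 1 ≤ i → i ≤ k + 2 → L.press w i = L.press w' i := fun i hi hi' => by
      unfold press firstState lastState
      split_ifs
      · rw [hw 1 (by omega) (by omega)]
      · rw [hw L.n (by omega) (by omega)]
      · rw [hw i hi hi']
    have hs : L.faceSensor w k = L.faceSensor w' k := by
      unfold faceSensor sensor
      rw [hp (k + 1) (by omega) (by omega), hp k (by omega) (by omega),
        hp (k - 1) (by omega) (by omega), hp (k + 1 + 1) (by omega) (by omega),
        hp (k + 1 - 1) (by omega) (by omega)]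
    have hd : L.difference w k = L.difference w' k := by
      unfold difference firstState lastState
      split_ifs
      · rw [hw 1 (by omega) (by omega), hw 2 (by omega) (by omega), hw 3 (by omega) (by omega)]
      · rw [hw L.n (by omega) (by omega), hw (L.n - 1) (by omega) (by omega),
          hw (L.n - 2) (by omega) (by omega)]
      · rw [hw k (by omega) (by omega), hw (k + 1) (by omega) (by omega),
          hw (k + 2) (by omega) (by omega), hw (k - 1) (by omega) (by omega)]
    rw [kBar, kBar, kappa, kappa, hs, hd, hw k (by omega) (by omega),
      hw (k + 1) (by omega) (by omega)]

theorem numFlux_update_of_far (L : Line γ) (w : ℤ → State) {k m : ℤ} (x y : State) (h0 : 0 ≤ k)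
    (hn : k ≤ L.n) (hm : k < m - 2 ∨ m + 1 < k) :
    L.numFlux (Function.update w m x) k = L.numFlux (Function.update w m y) k :=
  L.numFlux_congr h0 hn fun i hi hi' => by
    rw [Function.update_of_ne (by omega), Function.update_of_ne (by omega)]

end Line

/-! ### Summation by parts -/

/-- Abel summation moves the difference from the fluxes to the adjoint field. The boundary flux `G
0` that is left over is the source of the wall condition. -/
theorem sum_by_parts (Λ G : ℤ → State) {n : ℤ} (hn : 1 ≤ n) :
    ∑ k ∈ Finset.Icc 1 n, Λ k ⬝ᵥ (G k - G (k - 1)) = Λ n ⬝ᵥ G n - Λ 1 ⬝ᵥ G 0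
      + ∑ k ∈ Finset.Icc 1 (n - 1), (Λ k - Λ (k + 1)) ⬝ᵥ G k := by
  induction n, hn using Int.leInduction with
  | base => simp [dotProduct_sub]
  | succ n hn ih =>
    rw [← Finset.insert_Icc_right_eq_Icc_add_one (by omega), Finset.sum_insert (by simp), ih,
      add_sub_cancel_right, ← Finset.insert_Icc_sub_one_right_eq_Icc (a := (1 : ℤ)) (b := n) hn,
      Finset.sum_insert (by simp)]
    simp only [dotProduct_sub, sub_dotProduct]
    ring

/-- Reindexing by the offset from `m` leaves four terms whatever the position of the cell; offsets
that do not lead to an inner face contribute zero. -/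
theorem sum_stencil {f : ℤ → ℝ} {m n : ℤ}
    (hf : ∀ k, 1 ≤ k → k ≤ n - 1 → (k < m - 2 ∨ m + 1 < k) → f k = 0) :
    ∑ k ∈ Finset.Icc 1 (n - 1), f k =
      ∑ o ∈ Finset.Icc (-2 : ℤ) 1, if 1 ≤ m + o ∧ m + o ≤ n - 1 then f (m + o) else 0 := by
  rw [← Finset.sum_filter]
  symm
  refine Finset.sum_bij_ne_zero (fun o _ _ => m + o) ?_ ?_ ?_ ?_
  · intro o ho _
    simp only [Finset.mem_filter, Finset.mem_Icc] at ho ⊢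
    omega
  · intro a _ _ b _ _ h
    omega
  · intro k hk hk'
    rw [Finset.mem_Icc] at hk
    have : ¬ (k < m - 2 ∨ m + 1 < k) := fun h => hk' (hf k hk.1 hk.2 h)
    refine ⟨k - m, ?_, ?_, by omega⟩
    · simp only [Finset.mem_filter, Finset.mem_Icc]
      omega
    · rwa [add_sub_cancel]
  · intros; rfl

/-! ### Lines of cells under mesh refinement -/

/-- Near the cell `m` of a line, the states tend to `W₀` and the face vectors, divided by their
size `h`, tend to `s`; a boundary is far away or compatible with the limit state. -/
structure LineLimit {ι : Type*} (l : Filter ι) {γ : ℝ} (T : Line γ) (n : ι → ℤ)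
    (S : ι → ℤ → ℝ × ℝ) (w : ι → ℤ → State) (m : ι → ℤ) (h : ι → ℝ) (W₀ : State) (s : ℝ × ℝ) :
    Prop where
  one_lt : 1 < γ
  k₄_nonneg : 0 ≤ T.k₄
  h_pos : ∀ᶠ t in l, 0 < h t
  physical : W₀ ∈ physical γ
  state : ∀ o : ℤ, Tendsto (fun t => w t (m t + o)) l (𝓝 W₀)
  face : ∀ o : ℤ, Tendsto (fun t => (h t)⁻¹ • S t (m t + o)) l (𝓝 s)
  first : (∀ᶠ t in l, 4 < m t) ∨ ∃ n₀ : ℝ × ℝ, n₀ ≠ 0 ∧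
    Tendsto (fun t => unit (S t 0)) l (𝓝 n₀) ∧ W₀ ∈ T.first.conditions n₀
  last : (∀ᶠ t in l, m t + 4 ≤ n t) ∨ ∃ n₀ : ℝ × ℝ, n₀ ≠ 0 ∧
    Tendsto (fun t => unit (S t (n t))) l (𝓝 n₀) ∧ W₀ ∈ T.last.conditions n₀

/-- The states along a line, that of cell `m` being perturbed. -/
def perturbed {ι : Type*} (w : ι → ℤ → State) (m : ι → ℤ) (p : ι × State) : ℤ → State :=
  Function.update (w p.1) (m p.1) p.2

namespace LineLimit

variable {ι : Type*} {l : Filter ι} {γ : ℝ} {T : Line γ} {n : ι → ℤ} {S : ι → ℤ → ℝ × ℝ}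
  {w : ι → ℤ → State} {m : ι → ℤ} {h : ι → ℝ} {W₀ : State} {s : ℝ × ℝ}

local notation "xm" => fun t => w t (m t)

local notation "um" => perturbed w m

theorem tendsto_self (H : LineLimit l T n S w m h W₀ s) : Tendsto xm l (𝓝 W₀) := by
  simpa using H.state 0

theorem perturbed_self (p : ι × State) : um p (m p.1) = p.2 := by simp [perturbed]

theorem perturbed_of_ne (p : ι × State) {o : ℤ} (ho : o ≠ 0) :
    um p (m p.1 + o) = w p.1 (m p.1 + o) := by
  rw [perturbed, Function.update_of_ne (by omega)]

theorem reg_cell (H : LineLimit l T n S w m h W₀ s) (o : ℤ) :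
    Reg l xm (fun p => um p (m p.1 + o)) W₀ := by
  rcases eq_or_ne o 0 with rfl | ho
  · simpa only [add_zero, perturbed_self] using Reg.snd H.tendsto_self
  · simpa only [perturbed_of_ne _ ho] using Reg.of_fst (H.state o)

theorem der_cell (H : LineLimit l T n S w m h W₀ s) (o : ℤ) :
    Der l xm (fun p => um p (m p.1 + o)) (if o = 0 then ContinuousLinearMap.id ℝ State else 0) := by
  split_ifs with ho
  · subst ho
    simpa only [add_zero, perturbed_self] using
      der_of_hasStrictFDerivAt (f := fun x => x) (hasStrictFDerivAt_id (𝕜 := ℝ) W₀) H.tendsto_self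
  · simpa only [perturbed_of_ne _ ho] using Der.const fun t => w t (m t + o)

theorem reg_pressure (H : LineLimit l T n S w m h W₀ s) (o : ℤ) :
    Reg l xm (fun p => pressure γ (um p (m p.1 + o))) (pressure γ W₀) :=
  (H.reg_cell o).comp_contDiffAt (contDiffAt_pressure H.physical.1.ne')

theorem reg_ghostPressure (H : LineLimit l T n S w m h W₀ s) {b : ι × State → State} (o : ℤ)
    (hb : Reg l xm b W₀) :
    Reg l xm (fun p => 2 * pressure γ (b p) - pressure γ (um p (m p.1 + o))) (pressure γ W₀) := by
  have := ((Reg.const (2 : ℝ)).mul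
    (hb.comp_contDiffAt (contDiffAt_pressure (γ := γ) H.physical.1.ne'))).sub (H.reg_pressure o)
  convert this using 1
  ring

/-- The boundary state of `W₀` is `W₀`, so a ghost pressure and an ordinary one have the same limit
and `Reg.ite` applies without knowing which of them occurs. If the side is far away, the distance
required in `LineLimit` exceeds the reach `3` of the sensors, and no ghost pressure occurs. -/
theorem reg_press (H : LineLimit l T n S w m h W₀ s) {o : ℤ} (h₁ : -3 ≤ o) (h₂ : o ≤ 3) :
    Reg l xm (fun p => (T.on (n p.1) (S p.1)).press (um p) (m p.1 + o)) (pressure γ W₀) := by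
  have hl : Reg l xm (fun p => if m p.1 + o = n p.1 + 1 then
      2 * pressure γ (T.last.state (um p (n p.1)) (unit (S p.1 (n p.1)))) - pressure γ (um p (n p.1))
      else pressure γ (um p (m p.1 + o))) (pressure γ W₀) := by
    rcases H.last with hm | ⟨n₀, hn₀, hS, hc⟩
    · refine (H.reg_pressure o).congr ?_
      filter_upwards [tendsto_fst.eventually hm] with p hp
      rw [if_neg (by omega)]
    · refine (Reg.ite (fun t => m t + o = n t + 1) (H.reg_ghostPressure (o - 1)
        ((H.reg_cell (o - 1)).boundary T.last H.physical hS hn₀ hc)) (H.reg_pressure o)).congr ?_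
      refine Eventually.of_forall fun p => ?_
      by_cases hp : m p.1 + o = n p.1 + 1
      · simp only [hp, if_true, show m p.1 + (o - 1) = n p.1 by omega]
      · simp only [hp, if_false]
  rcases H.first with hm | ⟨n₀, hn₀, hS, hc⟩
  · refine hl.congr ?_
    filter_upwards [tendsto_fst.eventually hm] with p hp
    rw [Line.press, if_neg (c := m p.1 + o = 0) (by omega)]
    rfl
  · refine (Reg.ite (fun t => m t + o = 0) (H.reg_ghostPressure (o + 1)
        ((H.reg_cell (o + 1)).boundary T.first H.physical hS hn₀ hc)) hl).congr ?_
    refine Eventually.of_forall fun p => ?_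
    by_cases hp : m p.1 + o = 0
    · simp only [hp, if_true, show m p.1 + (o + 1) = 1 by omega, Line.press]
      rfl
    · simp only [hp, if_false, Line.press]
      rfl

/-- The three pressures share a positive limit, so the numerator tends to zero and the denominator
to `4 p`. The limit lies on the kink of the absolute value, hence a Lipschitz bound rather than a
derivative. -/
theorem reg_sensor (H : LineLimit l T n S w m h W₀ s) {o : ℤ} (h₁ : -2 ≤ o) (h₂ : o ≤ 2) :
    Reg l xm (fun p => (T.on (n p.1) (S p.1)).sensor (um p) (m p.1 + o)) 0 := by
  have a := H.reg_press (o := o + 1) (by omega) (by omega)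
  have b := H.reg_press (o := o) (by omega) (by omega)
  have c := H.reg_press (o := o - 1) (by omega) (by omega)
  have b' := (Reg.const (l := l) (x₀ := xm) (2 : ℝ)).mul b
  have hp := H.physical.2
  have := ((a.sub b').add c).abs.div ((a.add b').add c) (by positivity)
  have e : |pressure γ W₀ - 2 * pressure γ W₀ + pressure γ W₀| = 0 := by
    rw [abs_eq_zero]; ring
  rw [e, zero_div] at this
  simpa only [Line.sensor, ← add_assoc, ← add_sub_assoc] using this

theorem reg_faceSensor (H : LineLimit l T n S w m h W₀ s) {o : ℤ} (h₁ : -2 ≤ o) (h₂ : o ≤ 1) :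
    Reg l xm (fun p => (T.on (n p.1) (S p.1)).faceSensor (um p) (m p.1 + o)) 0 := by
  have := (H.reg_sensor h₁ (by omega)).max (H.reg_sensor (o := o + 1) (by omega) (by omega))
  rw [max_self] at this
  simpa only [Line.faceSensor, ← add_assoc] using this

theorem reg_kBar (H : LineLimit l T n S w m h W₀ s) {o : ℤ} (h₁ : -2 ≤ o) (h₂ : o ≤ 1) :
    Reg l xm (fun p => (T.on (n p.1) (S p.1)).kBar (um p) (m p.1 + o)) T.k₄ := by
  have := (Reg.const (l := l) (x₀ := xm) (0 : ℝ)).max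
    ((Reg.const T.k₄).sub ((H.reg_faceSensor h₁ h₂).mul (Reg.const T.k₂)))
  rw [zero_mul, sub_zero, max_eq_right H.k₄_nonneg] at this
  exact this

theorem reg_kappa (H : LineLimit l T n S w m h W₀ s) (o : ℤ) :
    Reg l xm (fun p => spectralRadius γ (T.mean.toFun (um p (m p.1 + o)) (um p (m p.1 + (o + 1))))
      ((h p.1)⁻¹ • S p.1 (m p.1 + o))) (spectralRadius γ W₀ s) :=
  (Reg.mean T.mean (H.reg_cell o) (H.reg_cell (o + 1)) H.physical).spectralRadius H.one_lt
    H.physical (H.face o)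

/-- In each of the three formulas the coefficients add up to zero, so equal limits cancel. -/
theorem reg_closure (v : Closure) {x₀' : ι → State} {a b c g : ι × State → State}
    (ha : Reg l x₀' a W₀) (hb : Reg l x₀' b W₀) (hc : Reg l x₀' c W₀) (hg : Reg l x₀' g W₀) :
    Reg l x₀' (fun p => v.difference (a p) (b p) (c p) (g p)) 0 := by
  have e (k : ℝ) {f : ι × State → State} (hf : Reg l x₀' f W₀) :=
    (Reg.const (l := l) (x₀ := x₀') k).smul hf
  cases v
  · convert (hc.sub (e 3 hb)).add (e 2 ha) using 1
    · rfl
    · module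
  · convert (hc.sub (e 2 hb)).add ha using 1
    · rfl
    · module
  · convert ((hc.sub (e 3 hb)).add (e 3 ha)).sub hg using 1
    · rfl
    · module

theorem reg_mirror {x₀' : ι → State} {b c : ι × State → State}
    (hb : Reg l x₀' b W₀) (hc : Reg l x₀' c W₀) :
    Reg l x₀' (fun p => (2 : ℝ) • b p - c p) W₀ := by
  convert ((Reg.const (2 : ℝ)).smul hb).sub hc using 1
  module

theorem reg_difference (H : LineLimit l T n S w m h W₀ s) {o : ℤ} (h₁ : -2 ≤ o) (h₂ : o ≤ 1) :
    Reg l xm (fun p => (T.on (n p.1) (S p.1)).difference (um p) (m p.1 + o)) 0 := by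
  have e (k : ℝ) {f : ι × State → State} (hf : Reg l xm f W₀) :=
    (Reg.const (l := l) (x₀ := xm) k).smul hf
  have hi : Reg l xm (fun p => um p (m p.1 + (o + 2)) - (3 : ℝ) • um p (m p.1 + (o + 1))
      + (3 : ℝ) • um p (m p.1 + o) - um p (m p.1 + (o - 1))) 0 := by
    convert (((H.reg_cell (o + 2)).sub (e 3 (H.reg_cell (o + 1)))).add (e 3 (H.reg_cell o))).sub
      (H.reg_cell (o - 1)) using 1
    module
  have hl : Reg l xm (fun p => if m p.1 + o = n p.1 - 1 then
      -T.closure.difference (um p (n p.1)) (um p (n p.1 - 1)) (um p (n p.1 - 2))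
        ((2 : ℝ) • T.last.state (um p (n p.1)) (unit (S p.1 (n p.1))) - um p (n p.1))
      else um p (m p.1 + (o + 2)) - (3 : ℝ) • um p (m p.1 + (o + 1))
      + (3 : ℝ) • um p (m p.1 + o) - um p (m p.1 + (o - 1))) 0 := by
    rcases H.last with hm | ⟨n₀, hn₀, hS, hc⟩
    · refine hi.congr ?_
      filter_upwards [tendsto_fst.eventually hm] with p hp
      rw [if_neg (by omega)]
    · have hb := (H.reg_cell (o + 1)).boundary T.last H.physical hS hn₀ hc
      have hd := (reg_closure T.closure (H.reg_cell (o + 1)) (H.reg_cell o) (H.reg_cell (o - 1))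
        (reg_mirror hb (H.reg_cell (o + 1)))).neg
      rw [neg_zero] at hd
      refine (Reg.ite (fun t => m t + o = n t - 1) hd hi).congr ?_
      refine Eventually.of_forall fun p => ?_
      by_cases hp : m p.1 + o = n p.1 - 1
      · simp only [hp, if_true, show m p.1 + (o + 1) = n p.1 by omega,
          show m p.1 + (o - 1) = n p.1 - 2 by omega]
      · simp only [hp, if_false]
  -- The same function with the indices associated as in `Line.difference`.
  have hl' : Reg l xm (fun p => if m p.1 + o = n p.1 - 1 then
      -T.closure.difference (um p (n p.1)) (um p (n p.1 - 1)) (um p (n p.1 - 2))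
        ((2 : ℝ) • T.last.state (um p (n p.1)) (unit (S p.1 (n p.1))) - um p (n p.1))
      else um p (m p.1 + o + 2) - (3 : ℝ) • um p (m p.1 + o + 1)
      + (3 : ℝ) • um p (m p.1 + o) - um p (m p.1 + o - 1)) 0 := by
    simpa only [← add_assoc, ← add_sub_assoc] using hl
  rcases H.first with hm | ⟨n₀, hn₀, hS, hc⟩
  · refine hl'.congr ?_
    filter_upwards [tendsto_fst.eventually hm] with p hp
    rw [Line.difference, if_neg (c := m p.1 + o = 1) (by omega)]
    rfl
  · have hb := (H.reg_cell o).boundary T.first H.physical hS hn₀ hc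
    have hd := reg_closure T.closure (H.reg_cell o) (H.reg_cell (o + 1)) (H.reg_cell (o + 2))
      (reg_mirror hb (H.reg_cell o))
    refine (Reg.ite (fun t => m t + o = 1) hd hl').congr ?_
    refine Eventually.of_forall fun p => ?_
    by_cases hp : m p.1 + o = 1
    · simp only [hp, if_true, show m p.1 + (o + 1) = 2 by omega,
        show m p.1 + (o + 2) = 3 by omega, Line.difference]
      rfl
    · simp only [hp, if_false, Line.difference]
      rfl

/-- The inner fluxes per unit of coordinate length. -/
theorem smul_innerFlux (L : Line γ) (v : ℤ → State) (k : ℤ) {c : ℝ} (hc : 0 < c) :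
    c⁻¹ • L.innerFlux v k =
      (1 / 2 : ℝ) • (flux γ (v k) (c⁻¹ • L.S k) + flux γ (v (k + 1)) (c⁻¹ • L.S k))
      - (L.k₂ * L.faceSensor v k *
          spectralRadius γ (L.mean.toFun (v k) (v (k + 1))) (c⁻¹ • L.S k)) • (v (k + 1) - v k)
      + (L.kBar v k * spectralRadius γ (L.mean.toFun (v k) (v (k + 1))) (c⁻¹ • L.S k)) •
          L.difference v k := by
  have hc' : 0 ≤ c⁻¹ := by positivity
  rw [Line.innerFlux, Line.kappa, flux_smul, flux_smul, spectralRadius_smul _ hc']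
  module

theorem innerFlux_eventuallyEq (H : LineLimit l T n S w m h W₀ s) (o : ℤ) :
    (fun p => (1 / 2 : ℝ) • (flux γ (um p (m p.1 + o)) ((h p.1)⁻¹ • S p.1 (m p.1 + o))
        + flux γ (um p (m p.1 + (o + 1))) ((h p.1)⁻¹ • S p.1 (m p.1 + o)))
      - (T.k₂ * (T.on (n p.1) (S p.1)).faceSensor (um p) (m p.1 + o) *
          spectralRadius γ (T.mean.toFun (um p (m p.1 + o)) (um p (m p.1 + (o + 1))))
            ((h p.1)⁻¹ • S p.1 (m p.1 + o))) • (um p (m p.1 + (o + 1)) - um p (m p.1 + o))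
      + ((T.on (n p.1) (S p.1)).kBar (um p) (m p.1 + o) *
          spectralRadius γ (T.mean.toFun (um p (m p.1 + o)) (um p (m p.1 + (o + 1))))
            ((h p.1)⁻¹ • S p.1 (m p.1 + o))) • (T.on (n p.1) (S p.1)).difference (um p) (m p.1 + o))
    =ᶠ[pert l xm] fun p => (h p.1)⁻¹ • (T.on (n p.1) (S p.1)).innerFlux (um p) (m p.1 + o) := by
  filter_upwards [tendsto_fst.eventually H.h_pos] with p hp
  rw [smul_innerFlux _ _ _ hp, add_assoc]
  rfl

/-- The value of the limit is irrelevant: in wall cells the flux is paired with coefficients that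
tend to zero, and the Lipschitz bound suffices. -/
theorem reg_innerFlux (H : LineLimit l T n S w m h W₀ s) {o : ℤ} (h₁ : -2 ≤ o) (h₂ : o ≤ 1) :
    ∃ c, Reg l xm (fun p => (h p.1)⁻¹ • (T.on (n p.1) (S p.1)).innerFlux (um p) (m p.1 + o)) c := by
  have hp := H.physical.1.ne'
  exact ⟨_, Reg.congr ((((Reg.const (1 / 2 : ℝ)).smul (((H.reg_cell o).flux hp (H.face o)).add
    ((H.reg_cell (o + 1)).flux hp (H.face o)))).sub
    ((((Reg.const T.k₂).mul (H.reg_faceSensor h₁ h₂)).mul (H.reg_kappa o)).smul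
      ((H.reg_cell (o + 1)).sub (H.reg_cell o)))).add
    (((H.reg_kBar h₁ h₂).mul (H.reg_kappa o)).smul (H.reg_difference h₁ h₂)))
    (H.innerFlux_eventuallyEq o)⟩

theorem der_centralFlux (H : LineLimit l T n S w m h W₀ s) (o o' : ℤ) :
    Der l xm (fun p => flux γ (um p (m p.1 + o)) ((h p.1)⁻¹ • S p.1 (m p.1 + o')))
      (if o = 0 then fluxDeriv γ W₀ s else 0) := by
  split_ifs with ho
  · subst ho
    simpa only [add_zero, perturbed_self] using
      der_flux H.tendsto_self H.physical.1.ne' (H.face o')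
  · simpa only [perturbed_of_ne _ ho] using
      Der.const fun t => flux γ (w t (m t + o)) ((h t)⁻¹ • S t (m t + o'))

theorem _root_.JST.Der.congr_eventuallyEq {ι E : Type*} [NormedAddCommGroup E] [NormedSpace ℝ E]
    {l : Filter ι} {y₀ : ι → State} {f g : ι × State → E} {A : State →L[ℝ] E} (hf : Der l y₀ f A)
    (e : f =ᶠ[pert l y₀] g) : Der l y₀ g A := by
  refine hf.congr_sub ?_
  filter_upwards [e, tendsto_base.eventually e] with p h₁ h₂
  rw [h₁, h₂]

/-- Derivative of the flux through the face `m + o + 1/2` with respect to the state of cell `m`, if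
the higher difference contains the state of cell `m` with the coefficient `c`. -/
theorem der_innerFlux (H : LineLimit l T n S w m h W₀ s) {o : ℤ} (h₁ : -2 ≤ o) (h₂ : o ≤ 1) {c : ℝ}
    (hd : ∀ᶠ t in l, ∀ x y, (T.on (n t) (S t)).difference (Function.update (w t) (m t) x) (m t + o)
      - (T.on (n t) (S t)).difference (Function.update (w t) (m t) y) (m t + o) = c • (x - y)) :
    Der l xm (fun p => (h p.1)⁻¹ • (T.on (n p.1) (S p.1)).innerFlux (um p) (m p.1 + o))
      ((1 / 2 : ℝ) • ((if o = 0 then fluxDeriv γ W₀ s else 0)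
          + if o + 1 = 0 then fluxDeriv γ W₀ s else 0)
        + (T.k₄ * spectralRadius γ W₀ s) • c • ContinuousLinearMap.id ℝ State) := by
  have hD : Der l xm (fun p => (T.on (n p.1) (S p.1)).difference (um p) (m p.1 + o))
      (c • ContinuousLinearMap.id ℝ State) := by
    refine IsLittleO.congr' (isLittleO_zero _ _) ?_ EventuallyEq.rfl
    filter_upwards [tendsto_fst.eventually hd] with p hp
    have := hp p.2 (w p.1 (m p.1))
    simp only [perturbed, base, this, incr, smul_apply, ContinuousLinearMap.id_apply, sub_self]
  have hcell : Reg l xm (fun p => um p (m p.1 + (o + 1)) - um p (m p.1 + o)) 0 := by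
    simpa using (H.reg_cell (o + 1)).sub (H.reg_cell o)
  -- Both factors vanish in the limit, the sensor and the difference of states, so this dissipation
  -- has derivative `0`.
  have hnu := (((Reg.const T.k₂).mul (H.reg_faceSensor h₁ h₂)).mul (H.reg_kappa o)).der_smul hcell
    ((H.der_cell (o + 1)).sub (H.der_cell o)) (k := 0) (by simp)
  -- Here the scalar factor tends to `k⁴ κ`; only the explicit dependence of the difference on the
  -- perturbed state survives.
  have hk := ((H.reg_kBar h₁ h₂).mul (H.reg_kappa o)).der_smul (H.reg_difference h₁ h₂) hD rfl
  have hc := ((H.der_centralFlux o o).add (H.der_centralFlux (o + 1) o)).smul_of_tendsto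
    (a := fun _ => (1 / 2 : ℝ)) tendsto_const_nhds
  have := (hc.sub hnu).add hk
  rw [zero_smul, sub_zero] at this
  exact this.congr_eventuallyEq (H.innerFlux_eventuallyEq o)

end LineLimit

/-! ### Weighted flux balance of a line and its derivative -/

/-- The coefficient of the state of the second cell in the higher difference at the second face. -/
def Closure.second (v : Closure) : ℝ :=
  match v with
  | .a => -3
  | .b => -2
  | .c => -3

namespace Line

variable {γ : ℝ}

/-- The boundary and mirror states depend on the cells `1` and `n` only. For any other cell the
higher difference is affine in its state, and the coefficient can be read off the formulas. -/
theorem difference_update_sub (L : Line γ) (w : ℤ → State) {m : ℤ} (h1 : m ≠ 1) (hn : m ≠ L.n)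
    (k : ℤ) (x y : State) :
    L.difference (Function.update w m x) k - L.difference (Function.update w m y) k =
      (if k = 1 then if m = 3 then 1 else if m = 2 then L.closure.second else 0
      else if k = L.n - 1 then
        -if m = L.n - 2 then 1 else if m = L.n - 1 then L.closure.second else 0
      else if k + 2 = m then 1 else if k + 1 = m then -3 else if k = m then 3
      else if k - 1 = m then -1 else (0 : ℝ)) • (x - y) := by
  have hX : ∀ i, Function.update w m x i =
      Function.update w m y i + (if i = m then (1 : ℝ) else 0) • (x - y) := fun i => by
    by_cases hi : i = m
    · subst hi; simp
    · simp [hi]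
  have h1' : Function.update w m x 1 = Function.update w m y 1 := by
    rw [hX, if_neg h1.symm, zero_smul, add_zero]
  have hn' : Function.update w m x L.n = Function.update w m y L.n := by
    rw [hX, if_neg hn.symm, zero_smul, add_zero]
  unfold difference firstState lastState
  rw [h1', hn']
  split_ifs with hk _ _ hk _ _ <;>
    first
    | (rw [hX 2, hX 3]; cases L.closure <;> simp only [Closure.difference, Closure.second] <;>
        split_ifs <;> first | omega | module)
    | (rw [hX (L.n - 1), hX (L.n - 2)]; cases L.closure <;>
        simp only [Closure.difference, Closure.second] <;>
        split_ifs <;> first | omega | module)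
    | (rw [hX (k + 2), hX (k + 1), hX k, hX (k - 1)]; split_ifs <;> first | omega | module)

/-- The sum of the flux balances of the cells of a line, weighted with `Λ`. -/
noncomputable def balance (L : Line γ) (Λ w : ℤ → State) : ℝ :=
  ∑ k ∈ Finset.Icc 1 L.n, Λ k ⬝ᵥ (L.numFlux w k - L.numFlux w (k - 1))

/-- Summation by parts is applied to the change of the fluxes, which is zero outside the stencil of
cell `m`. The two boundary terms vanish later unless `m` is an end cell. -/
theorem balance_update_sub (L : Line γ) (Λ w : ℤ → State) {m : ℤ} (h1 : 1 ≤ m) (hn : m ≤ L.n)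
    (x y : State) :
    L.balance Λ (Function.update w m x) - L.balance Λ (Function.update w m y) =
      Λ L.n ⬝ᵥ (L.numFlux (Function.update w m x) L.n - L.numFlux (Function.update w m y) L.n)
      - Λ 1 ⬝ᵥ (L.numFlux (Function.update w m x) 0 - L.numFlux (Function.update w m y) 0)
      + ∑ o ∈ Finset.Icc (-2 : ℤ) 1, if 1 ≤ m + o ∧ m + o ≤ L.n - 1 then
          (Λ (m + o) - Λ (m + o + 1)) ⬝ᵥ (L.innerFlux (Function.update w m x) (m + o)
            - L.innerFlux (Function.update w m y) (m + o)) else 0 := by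
  have e := sum_by_parts Λ (fun k => L.numFlux (Function.update w m x) k
    - L.numFlux (Function.update w m y) k) (h1.trans hn)
  rw [sum_stencil (m := m)] at e
  · rw [balance, balance, ← Finset.sum_sub_distrib]
    convert e using 1
    · refine Finset.sum_congr rfl fun k _ => ?_
      rw [← dotProduct_sub]
      congr 1
      abel
    · congr 1
      refine Finset.sum_congr rfl fun o _ => ?_
      refine if_ctx_congr Iff.rfl (fun h => ?_) fun _ => rfl
      rw [L.numFlux_of_inner _ h, L.numFlux_of_inner _ h]
  · intro k hk hk' hm
    rw [L.numFlux_update_of_far w x y (by omega) (by omega) hm, sub_self, dotProduct_zero]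

theorem numFlux_zero_update (L : Line γ) (w : ℤ → State) {m : ℤ} (h1 : m ≠ 1) (x y : State) :
    L.numFlux (Function.update w m x) 0 = L.numFlux (Function.update w m y) 0 := by
  simp [numFlux, firstState, Function.update_of_ne h1.symm]

theorem numFlux_last_update (L : Line γ) (w : ℤ → State) {m : ℤ} (hL : L.n ≠ 0) (hn : m ≠ L.n)
    (x y : State) :
    L.numFlux (Function.update w m x) L.n = L.numFlux (Function.update w m y) L.n := by
  simp [numFlux, lastState, Function.update_of_ne hn.symm, hL]

end Line

namespace LineLimit

variable {ι : Type*} {l : Filter ι} {γ : ℝ} {T : Line γ} {n : ι → ℤ} {S : ι → ℤ → ℝ × ℝ}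
  {w : ι → ℤ → State} {m : ι → ℤ} {h : ι → ℝ} {W₀ : State} {s : ℝ × ℝ}

local notation "xm" => fun t => w t (m t)

local notation "um" => perturbed w m

theorem sum_stencil_offsets (f : ℤ → ℝ) :
    ∑ o ∈ Finset.Icc (-2 : ℤ) 1, f o = f (-2) + f (-1) + f 0 + f 1 := by
  rw [show Finset.Icc (-2 : ℤ) 1 = {-2, -1, 0, 1} by decide]
  simp
  ring

theorem _root_.JST.Der.congr_right {ι E : Type*} [NormedAddCommGroup E] [NormedSpace ℝ E]
    {l : Filter ι} {y₀ : ι → State} {f : ι × State → E} {A B : State →L[ℝ] E} (hf : Der l y₀ f A)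
    (e : A = B) : Der l y₀ f B := e ▸ hf

theorem _root_.JST.Der.congr_sub_of_forall {ι E : Type*} [NormedAddCommGroup E] [NormedSpace ℝ E]
    {l : Filter ι} {y₀ : ι → State} {f g : ι × State → E} {A : State →L[ℝ] E} (hf : Der l y₀ f A)
    (e : ∀ᶠ t in l, ∀ x, f (t, x) - f (t, y₀ t) = g (t, x) - g (t, y₀ t)) : Der l y₀ g A :=
  hf.congr_sub ((tendsto_fst.eventually e).mono fun p hp => hp p.2)

/-- Derivative of the weighted sum of the flux balances with respect to the state of a cell that is
not adjacent to the boundary. The coefficients of that state in the higher differences are `c o`. -/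
theorem der_balance (H : LineLimit l T n S w m h W₀ s)
    (hm : ∀ᶠ t in l, 2 ≤ m t ∧ m t ≤ n t - 1) {Λ : ι → ℤ → State} {τ : ι → ℝ} {Λ' : State}
    (hΛ : ∀ o : ℤ, Tendsto (fun t => (τ t)⁻¹ • (Λ t (m t + o + 1) - Λ t (m t + o))) l (𝓝 Λ'))
    (c : ℤ → ℝ)
    (hc : ∀ o : ℤ, -2 ≤ o → o ≤ 1 →
      (∀ᶠ t in l, (1 ≤ m t + o ∧ m t + o ≤ n t - 1) ∧ ∀ x y,
        (T.on (n t) (S t)).difference (Function.update (w t) (m t) x) (m t + o)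
        - (T.on (n t) (S t)).difference (Function.update (w t) (m t) y) (m t + o) = c o • (x - y)) ∨
      (c o = 0 ∧ o ≠ 0 ∧ o + 1 ≠ 0 ∧ ∀ᶠ t in l, ¬ (1 ≤ m t + o ∧ m t + o ≤ n t - 1))) :
    Der l xm (fun p => (τ p.1)⁻¹ * (h p.1)⁻¹ * (T.on (n p.1) (S p.1)).balance (Λ p.1) (um p))
      ((covec (-Λ')).comp (fluxDeriv γ W₀ s + (T.k₄ * spectralRadius γ W₀ s *
        (c (-2) + c (-1) + c 0 + c 1)) • ContinuousLinearMap.id ℝ State)) := by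
  -- All four offsets get one formula. An offset without inner face has `c o = 0` and is neither `0`
  -- nor `-1`, so the formula gives zero for it too.
  have hf : ∀ o : ℤ, -2 ≤ o → o ≤ 1 → Der l xm (fun p => if 1 ≤ m p.1 + o ∧ m p.1 + o ≤ n p.1 - 1 then
      ((τ p.1)⁻¹ • (Λ p.1 (m p.1 + o) - Λ p.1 (m p.1 + o + 1))) ⬝ᵥ
        ((h p.1)⁻¹ • (T.on (n p.1) (S p.1)).innerFlux (um p) (m p.1 + o)) else 0)
      ((covec (-Λ')).comp ((1 / 2 : ℝ) • ((if o = 0 then fluxDeriv γ W₀ s else 0)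
          + if o + 1 = 0 then fluxDeriv γ W₀ s else 0)
        + (T.k₄ * spectralRadius γ W₀ s) • c o • ContinuousLinearMap.id ℝ State)) := by
    intro o h₁ h₂
    rcases hc o h₁ h₂ with hi | ⟨h0, ho, ho', hi⟩
    -- Summation by parts produces `Λ_k - Λ_{k+1}`; this is the origin of the minus sign in the
    -- adjoint equation.
    · have ha : Tendsto (fun t => (τ t)⁻¹ • (Λ t (m t + o) - Λ t (m t + o + 1))) l (𝓝 (-Λ')) := by
        refine (hΛ o).neg.congr fun t => ?_
        rw [← smul_neg, neg_sub]
      refine (Der.dotProduct_of_tendsto ha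
        (H.der_innerFlux h₁ h₂ (hi.mono fun t ht => ht.2))).congr_eventuallyEq ?_
      filter_upwards [tendsto_fst.eventually hi] with p hp
      rw [if_pos hp.1]
    · rw [h0, if_neg ho, if_neg ho']
      refine ((Der.const fun _ => (0 : ℝ)).congr_right (by simp)).congr_eventuallyEq ?_
      filter_upwards [tendsto_fst.eventually hi] with p hp
      rw [if_neg hp]
  refine (((((hf (-2) (by simp) (by simp)).add (hf (-1) (by simp) (by simp))).add
    (hf 0 (by simp) (by simp))).add (hf 1 (by simp) (by simp))).congr_sub_of_forall ?_).congr_right ?_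
  · filter_upwards [hm] with t ht x
    have e := (T.on (n t) (S t)).balance_update_sub (Λ t) (w t) (m := m t)
      (by omega) (show m t ≤ n t by omega) x (w t (m t))
    rw [(T.on (n t) (S t)).numFlux_zero_update (w t) (by omega) _ (w t (m t)),
      (T.on (n t) (S t)).numFlux_last_update (w t) (show n t ≠ 0 by omega)
        (show m t ≠ n t by omega) _ (w t (m t)), sub_self, sub_self, dotProduct_zero,
      dotProduct_zero, sub_zero, zero_add, sum_stencil_offsets,
      show (T.on (n t) (S t)).n = n t from rfl] at e
    have key : ∀ (q : Prop) [Decidable q] (a b c : State),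
        ((if q then (τ t)⁻¹ • a ⬝ᵥ (h t)⁻¹ • b else 0)
        - if q then (τ t)⁻¹ • a ⬝ᵥ (h t)⁻¹ • c else 0) =
        if q then (τ t)⁻¹ * (h t)⁻¹ * (a ⬝ᵥ (b - c)) else 0 := by
      intro q _ a b c
      split_ifs
      · simp only [smul_dotProduct, dotProduct_smul, dotProduct_sub, smul_eq_mul]
        ring
      · simp
    dsimp only [perturbed]
    rw [← mul_sub, e]
    simp only [mul_add, mul_ite, mul_zero]
    rw [add_sub_add_comm, add_sub_add_comm, add_sub_add_comm, key, key, key, key]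
  -- The offsets `-1` and `0` contribute half a Jacobian each; the dissipation coefficients add up.
  · rw [← ContinuousLinearMap.comp_add, ← ContinuousLinearMap.comp_add,
      ← ContinuousLinearMap.comp_add]
    congr 1
    norm_num
    module

/-- In a boundary cell, the weighted sum of the flux balances is dominated by the boundary flux. -/
theorem der_balance_first (H : LineLimit l T n S w m h W₀ s)
    (hm : ∀ᶠ t in l, m t = 1 ∧ 2 ≤ n t) {Λ : ι → ℤ → State}
    (hΛ : ∀ o : ℤ, Tendsto (fun t => Λ t (m t + o + 1) - Λ t (m t + o)) l (𝓝 0)) :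
    Der l xm (fun p => (h p.1)⁻¹ * ((T.on (n p.1) (S p.1)).balance (Λ p.1) (um p)
      + Λ p.1 1 ⬝ᵥ (T.on (n p.1) (S p.1)).numFlux (um p) 0)) 0 := by
  have hf : ∀ o : ℤ, -2 ≤ o → o ≤ 1 → Der l xm (fun p =>
      (if 1 ≤ m p.1 + o ∧ m p.1 + o ≤ n p.1 - 1 then
        Λ p.1 (m p.1 + o) - Λ p.1 (m p.1 + o + 1) else 0) ⬝ᵥ
        ((h p.1)⁻¹ • (T.on (n p.1) (S p.1)).innerFlux (um p) (m p.1 + o))) 0 := by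
    intro o h₁ h₂
    -- The jump of `Λ` is not divided by a mesh width here, so it tends to zero and no derivative of
    -- the inner flux is required.
    obtain ⟨c, hc⟩ := H.reg_innerFlux h₁ h₂
    have ha : Tendsto (fun t => if 1 ≤ m t + o ∧ m t + o ≤ n t - 1 then
        Λ t (m t + o) - Λ t (m t + o + 1) else 0) l (𝓝 0) := by
      refine Tendsto.if (Tendsto.mono_left ?_ inf_le_left) tendsto_const_nhds
      simpa using (hΛ o).neg
    exact Der.dotProduct_of_tendsto_zero ha hc
  refine (((((hf (-2) (by simp) (by simp)).add (hf (-1) (by simp) (by simp))).add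
    (hf 0 (by simp) (by simp))).add (hf 1 (by simp) (by simp))).congr_sub_of_forall ?_).congr_right
      (by simp)
  filter_upwards [hm] with t ht x
  have e := (T.on (n t) (S t)).balance_update_sub (Λ t) (w t) (m := m t)
    (by omega) (show m t ≤ n t by omega) x (w t (m t))
  rw [(T.on (n t) (S t)).numFlux_last_update (w t) (show n t ≠ 0 by omega)
    (show m t ≠ n t by omega) _ (w t (m t)), sub_self, dotProduct_zero, zero_sub,
    sum_stencil_offsets, ← sub_eq_iff_eq_add', show (T.on (n t) (S t)).n = n t from rfl] at e
  have key : ∀ (q : Prop) [Decidable q] (a b c : State), ((if q then a else 0) ⬝ᵥ (h t)⁻¹ • b)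
      - ((if q then a else 0) ⬝ᵥ (h t)⁻¹ • c) =
      if q then (h t)⁻¹ * (a ⬝ᵥ (b - c)) else 0 := by
    intro q _ a b c
    split_ifs
    · simp only [dotProduct_smul, dotProduct_sub, smul_eq_mul]
      ring
    · simp
  dsimp only [perturbed]
  rw [← mul_sub, add_sub_add_comm ((T.on (n t) (S t)).balance _ _), ← dotProduct_sub,
    ← sub_neg_eq_add _ (Λ t 1 ⬝ᵥ _), e]
  simp only [mul_add, mul_ite, mul_zero]
  rw [add_sub_add_comm, add_sub_add_comm, add_sub_add_comm, key, key, key, key]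

end LineLimit

/-- Position of a cell on a line, away from the first and last cells: interior, or second, or last
but one. The number `δ` is the sum of the coefficients of the state of that cell in the higher
differences of all faces. -/
def LinePosition {ι : Type*} (l : Filter ι) (v : Closure) (n m : ι → ℤ) (δ : ℝ) : Prop :=
  (δ = 0 ∧ ∀ᶠ t in l, 3 ≤ m t ∧ m t ≤ n t - 2) ∨
  (δ = v.second + 2 ∧ ∀ᶠ t in l, m t = 2 ∧ 5 ≤ n t) ∨
  (δ = -(v.second + 2) ∧ ∀ᶠ t in l, m t = n t - 1 ∧ 5 ≤ n t)

namespace LineLimit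

variable {ι : Type*} {l : Filter ι} {γ : ℝ} {T : Line γ} {n : ι → ℤ} {S : ι → ℤ → ℝ × ℝ}
  {w : ι → ℤ → State} {m : ι → ℤ} {h : ι → ℝ} {W₀ : State} {s : ℝ × ℝ}

/-- The coefficient sums are `1 - 3 + 3 - 1` inside, `second + 3 - 1` in the second cell and `1 - 3
- second` in the last but one. The third cell counts as interior: all three formulas keep the
coefficient `1` of `W₃`. -/
theorem der_balance_of_position (H : LineLimit l T n S w m h W₀ s) {δ : ℝ}
    (hδ : LinePosition l T.closure n m δ) {Λ : ι → ℤ → State} {τ : ι → ℝ} {Λ' : State}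
    (hΛ : ∀ o : ℤ, Tendsto (fun t => (τ t)⁻¹ • (Λ t (m t + o + 1) - Λ t (m t + o))) l (𝓝 Λ')) :
    Der l (fun t => w t (m t))
      (fun p => (τ p.1)⁻¹ * (h p.1)⁻¹ *
        (T.on (n p.1) (S p.1)).balance (Λ p.1) (perturbed w m p))
      ((covec (-Λ')).comp (fluxDeriv γ W₀ s +
        (T.k₄ * spectralRadius γ W₀ s * δ) • ContinuousLinearMap.id ℝ State)) := by
  rcases hδ with ⟨rfl, hm⟩ | ⟨rfl, hm⟩ | ⟨rfl, hm⟩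
  · refine (H.der_balance (hm.mono fun t ht => by omega) hΛ
      (fun o => if o = -2 then 1 else if o = -1 then -3 else if o = 0 then 3 else -1)
      fun o h₁ h₂ => Or.inl (hm.mono fun t ht => ⟨by omega, fun x y => ?_⟩)).congr_right ?_
    · rw [Line.difference_update_sub _ _ (by omega) (show m t ≠ n t by omega),
        show (T.on (n t) (S t)).n = n t from rfl]
      congr 1
      split_ifs <;> first | omega | norm_num
    · norm_num
  · refine (H.der_balance (hm.mono fun t ht => by omega) hΛ
      (fun o => if o = -2 then 0 else if o = -1 then T.closure.second else if o = 0 then 3 else -1)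
      fun o h₁ h₂ => ?_).congr_right ?_
    · rcases eq_or_ne o (-2) with rfl | ho
      -- For `m = 2` the offset `-2` is the boundary face `0`, which has no higher difference; hence
      -- three coefficients only.
      · exact Or.inr ⟨by simp, by simp, by simp, hm.mono fun t ht => by omega⟩
      · refine Or.inl (hm.mono fun t ht => ⟨by omega, fun x y => ?_⟩)
        rw [Line.difference_update_sub _ _ (by omega) (show m t ≠ n t by omega),
          show (T.on (n t) (S t)).n = n t from rfl,
          show (T.on (n t) (S t)).closure = T.closure from rfl]
        congr 1
        split_ifs <;> first | omega | norm_num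
    · have e : ∀ z : ℝ, z + 3 + -1 = z + 2 := fun z => by ring
      norm_num [e]
  · refine (H.der_balance (hm.mono fun t ht => by omega) hΛ
      (fun o => if o = -2 then 1 else if o = -1 then -3 else if o = 0 then -T.closure.second else 0)
      fun o h₁ h₂ => ?_).congr_right ?_
    · rcases eq_or_ne o 1 with rfl | ho
      · exact Or.inr ⟨by simp, by simp, by simp, hm.mono fun t ht => by omega⟩
      · refine Or.inl (hm.mono fun t ht => ⟨by omega, fun x y => ?_⟩)
        rw [Line.difference_update_sub _ _ (by omega) (show m t ≠ n t by omega),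
          show (T.on (n t) (S t)).n = n t from rfl,
          show (T.on (n t) (S t)).closure = T.closure from rfl]
        congr 1
        split_ifs <;> first | omega | norm_num
    · norm_num

end LineLimit

/-! ### Mesh refinement -/

/-- Meshes that are refined while a cell converges to a point of the unit square. -/
structure MeshLimit {ι : Type*} (l : Filter ι) (N M : ι → ℕ) (q : ι → ℤ × ℤ) (P : ℝ × ℝ) : Prop where
  N_atTop : Tendsto N l atTop
  M_atTop : Tendsto M l atTop
  centre : Tendsto (fun t => Config.centre (N t) (M t) (q t)) l (𝓝 P)
  mem : ∀ᶠ t in l, (1 ≤ (q t).1 ∧ (q t).1 ≤ N t) ∧ 1 ≤ (q t).2 ∧ (q t).2 ≤ M t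

/-- Difference quotients of a function with a strict derivative. -/
theorem tendsto_differenceQuotient {ι E : Type*} [NormedAddCommGroup E] [NormedSpace ℝ E]
    {l : Filter ι} {f : ℝ × ℝ → E} {P v : ℝ × ℝ} (hf : ContDiff ℝ ∞ f) {a b : ι → ℝ × ℝ}
    {c : ι → ℝ} (ha : Tendsto a l (𝓝 P)) (hb : Tendsto b l (𝓝 P)) (hc : ∀ᶠ t in l, c t ≠ 0)
    (hab : ∀ t, a t - b t = c t • v) :
    Tendsto (fun t => (c t)⁻¹ • (f (a t) - f (b t))) l (𝓝 (fderiv ℝ f P v)) := by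
  have hs : HasStrictFDerivAt f (fderiv ℝ f P) P :=
    hf.contDiffAt.hasStrictFDerivAt (by simp)
  have h₁ := hs.isLittleO.comp_tendsto (ha.prodMk_nhds hb)
  have h₂ : (fun t => (c t)⁻¹ • (f (a t) - f (b t) - fderiv ℝ f P (a t - b t))) =o[l]
      fun _ => v := by
    have := (isBigO_refl (fun t => (c t)⁻¹) l).smul_isLittleO h₁
    refine this.congr' (Eventually.of_forall fun t => rfl) ?_
    filter_upwards [hc] with t ht
    simp [hab, smul_smul, ht]
  have h₄ : Tendsto (fun t => (c t)⁻¹ • (f (a t) - f (b t) - fderiv ℝ f P (a t - b t))) l (𝓝 0) :=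
    (isLittleO_one_iff ℝ).1 (h₂.trans_isBigO (isBigO_const_const v (one_ne_zero (α := ℝ)) l))
  have := h₄.add_const (fderiv ℝ f P v)
  rw [zero_add] at this
  refine this.congr' ?_
  filter_upwards [hc] with t ht
  rw [hab, map_smul, smul_sub, smul_smul, inv_mul_cancel₀ ht, one_smul, sub_add_cancel]

theorem square_isCompact : IsCompact square := isCompact_Icc.prod isCompact_Icc

theorem centre_mem_square {N M : ℕ} {q : ℤ × ℤ}
    (h : (1 ≤ q.1 ∧ q.1 ≤ N) ∧ 1 ≤ q.2 ∧ q.2 ≤ M) : Config.centre N M q ∈ square := by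
  have aux : ∀ (n : ℕ) (k : ℤ), 1 ≤ k → k ≤ n → ((k : ℝ) - 1 / 2) / n ∈ Set.Icc (0 : ℝ) 1 := by
    intro n k h₁ h₂
    have h₁' : (1 : ℝ) ≤ k := by exact_mod_cast h₁
    have h₂' : (k : ℝ) ≤ n := by exact_mod_cast h₂
    exact ⟨div_nonneg (by linarith) (by linarith), (div_le_one (by linarith)).2 (by linarith)⟩
  exact ⟨aux N _ h.1.1 h.1.2, aux M _ h.2.1 h.2.2⟩

namespace MeshLimit

variable {ι : Type*} {l : Filter ι} {N M : ι → ℕ} {q : ι → ℤ × ℤ} {P : ℝ × ℝ}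

theorem inv_N (H : MeshLimit l N M q P) : Tendsto (fun t => 1 / (N t : ℝ)) l (𝓝 0) :=
  tendsto_one_div_atTop_nhds_zero_nat.comp H.N_atTop

theorem inv_M (H : MeshLimit l N M q P) : Tendsto (fun t => 1 / (M t : ℝ)) l (𝓝 0) :=
  tendsto_one_div_atTop_nhds_zero_nat.comp H.M_atTop

theorem N_pos (H : MeshLimit l N M q P) : ∀ᶠ t in l, 0 < 1 / (N t : ℝ) := by
  filter_upwards [H.N_atTop.eventually_gt_atTop 0] with t ht
  positivity

theorem M_pos (H : MeshLimit l N M q P) : ∀ᶠ t in l, 0 < 1 / (M t : ℝ) := by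
  filter_upwards [H.M_atTop.eventually_gt_atTop 0] with t ht
  positivity

theorem le_N (H : MeshLimit l N M q P) (k : ℤ) : ∀ᶠ t in l, k ≤ N t := by
  filter_upwards [H.N_atTop.eventually_ge_atTop k.toNat] with t ht
  omega

theorem mem_square [l.NeBot] (H : MeshLimit l N M q P) : P ∈ square :=
  square_isCompact.isClosed.mem_of_tendsto H.centre (H.mem.mono fun _ ht => centre_mem_square ht)

theorem tendsto_fst (H : MeshLimit l N M q P) (a : ℝ) :
    Tendsto (fun t => (((q t).1 : ℝ) + a) / N t) l (𝓝 P.1) := by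
  have h₁ := (continuous_fst.tendsto P).comp H.centre
  have h₂ := h₁.add (H.inv_N.const_mul (a + 1 / 2))
  rw [mul_zero, add_zero] at h₂
  refine h₂.congr fun t => ?_
  simp only [Function.comp, Config.centre]
  ring

theorem tendsto_snd (H : MeshLimit l N M q P) (a : ℝ) :
    Tendsto (fun t => (((q t).2 : ℝ) + a) / M t) l (𝓝 P.2) := by
  have h₁ := (continuous_snd.tendsto P).comp H.centre
  have h₂ := h₁.add (H.inv_M.const_mul (a + 1 / 2))
  rw [mul_zero, add_zero] at h₂
  refine h₂.congr fun t => ?_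
  simp only [Function.comp, Config.centre]
  ring

theorem tendsto_centre (H : MeshLimit l N M q P) (a b : ℤ) :
    Tendsto (fun t => Config.centre (N t) (M t) ((q t).1 + a, (q t).2 + b)) l (𝓝 P) := by
  refine ((H.tendsto_fst (a - 1 / 2)).prodMk_nhds (H.tendsto_snd (b - 1 / 2))).congr fun t => ?_
  simp only [Config.centre]
  push_cast
  congr 2 <;> ring

theorem tendsto_node (H : MeshLimit l N M q P) (a b : ℤ) :
    Tendsto (fun t => Config.node (N t) (M t) ((q t).1 + a) ((q t).2 + b)) l (𝓝 P) := by
  refine ((H.tendsto_fst a).prodMk_nhds (H.tendsto_snd b)).congr fun t => ?_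
  simp only [Config.node]
  push_cast
  rfl

end MeshLimit

/-! ### Scaled face vectors and their limits -/

namespace Config

variable {γ : ℝ} {C : Config γ} {D : Scheme γ} {ι : Type*} {l : Filter ι} {N M : ι → ℕ}
  {P : ℝ × ℝ}

theorem tendsto_faceξ (hC : C.Admissible D) (hM : ∀ᶠ t in l, 0 < 1 / (M t : ℝ)) {k j : ι → ℤ}
    (h₁ : Tendsto (fun t => node (N t) (M t) (k t) (j t)) l (𝓝 P))
    (h₂ : Tendsto (fun t => node (N t) (M t) (k t) (j t - 1)) l (𝓝 P)) :
    Tendsto (fun t => (1 / (M t : ℝ))⁻¹ • C.faceξ (N t) (M t) (k t) (j t)) l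
      (𝓝 (C.normalξ P)) := by
  have e : ∀ t, node (N t) (M t) (k t) (j t) - node (N t) (M t) (k t) (j t - 1) =
      (1 / (M t : ℝ)) • ((0, 1) : ℝ × ℝ) := fun t => by
    simp [node, sub_div]
  have hx := tendsto_differenceQuotient hC.smooth_x h₁ h₂ (hM.mono fun t ht => ht.ne') e
  have hy := tendsto_differenceQuotient hC.smooth_y h₁ h₂ (hM.mono fun t ht => ht.ne') e
  refine (hy.prodMk_nhds hx.neg).congr fun t => ?_
  ext
  · rfl
  · simp only [faceξ, Prod.smul_snd, smul_eq_mul]; ring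

theorem tendsto_faceη (hC : C.Admissible D) (hN : ∀ᶠ t in l, 0 < 1 / (N t : ℝ)) {i k : ι → ℤ}
    (h₁ : Tendsto (fun t => node (N t) (M t) (i t) (k t)) l (𝓝 P))
    (h₂ : Tendsto (fun t => node (N t) (M t) (i t - 1) (k t)) l (𝓝 P)) :
    Tendsto (fun t => (1 / (N t : ℝ))⁻¹ • C.faceη (N t) (M t) (i t) (k t)) l
      (𝓝 (C.normalη P)) := by
  have e : ∀ t, node (N t) (M t) (i t) (k t) - node (N t) (M t) (i t - 1) (k t) =
      (1 / (N t : ℝ)) • ((1, 0) : ℝ × ℝ) := fun t => by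
    simp [node, sub_div]
  have hx := tendsto_differenceQuotient hC.smooth_x h₁ h₂ (hN.mono fun t ht => ht.ne') e
  have hy := tendsto_differenceQuotient hC.smooth_y h₁ h₂ (hN.mono fun t ht => ht.ne') e
  refine (hy.neg.prodMk_nhds hx).congr fun t => ?_
  ext
  · simp only [faceη, Prod.smul_fst, smul_eq_mul]; ring
  · rfl

theorem normalξ_ne_zero (hC : C.Admissible D) (hP : P ∈ square) : C.normalξ P ≠ 0 := by
  intro h
  have h₁ : dη C.y P = 0 := congrArg Prod.fst h
  have h₂ : -dη C.x P = 0 := congrArg Prod.snd h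
  have := hC.jacobian_pos P hP
  rw [h₁, neg_eq_zero.1 h₂] at this
  simp at this

theorem normalη_ne_zero (hC : C.Admissible D) (hP : P ∈ square) : C.normalη P ≠ 0 := by
  intro h
  have h₁ : -dξ C.y P = 0 := congrArg Prod.fst h
  have h₂ : dξ C.x P = 0 := congrArg Prod.snd h
  have := hC.jacobian_pos P hP
  rw [h₂, neg_eq_zero.1 h₁] at this
  simp at this

/-- The face vectors shrink to zero, but normalisation ignores positive factors and is continuous at
the nonzero limit of the scaled vectors. -/
theorem tendsto_unit_of_smul {S : ι → ℝ × ℝ} {c : ι → ℝ} {s : ℝ × ℝ} (hs : s ≠ 0)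
    (hc : ∀ᶠ t in l, 0 < c t) (h : Tendsto (fun t => (c t)⁻¹ • S t) l (𝓝 s)) :
    Tendsto (fun t => unit (S t)) l (𝓝 (unit s)) := by
  refine ((continuousAt_unit hs).tendsto.comp h).congr' ?_
  filter_upwards [hc] with t ht
  exact unit_smul (inv_pos.2 ht) _

end Config

/-- An integer sequence that is not eventually large along an ultrafilter stays bounded. -/
theorem eventually_lt_or_le {ι : Type*} (l : Ultrafilter ι) (a b : ι → ℤ) :
    (∀ᶠ t in (l : Filter ι), a t < b t) ∨ ∀ᶠ t in (l : Filter ι), b t ≤ a t := by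
  rw [← Ultrafilter.eventually_or]
  exact Eventually.of_forall fun t => lt_or_ge _ _

/-! ### Rows and columns through a converging cell -/

namespace MeshLimit

variable {ι : Type*} {l : Ultrafilter ι} {N M : ι → ℕ} {q : ι → ℤ × ℤ} {P : ℝ × ℝ} {γ : ℝ}
  {C : Config γ} {D : Scheme γ}

theorem fst_eq_zero (H : MeshLimit l N M q P) (h : ∀ᶠ t in (l : Filter ι), (q t).1 ≤ 4) :
    P.1 = 0 := by
  refine tendsto_nhds_unique (H.tendsto_fst 0) ?_
  refine squeeze_zero' ?_ ?_ (by simpa only [mul_zero] using H.inv_N.const_mul 4)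
  · filter_upwards [H.mem] with t ht
    have : (1 : ℝ) ≤ (q t).1 := by exact_mod_cast ht.1.1
    positivity
  · filter_upwards [h] with t ht
    have : ((q t).1 : ℝ) ≤ 4 := by exact_mod_cast ht
    rw [add_zero, div_eq_mul_one_div]
    gcongr

theorem snd_eq_zero (H : MeshLimit l N M q P) (h : ∀ᶠ t in (l : Filter ι), (q t).2 ≤ 4) :
    P.2 = 0 := by
  refine tendsto_nhds_unique (H.tendsto_snd 0) ?_
  refine squeeze_zero' ?_ ?_ (by simpa only [mul_zero] using H.inv_M.const_mul 4)
  · filter_upwards [H.mem] with t ht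
    have : (1 : ℝ) ≤ (q t).2 := by exact_mod_cast ht.2.1
    positivity
  · filter_upwards [h] with t ht
    have : ((q t).2 : ℝ) ≤ 4 := by exact_mod_cast ht
    rw [add_zero, div_eq_mul_one_div]
    gcongr

theorem fst_eq_one (H : MeshLimit l N M q P) (h : ∀ᶠ t in (l : Filter ι), (N t : ℤ) < (q t).1 + 4) :
    P.1 = 1 := by
  have h0 : Tendsto (fun t => 1 - (((q t).1 : ℝ) + 0) / N t) l (𝓝 0) := by
    refine squeeze_zero' ?_ ?_ (by simpa only [mul_zero] using H.inv_N.const_mul 4)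
    · filter_upwards [H.mem, H.N_pos] with t ht hN
      have : ((q t).1 : ℝ) ≤ N t := by exact_mod_cast ht.1.2
      rw [add_zero, sub_nonneg]
      exact (div_le_one (one_div_pos.1 hN)).2 this
    · filter_upwards [h, H.N_pos] with t ht hN
      have : (N t : ℝ) < (q t).1 + 4 := by exact_mod_cast ht
      have hN' := one_div_pos.1 hN
      rw [mul_one_div, add_zero, sub_le_iff_le_add, ← add_div, le_div_iff₀ hN']
      linarith
  have := tendsto_nhds_unique ((H.tendsto_fst 0).const_sub 1) h0
  linarith

theorem snd_eq_one (H : MeshLimit l N M q P) (h : ∀ᶠ t in (l : Filter ι), (M t : ℤ) < (q t).2 + 4) :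
    P.2 = 1 := by
  have h0 : Tendsto (fun t => 1 - (((q t).2 : ℝ) + 0) / M t) l (𝓝 0) := by
    refine squeeze_zero' ?_ ?_ (by simpa only [mul_zero] using H.inv_M.const_mul 4)
    · filter_upwards [H.mem, H.M_pos] with t ht hN
      have : ((q t).2 : ℝ) ≤ M t := by exact_mod_cast ht.2.2
      rw [add_zero, sub_nonneg]
      exact (div_le_one (one_div_pos.1 hN)).2 this
    · filter_upwards [h, H.M_pos] with t ht hN
      have : (M t : ℝ) < (q t).2 + 4 := by exact_mod_cast ht
      have hN' := one_div_pos.1 hN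
      rw [mul_one_div, add_zero, sub_le_iff_le_add, ← add_div, le_div_iff₀ hN']
      linarith
  have := tendsto_nhds_unique ((H.tendsto_snd 0).const_sub 1) h0
  linarith

theorem tendsto_node_of_fst (H : MeshLimit l N M q P) {k : ι → ℤ} {a : ℝ} (ha : P.1 = a)
    (hk : Tendsto (fun t => (k t : ℝ) / N t) l (𝓝 a)) (b : ℤ) :
    Tendsto (fun t => Config.node (N t) (M t) (k t) ((q t).2 + b)) l (𝓝 P) := by
  subst ha
  refine (hk.prodMk_nhds (H.tendsto_snd b)).congr fun t => ?_
  simp only [Config.node]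
  push_cast
  rfl

theorem tendsto_node_of_snd (H : MeshLimit l N M q P) {k : ι → ℤ} {a : ℝ} (ha : P.2 = a)
    (hk : Tendsto (fun t => (k t : ℝ) / M t) l (𝓝 a)) (b : ℤ) :
    Tendsto (fun t => Config.node (N t) (M t) ((q t).1 + b) (k t)) l (𝓝 P) := by
  subst ha
  refine ((H.tendsto_fst b).prodMk_nhds hk).congr fun t => ?_
  simp only [Config.node]
  push_cast
  rfl

/-- Either the cells eventually keep a distance from a side or they stay within four cells of it. In
the latter case `P` lies on that side and `W P` satisfies its conditions for the limiting normal.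
The zeros in `C.row D v 0 0 0` are placeholders, since `Line.on` supplies the number of cells and
the faces. -/
theorem lineLimit_row (H : MeshLimit l N M q P) (hγ : 1 < γ) (hk₄ : 0 ≤ D.k₄)
    (hC : C.Admissible D) (v : Closure) :
    LineLimit l (C.row D v 0 0 0) (fun t => N t) (fun t k => C.faceξ (N t) (M t) k (q t).2)
      (fun t i => C.sampledFlow (N t) (M t) (i, (q t).2)) (fun t => (q t).1)
      (fun t => 1 / (M t : ℝ)) (C.W P) (C.normalξ P) where
  one_lt := hγ
  k₄_nonneg := hk₄
  h_pos := H.M_pos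
  physical := hC.physical_W P H.mem_square
  state o := by
    have := (hC.smooth_W.continuous.tendsto P).comp (H.tendsto_centre o 0)
    simp only [add_zero] at this
    exact this
  face o := by
    have h₁ := H.tendsto_node o 0
    have h₂ := H.tendsto_node o (-1)
    simp only [add_zero] at h₁
    exact Config.tendsto_faceξ hC H.M_pos h₁ h₂
  first := by
    refine (eventually_lt_or_le l (fun _ => 4) fun t => (q t).1).imp id fun h => ?_
    have hP := H.fst_eq_zero h
    have h₁ := H.tendsto_node_of_fst (k := fun _ => 0) hP (by simp) 0
    have h₂ := H.tendsto_node_of_fst (k := fun _ => 0) hP (by simp) (-1)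
    simp only [add_zero] at h₁
    have hn := Config.normalξ_ne_zero hC H.mem_square
    refine ⟨unit (C.normalξ P), unit_ne_zero hn,
      Config.tendsto_unit_of_smul hn H.M_pos (Config.tendsto_faceξ hC H.M_pos h₁ h₂), ?_⟩
    have := hC.wall_cond P.2 H.mem_square.2
    rwa [← hP] at this
  last := by
    refine (eventually_lt_or_le l (fun t => (N t : ℤ)) fun t => (q t).1 + 4).symm.imp id fun h => ?_
    have hP := H.fst_eq_one h
    have hk : Tendsto (fun t => (((N t : ℤ) : ℝ)) / N t) l (𝓝 1) := by
      refine tendsto_const_nhds.congr' ?_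
      filter_upwards [H.N_pos] with t ht
      rw [Int.cast_natCast, div_self (one_div_pos.1 ht).ne']
    have h₁ := H.tendsto_node_of_fst (k := fun t => (N t : ℤ)) hP hk 0
    have h₂ := H.tendsto_node_of_fst (k := fun t => (N t : ℤ)) hP hk (-1)
    simp only [add_zero] at h₁
    have hn := Config.normalξ_ne_zero hC H.mem_square
    refine ⟨unit (C.normalξ P), unit_ne_zero hn,
      Config.tendsto_unit_of_smul hn H.M_pos (Config.tendsto_faceξ hC H.M_pos h₁ h₂), ?_⟩
    have := hC.right_cond P.2 H.mem_square.2
    rwa [← hP] at this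

theorem lineLimit_column (H : MeshLimit l N M q P) (hγ : 1 < γ) (hk₄ : 0 ≤ D.k₄)
    (hC : C.Admissible D) (v : Closure) :
    LineLimit l (C.column D v 0 0 0) (fun t => M t) (fun t k => C.faceη (N t) (M t) (q t).1 k)
      (fun t j => C.sampledFlow (N t) (M t) ((q t).1, j)) (fun t => (q t).2)
      (fun t => 1 / (N t : ℝ)) (C.W P) (C.normalη P) where
  one_lt := hγ
  k₄_nonneg := hk₄
  h_pos := H.N_pos
  physical := hC.physical_W P H.mem_square
  state o := by
    have := (hC.smooth_W.continuous.tendsto P).comp (H.tendsto_centre 0 o)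
    simp only [add_zero] at this
    exact this
  face o := by
    have h₁ := H.tendsto_node 0 o
    have h₂ := H.tendsto_node (-1) o
    simp only [add_zero] at h₁
    exact Config.tendsto_faceη hC H.N_pos h₁ h₂
  first := by
    refine (eventually_lt_or_le l (fun _ => 4) fun t => (q t).2).imp id fun h => ?_
    have hP := H.snd_eq_zero h
    have h₁ := H.tendsto_node_of_snd (k := fun _ => 0) hP (by simp) 0
    have h₂ := H.tendsto_node_of_snd (k := fun _ => 0) hP (by simp) (-1)
    simp only [add_zero] at h₁
    have hn := Config.normalη_ne_zero hC H.mem_square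
    refine ⟨unit (C.normalη P), unit_ne_zero hn,
      Config.tendsto_unit_of_smul hn H.N_pos (Config.tendsto_faceη hC H.N_pos h₁ h₂), ?_⟩
    have := hC.bottom_cond P.1 H.mem_square.1
    rwa [← hP] at this
  last := by
    refine (eventually_lt_or_le l (fun t => (M t : ℤ)) fun t => (q t).2 + 4).symm.imp id fun h => ?_
    have hP := H.snd_eq_one h
    have hk : Tendsto (fun t => (((M t : ℤ) : ℝ)) / M t) l (𝓝 1) := by
      refine tendsto_const_nhds.congr' ?_
      filter_upwards [H.M_pos] with t ht
      rw [Int.cast_natCast, div_self (one_div_pos.1 ht).ne']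
    have h₁ := H.tendsto_node_of_snd (k := fun t => (M t : ℤ)) hP hk 0
    have h₂ := H.tendsto_node_of_snd (k := fun t => (M t : ℤ)) hP hk (-1)
    simp only [add_zero] at h₁
    have hn := Config.normalη_ne_zero hC H.mem_square
    refine ⟨unit (C.normalη P), unit_ne_zero hn,
      Config.tendsto_unit_of_smul hn H.N_pos (Config.tendsto_faceη hC H.N_pos h₁ h₂), ?_⟩
    have := hC.top_cond P.1 H.mem_square.1
    rwa [← hP] at this

/-- Difference quotients of the adjoint field along rows. -/
theorem tendsto_row_quotient (H : MeshLimit l N M q P) {f : ℝ × ℝ → State} (hf : ContDiff ℝ ∞ f)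
    (o : ℤ) : Tendsto (fun t => (1 / (N t : ℝ))⁻¹ •
      (f (Config.centre (N t) (M t) ((q t).1 + o + 1, (q t).2))
        - f (Config.centre (N t) (M t) ((q t).1 + o, (q t).2)))) l (𝓝 (dξ f P)) := by
  have h₁ := H.tendsto_centre (o + 1) 0
  have h₂ := H.tendsto_centre o 0
  simp only [add_zero, ← add_assoc] at h₁ h₂
  refine tendsto_differenceQuotient hf h₁ h₂ (H.N_pos.mono fun t ht => ht.ne') fun t => ?_
  ext
  · simp [Config.centre]; ring
  · simp [Config.centre]

/-- Difference quotients of the adjoint field along columns. -/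
theorem tendsto_column_quotient (H : MeshLimit l N M q P) {f : ℝ × ℝ → State}
    (hf : ContDiff ℝ ∞ f) (o : ℤ) : Tendsto (fun t => (1 / (M t : ℝ))⁻¹ •
      (f (Config.centre (N t) (M t) ((q t).1, (q t).2 + o + 1))
        - f (Config.centre (N t) (M t) ((q t).1, (q t).2 + o)))) l (𝓝 (dη f P)) := by
  have h₁ := H.tendsto_centre 0 (o + 1)
  have h₂ := H.tendsto_centre 0 o
  simp only [add_zero, ← add_assoc] at h₁ h₂
  refine tendsto_differenceQuotient hf h₁ h₂ (H.M_pos.mono fun t ht => ht.ne') fun t => ?_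
  ext
  · simp [Config.centre]
  · simp [Config.centre]; ring

end MeshLimit

/-! ### The discrete adjoint as a gradient -/

theorem vecMul_jacobian_apply (c : State) (F : State → State) (W : State) (b : Fin 4) :
    (c ᵥ* jacobian F W) b = covec c (fderiv ℝ F W (Pi.single b 1)) := by
  simp [covec_apply, Matrix.vecMul, jacobian, dotProduct]

theorem vecMul_jacobian_eq_grad (c : State) {F : State → State} {W : State}
    (hF : DifferentiableAt ℝ F W) : c ᵥ* jacobian F W = grad (fun x => c ⬝ᵥ F x) W := by
  ext b
  have h : HasFDerivAt (fun x => c ⬝ᵥ F x) ((covec c).comp (fderiv ℝ F W)) W := by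
    simpa only [Function.comp_def, covec_apply] using
      (covec c).hasFDerivAt.comp W hF.hasFDerivAt
  rw [vecMul_jacobian_apply, grad, h.fderiv]
  rfl

theorem differentiableAt_dotProduct (c : State) {F : State → State} {W : State}
    (hF : DifferentiableAt ℝ F W) : DifferentiableAt ℝ (fun x => c ⬝ᵥ F x) W := by
  simpa only [Function.comp_def, covec_apply] using
    ((covec c).hasFDerivAt.comp W hF.hasFDerivAt).differentiableAt

theorem grad_add {f g : State → ℝ} {W : State} (hf : DifferentiableAt ℝ f W)
    (hg : DifferentiableAt ℝ g W) : grad (fun x => f x + g x) W = grad f W + grad g W := by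
  ext b
  simp [grad, fderiv_fun_add hf hg]

theorem grad_sum {α : Type*} (s : Finset α) {f : α → State → ℝ} {W : State}
    (hf : ∀ a ∈ s, DifferentiableAt ℝ (f a) W) :
    grad (fun x => ∑ a ∈ s, f a x) W = ∑ a ∈ s, grad (f a) W := by
  ext b
  simp [grad, fderiv_fun_sum hf]

theorem grad_const_mul (c : ℝ) {f : State → ℝ} {W : State} (hf : DifferentiableAt ℝ f W) :
    grad (fun x => c * f x) W = c • grad f W := by
  ext b
  simp [grad, fderiv_const_mul hf]

namespace Config

variable {γ : ℝ} (C : Config γ) (D : Scheme γ) (v : Closure) (N M : ℕ)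

/-- The sum of the residuals weighted with the adjoint field. -/
noncomputable def weightedResidual (U : ℤ × ℤ → State) : ℝ :=
  ∑ k ∈ cells N M, C.Λ (centre N M k) ⬝ᵥ C.residual D v N M U k

/-- Each residual is a flux difference along a row plus one along a column, so the double sum
separates into one-dimensional problems. -/
theorem weightedResidual_eq (U : ℤ × ℤ → State) : C.weightedResidual D v N M U =
    ∑ j ∈ Finset.Icc (1 : ℤ) M, (C.row D v N M j).balance (fun i => C.Λ (centre N M (i, j)))
      (fun i => U (i, j))
    + ∑ i ∈ Finset.Icc (1 : ℤ) N, (C.column D v N M i).balance (fun j => C.Λ (centre N M (i, j)))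
      (fun j => U (i, j)) := by
  have hr : ∀ j, (C.row D v N M j).balance (fun i => C.Λ (centre N M (i, j))) (fun i => U (i, j)) =
      ∑ i ∈ Finset.Icc (1 : ℤ) N, C.Λ (centre N M (i, j)) ⬝ᵥ
        ((C.row D v N M j).numFlux (fun i => U (i, j)) i
          - (C.row D v N M j).numFlux (fun i => U (i, j)) (i - 1)) := fun _ => rfl
  have hc : ∀ i, (C.column D v N M i).balance (fun j => C.Λ (centre N M (i, j)))
      (fun j => U (i, j)) =
      ∑ j ∈ Finset.Icc (1 : ℤ) M, C.Λ (centre N M (i, j)) ⬝ᵥ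
        ((C.column D v N M i).numFlux (fun j => U (i, j)) j
          - (C.column D v N M i).numFlux (fun j => U (i, j)) (j - 1)) := fun _ => rfl
  simp only [hr, hc]
  rw [Finset.sum_comm, weightedResidual, cells, Finset.sum_product, ← Finset.sum_add_distrib]
  refine Finset.sum_congr rfl fun i _ => ?_
  rw [← Finset.sum_add_distrib]
  refine Finset.sum_congr rfl fun j _ => ?_
  rw [← dotProduct_add, residual]
  congr 1
  abel

-- A cell lies on exactly one row and one column; the balances of all other lines cancel.
variable {N M} in
theorem weightedResidual_update_sub (U : ℤ × ℤ → State) {q : ℤ × ℤ}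
    (hq : (1 ≤ q.1 ∧ q.1 ≤ N) ∧ 1 ≤ q.2 ∧ q.2 ≤ M) (x y : State) :
    C.weightedResidual D v N M (Function.update U q x)
      - C.weightedResidual D v N M (Function.update U q y) =
    ((C.row D v N M q.2).balance (fun i => C.Λ (centre N M (i, q.2)))
        (Function.update (fun i => U (i, q.2)) q.1 x)
      - (C.row D v N M q.2).balance (fun i => C.Λ (centre N M (i, q.2)))
        (Function.update (fun i => U (i, q.2)) q.1 y))
    + ((C.column D v N M q.1).balance (fun j => C.Λ (centre N M (q.1, j)))
        (Function.update (fun j => U (q.1, j)) q.2 x)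
      - (C.column D v N M q.1).balance (fun j => C.Λ (centre N M (q.1, j)))
        (Function.update (fun j => U (q.1, j)) q.2 y)) := by
  have hr : ∀ z, (fun i => Function.update U q z (i, q.2)) =
      Function.update (fun i => U (i, q.2)) q.1 z := fun z => by
    ext1 i
    simp only [Function.update_apply, Prod.ext_iff, and_true]
  have hr' : ∀ z j, j ≠ q.2 → (fun i => Function.update U q z (i, j)) = fun i => U (i, j) :=
    fun z j hj => by
      ext1 i
      simp [Prod.ext_iff, hj]
  have hc : ∀ z, (fun j => Function.update U q z (q.1, j)) =
      Function.update (fun j => U (q.1, j)) q.2 z := fun z => by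
    ext1 i
    simp only [Function.update_apply, Prod.ext_iff, true_and]
  have hc' : ∀ z i, i ≠ q.1 → (fun j => Function.update U q z (i, j)) = fun j => U (i, j) :=
    fun z j hj => by
      ext1 i
      simp [Prod.ext_iff, hj]
  rw [weightedResidual_eq, weightedResidual_eq, add_sub_add_comm, ← Finset.sum_sub_distrib,
    ← Finset.sum_sub_distrib, Finset.sum_eq_single_of_mem q.2 (Finset.mem_Icc.2 hq.2),
    Finset.sum_eq_single_of_mem q.1 (Finset.mem_Icc.2 hq.1), hr, hr, hc, hc]
  · intro i _ hi
    rw [hc' x i hi, hc' y i hi, sub_self]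
  · intro j _ hj
    rw [hr' x j hj, hr' y j hj, sub_self]

variable {C D v N M} in
theorem differentiableAt_weightedResidual {q : ℤ × ℤ} (h : C.DifferentiableInCell D v N M q) :
    DifferentiableAt ℝ
      (fun x => C.weightedResidual D v N M (Function.update (C.sampledFlow N M) q x))
      (C.sampledFlow N M q) :=
  DifferentiableAt.fun_sum fun k hk => differentiableAt_dotProduct _ (h k hk)

-- With `Λ` frozen, the adjoint equation is the derivative of a single scalar function. Its limit
-- can then be found without differentiating individual fluxes.
variable {C D v N M} in
theorem discreteAdjoint_eq_grad {q : ℤ × ℤ} (h : C.DifferentiableInCell D v N M q)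
    (hJ : DifferentiableAt ℝ (fun x => C.force D N M (Function.update (C.sampledFlow N M) q x))
      (C.sampledFlow N M q)) :
    C.discreteAdjoint D v N M q =
      grad (fun x => C.weightedResidual D v N M (Function.update (C.sampledFlow N M) q x)
        + C.force D N M (Function.update (C.sampledFlow N M) q x)) (C.sampledFlow N M q) := by
  rw [grad_add (differentiableAt_weightedResidual h) hJ, discreteAdjoint]
  unfold weightedResidual
  rw [grad_sum _ fun k hk => differentiableAt_dotProduct _ (h k hk)]
  congr 1
  exact Finset.sum_congr rfl fun k hk => vecMul_jacobian_eq_grad _ (h k hk)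

theorem force_update_of_ne (U : ℤ × ℤ → State) {q : ℤ × ℤ} (hq : q.1 ≠ 1) (x : State) :
    C.force D N M (Function.update U q x) = C.force D N M U := by
  unfold force
  refine Finset.sum_congr rfl fun j _ => ?_
  rw [Function.update_of_ne fun h => hq (congrArg Prod.fst h).symm]

variable {C} in
theorem contAdjoint_apply (P : ℝ × ℝ) (b : Fin 4) : C.contAdjoint P b =
    -covec (dξ C.Λ P) (fluxDeriv γ (C.W P) (C.normalξ P) (Pi.single b 1))
      - covec (dη C.Λ P) (fluxDeriv γ (C.W P) (C.normalη P) (Pi.single b 1)) := by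
  simp [contAdjoint, fluxDeriv, normalξ, normalη, covec_apply, Matrix.vecMul, jacobian, dotProduct,
    Fin.sum_univ_four]
  ring

/-! ### Continuity of the limit expressions on the square -/

section Continuity

variable {C D N M}

theorem continuous_dξ {E : Type*} [NormedAddCommGroup E] [NormedSpace ℝ E] {f : ℝ × ℝ → E}
    (hf : ContDiff ℝ ∞ f) : Continuous (dξ f) :=
  (hf.continuous_fderiv (by simp)).clm_apply continuous_const

theorem continuous_dη {E : Type*} [NormedAddCommGroup E] [NormedSpace ℝ E] {f : ℝ × ℝ → E}
    (hf : ContDiff ℝ ∞ f) : Continuous (dη f) :=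
  (hf.continuous_fderiv (by simp)).clm_apply continuous_const

theorem continuous_normalξ (hC : C.Admissible D) : Continuous C.normalξ :=
  (continuous_dη hC.smooth_y).prodMk (continuous_dη hC.smooth_x).neg

theorem continuous_normalη (hC : C.Admissible D) : Continuous C.normalη :=
  (continuous_dξ hC.smooth_y).neg.prodMk (continuous_dξ hC.smooth_x)

theorem continuousAt_fluxDeriv (hC : C.Admissible D) {P : ℝ × ℝ} (hP : P ∈ square)
    {s : ℝ × ℝ → ℝ × ℝ} (hs : Continuous s) (e : State) :
    ContinuousAt (fun Q => fluxDeriv γ (C.W Q) (s Q) e) P := by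
  have h0 := (hC.physical_W P hP).1.ne'
  have hX : ContinuousAt (fun Q => fderiv ℝ (fluxX γ) (C.W Q)) P :=
    ((contDiffAt_fluxX h0).continuousAt_fderiv one_ne_zero).comp
      (f := C.W) hC.smooth_W.continuous.continuousAt
  have hY : ContinuousAt (fun Q => fderiv ℝ (fluxY γ) (C.W Q)) P :=
    ((contDiffAt_fluxY h0).continuousAt_fderiv one_ne_zero).comp
      (f := C.W) hC.smooth_W.continuous.continuousAt
  exact ((hs.fst.continuousAt.smul hX).add (hs.snd.continuousAt.smul hY)).clm_apply
    continuousAt_const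

theorem continuousAt_contAdjoint (hC : C.Admissible D) {P : ℝ × ℝ} (hP : P ∈ square) :
    ContinuousAt C.contAdjoint P := by
  refine continuousAt_pi.2 fun b => ?_
  simp only [contAdjoint_apply, covec_apply, dotProduct]
  have hx := continuousAt_fluxDeriv hC hP (continuous_normalξ hC) (Pi.single b 1)
  have hy := continuousAt_fluxDeriv hC hP (continuous_normalη hC) (Pi.single b 1)
  have h₁ := (continuous_dξ hC.smooth_Λ).continuousAt (x := P)
  have h₂ := (continuous_dη hC.smooth_Λ).continuousAt (x := P)
  rw [continuousAt_pi] at hx hy h₁ h₂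
  exact (tendsto_finsetSum _ fun i _ => (h₁ i).mul (hx i)).neg.sub
    (tendsto_finsetSum _ fun i _ => (h₂ i).mul (hy i))

theorem continuousAt_spectralRadius (hγ : 1 < γ) (hC : C.Admissible D) {P : ℝ × ℝ}
    (hP : P ∈ square) {s : ℝ × ℝ → ℝ × ℝ} (hs : Continuous s) :
    ContinuousAt (fun Q => spectralRadius γ (C.W Q) (s Q)) P := by
  have hW := hC.physical_W P hP
  have hv : ContinuousAt (fun Q => velocity (C.W Q)) P :=
    (contDiffAt_velocity hW.1.ne').continuousAt.comp (f := C.W)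
      hC.smooth_W.continuous.continuousAt
  have hc : ContinuousAt (fun Q => soundSpeed γ (C.W Q)) P :=
    (contDiffAt_soundSpeed hγ hW).continuousAt.comp (f := C.W)
      hC.smooth_W.continuous.continuousAt
  exact ((hv.fst.mul hs.fst.continuousAt).add (hv.snd.mul hs.snd.continuousAt)).abs.add
    (hc.mul (continuous_len.comp hs).continuousAt)

theorem continuousAt_defect (hγ : 1 < γ) (hC : C.Admissible D) {P : ℝ × ℝ} (hP : P ∈ square)
    (s : Side) : ContinuousAt (defect D s C) P := by
  have hξ := (continuousAt_spectralRadius hγ hC hP (continuous_normalξ hC)).const_mul D.k₄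
  have hη := (continuousAt_spectralRadius hγ hC hP (continuous_normalη hC)).const_mul D.k₄
  have h₁ := (continuous_dξ hC.smooth_Λ).continuousAt (x := P)
  have h₂ := (continuous_dη hC.smooth_Λ).continuousAt (x := P)
  cases s
  · exact hξ.smul h₁
  · exact (hξ.smul h₁).neg
  · exact hη.smul h₂
  · exact (hη.smul h₂).neg

end Continuity

end Config

/-! ### Limit of the discrete adjoint outside the boundary cells -/

namespace MeshLimit

variable {ι : Type*} {l : Ultrafilter ι} {N M : ι → ℕ} {q : ι → ℤ × ℤ} {P : ℝ × ℝ} {γ : ℝ}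
  {C : Config γ} {D : Scheme γ}

theorem der_row (H : MeshLimit l N M q P) (hγ : 1 < γ) (hk₄ : 0 ≤ D.k₄) (hC : C.Admissible D)
    {v : Closure} {δ : ℝ} (hδ : LinePosition l v (fun t => N t) (fun t => (q t).1) δ) :
    Der l (fun t => C.sampledFlow (N t) (M t) (q t))
      (fun p => (1 / (N p.1 : ℝ))⁻¹ * (1 / (M p.1 : ℝ))⁻¹ *
        (C.row D v (N p.1) (M p.1) (q p.1).2).balance
          (fun i => C.Λ (Config.centre (N p.1) (M p.1) (i, (q p.1).2)))
          (Function.update (fun i => C.sampledFlow (N p.1) (M p.1) (i, (q p.1).2)) (q p.1).1 p.2))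
      ((covec (-dξ C.Λ P)).comp (fluxDeriv γ (C.W P) (C.normalξ P) +
        (D.k₄ * spectralRadius γ (C.W P) (C.normalξ P) * δ) •
          ContinuousLinearMap.id ℝ State)) :=
  (H.lineLimit_row hγ hk₄ hC v).der_balance_of_position hδ (τ := fun t => 1 / (N t : ℝ))
    (Λ := fun t i => C.Λ (Config.centre (N t) (M t) (i, (q t).2)))
    (H.tendsto_row_quotient hC.smooth_Λ)

theorem der_column (H : MeshLimit l N M q P) (hγ : 1 < γ) (hk₄ : 0 ≤ D.k₄) (hC : C.Admissible D)
    {v : Closure} {δ : ℝ} (hδ : LinePosition l v (fun t => M t) (fun t => (q t).2) δ) :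
    Der l (fun t => C.sampledFlow (N t) (M t) (q t))
      (fun p => (1 / (M p.1 : ℝ))⁻¹ * (1 / (N p.1 : ℝ))⁻¹ *
        (C.column D v (N p.1) (M p.1) (q p.1).1).balance
          (fun j => C.Λ (Config.centre (N p.1) (M p.1) ((q p.1).1, j)))
          (Function.update (fun j => C.sampledFlow (N p.1) (M p.1) ((q p.1).1, j)) (q p.1).2 p.2))
      ((covec (-dη C.Λ P)).comp (fluxDeriv γ (C.W P) (C.normalη P) +
        (D.k₄ * spectralRadius γ (C.W P) (C.normalη P) * δ) •
          ContinuousLinearMap.id ℝ State)) :=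
  (H.lineLimit_column hγ hk₄ hC v).der_balance_of_position hδ (τ := fun t => 1 / (M t : ℝ))
    (Λ := fun t j => C.Λ (Config.centre (N t) (M t) ((q t).1, j)))
    (H.tendsto_column_quotient hC.smooth_Λ)

/-- The row contributes the `Λ_ξ` terms and the column the `Λ_η` terms, each with its own
dissipative remainder. The force drops out because it sees only the cells `(1, j)`. -/
theorem tendsto_discreteAdjoint (H : MeshLimit l N M q P) (hγ : 1 < γ) (hk₄ : 0 ≤ D.k₄)
    (hC : C.Admissible D) {v : Closure} {δξ δη : ℝ}
    (hξ : LinePosition l v (fun t => N t) (fun t => (q t).1) δξ)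
    (hη : LinePosition l v (fun t => M t) (fun t => (q t).2) δη)
    (hq : ∀ᶠ t in (l : Filter ι), (q t).1 ≠ 1)
    (hd : ∀ᶠ t in (l : Filter ι), C.DifferentiableInCell D v (N t) (M t) (q t)) :
    Tendsto (fun t => ((1 / N t : ℝ) * (1 / M t))⁻¹ • C.discreteAdjoint D v (N t) (M t) (q t)) l
      (𝓝 (C.contAdjoint P
        - (D.k₄ * spectralRadius γ (C.W P) (C.normalξ P) * δξ) • dξ C.Λ P
        - (D.k₄ * spectralRadius γ (C.W P) (C.normalη P) * δη) • dη C.Λ P)) := by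
  have hf := Der.congr_sub_of_forall
    (g := fun p => ((1 / N p.1 : ℝ) * (1 / M p.1))⁻¹ *
        (C.weightedResidual D v (N p.1) (M p.1)
          (Function.update (C.sampledFlow (N p.1) (M p.1)) (q p.1) p.2)
        + C.force D (N p.1) (M p.1)
          (Function.update (C.sampledFlow (N p.1) (M p.1)) (q p.1) p.2)))
    ((H.der_row hγ hk₄ hC hξ).add (H.der_column hγ hk₄ hC hη)) <| by
      filter_upwards [H.mem, hq] with t ht ht' x
      have e := C.weightedResidual_update_sub D v (C.sampledFlow (N t) (M t)) ht x
        (C.sampledFlow (N t) (M t) (q t))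
      rw [C.force_update_of_ne D _ _ _ ht', C.force_update_of_ne D _ _ _ ht', ← mul_sub,
        add_sub_add_right_eq_sub, e, mul_inv]
      ring
  have hJ : ∀ᶠ t in (l : Filter ι), DifferentiableAt ℝ
      (fun x => C.force D (N t) (M t) (Function.update (C.sampledFlow (N t) (M t)) (q t) x))
      (C.sampledFlow (N t) (M t) (q t)) := by
    filter_upwards [hq] with t ht
    simp only [C.force_update_of_ne D _ _ _ ht]
    exact differentiableAt_const _
  have hdiff : ∀ᶠ t in (l : Filter ι), DifferentiableAt ℝ
      (fun x => C.weightedResidual D v (N t) (M t)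
          (Function.update (C.sampledFlow (N t) (M t)) (q t) x)
        + C.force D (N t) (M t) (Function.update (C.sampledFlow (N t) (M t)) (q t) x))
      (C.sampledFlow (N t) (M t) (q t)) := by
    filter_upwards [hd, hJ] with t h₁ h₂
    exact (Config.differentiableAt_weightedResidual h₁).add h₂
  have key := hf.tendsto_grad (hdiff.mono fun t ht => ht.const_mul ((1 / N t : ℝ) * (1 / M t))⁻¹)
  refine (key.congr' ?_).trans (le_of_eq ?_)
  · filter_upwards [hd, hJ, hdiff] with t h₁ h₂ h₃
    rw [grad_const_mul _ h₃, Config.discreteAdjoint_eq_grad h₁ h₂]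
  · congr 1
    ext b
    simp only [Pi.sub_apply, Config.contAdjoint_apply, covec_apply, add_apply,
      ContinuousLinearMap.comp_apply, smul_apply, ContinuousLinearMap.id_apply, neg_dotProduct,
      dotProduct_add, dotProduct_smul, dotProduct_single, Pi.smul_apply, Pi.neg_apply, smul_eq_mul]
    ring

end MeshLimit

/-! ### Consistency away from the boundary cells -/

/-- Compactness of the square in ultrafilter form. It replaces repeated passage to subsequences, for
the limit point as well as for the position relative to the sides. -/
theorem exists_meshLimit {N M : ℕ → ℕ} {q : ℕ → ℤ × ℤ} (hN : ∀ t, t ≤ N t) (hM : ∀ t, t ≤ M t)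
    (hq : ∀ t, (1 ≤ (q t).1 ∧ (q t).1 ≤ N t) ∧ 1 ≤ (q t).2 ∧ (q t).2 ≤ M t) :
    ∃ P, MeshLimit (hyperfilter ℕ) N M q P := by
  have h := square_isCompact.ultrafilter_le_nhds'
    ((hyperfilter ℕ).map fun t => Config.centre (N t) (M t) (q t))
    (Ultrafilter.mem_map.2 (Eventually.of_forall fun t => centre_mem_square (hq t)))
  obtain ⟨P, _, hP⟩ := h
  exact ⟨P, (tendsto_atTop_mono hN tendsto_id).mono_left Nat.hyperfilter_le_atTop,
    (tendsto_atTop_mono hM tendsto_id).mono_left Nat.hyperfilter_le_atTop, hP,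
    Eventually.of_forall hq⟩

/-- If uniform convergence failed, each refinement level would supply a cell with error above `ε`.
Along the ultrafilter these cells tend to some `P`, where the assumed limit and the continuity of
`contAdjoint` and `E` force the error to zero. -/
theorem truncationErrorTendsTo_of_meshLimit {γ : ℝ} {D : Scheme γ} {v : Closure}
    {cls : ℕ → ℕ → Set (ℤ × ℤ)} {E : Config γ → ℝ × ℝ → State}
    (hE : ∀ C : Config γ, C.Admissible D → ∀ P ∈ square, ContinuousAt (E C) P)
    (hcls : ∀ N M, 5 ≤ N → 5 ≤ M → ∀ q ∈ cls N M, (1 ≤ q.1 ∧ q.1 ≤ N) ∧ 1 ≤ q.2 ∧ q.2 ≤ M)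
    (h : ∀ C : Config γ, C.Admissible D → ∀ (l : Ultrafilter ℕ) (N M : ℕ → ℕ) (q : ℕ → ℤ × ℤ)
      (P : ℝ × ℝ), MeshLimit l N M q P → (∀ t, 5 ≤ N t ∧ 5 ≤ M t ∧ q t ∈ cls (N t) (M t)) →
      (∀ᶠ t in (l : Filter ℕ), C.DifferentiableInCell D v (N t) (M t) (q t)) →
      Tendsto (fun t => ((1 / N t : ℝ) * (1 / M t))⁻¹ • C.discreteAdjoint D v (N t) (M t) (q t)) l
        (𝓝 (C.contAdjoint P + E C P))) :
    TruncationErrorTendsTo D v cls E := by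
  intro C hC r ε hε
  by_contra! hcon
  -- The shift by `5` provides at least five cells in each direction, as required by `LinePosition`.
  choose N M hN hM _ _ q hq hd herr using fun t => hcon (t + 5)
  have hN' : ∀ t, 5 ≤ N t := fun t => by have := hN t; omega
  have hM' : ∀ t, 5 ≤ M t := fun t => by have := hM t; omega
  obtain ⟨P, H⟩ := exists_meshLimit (fun t => by have := hN t; omega)
    (fun t => by have := hM t; omega) fun t => hcls _ _ (hN' t) (hM' t) _ (hq t)
  have h₁ := h C hC _ N M q P H (fun t => ⟨hN' t, hM' t, hq t⟩) (Eventually.of_forall hd)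
  have h₂ := (Config.continuousAt_contAdjoint hC H.mem_square).tendsto.comp H.centre
  have h₃ := (hE C hC P H.mem_square).tendsto.comp H.centre
  have h₄ := ((h₁.sub h₂).sub h₃).norm
  rw [add_sub_cancel_left, sub_self, norm_zero] at h₄
  obtain ⟨t, ht⟩ := (h₄.eventually_lt_const hε).exists
  exact lt_irrefl _ ((herr t).trans ht)

section Consistency

variable {γ : ℝ} {D : Scheme γ}

theorem dualConsistent_interior (hγ : 1 < γ) (hk₄ : 0 ≤ D.k₄) (v : Closure) :
    DualConsistent D v interior := by
  refine truncationErrorTendsTo_of_meshLimit (fun _ _ _ _ => continuousAt_const)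
    (fun N M _ _ q hq => ?_) fun C hC l N M q P H hq hd => ?_
  · obtain ⟨h₁, h₂, h₃, h₄⟩ := hq
    omega
  · have hq' : ∀ t, 3 ≤ (q t).1 ∧ (q t).1 ≤ N t - 2 ∧ 3 ≤ (q t).2 ∧ (q t).2 ≤ M t - 2 :=
      fun t => (hq t).2.2
    have h₁ : LinePosition l v (fun t => N t) (fun t => (q t).1) 0 :=
      Or.inl ⟨rfl, Eventually.of_forall fun t => ⟨(hq' t).1, (hq' t).2.1⟩⟩
    have h₂ : LinePosition l v (fun t => M t) (fun t => (q t).2) 0 :=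
      Or.inl ⟨rfl, Eventually.of_forall fun t => ⟨(hq' t).2.2.1, (hq' t).2.2.2⟩⟩
    have h₃ : ∀ t, (q t).1 ≠ 1 := fun t => by have := (hq' t).1; omega
    simpa using H.tendsto_discreteAdjoint hγ hk₄ hC h₁ h₂ (Eventually.of_forall h₃) hd

/-- In the penultimate cells the truncation error tends to a multiple of the defect. -/
theorem truncationErrorTendsTo_penultimate (hγ : 1 < γ) (hk₄ : 0 ≤ D.k₄) (v : Closure) (s : Side) :
    TruncationErrorTendsTo D v (penultimate s)
      fun C P => (-(v.second + 2)) • defect D s C P := by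
  refine truncationErrorTendsTo_of_meshLimit
    (fun C hC P hP => (Config.continuousAt_defect hγ hC hP s).const_smul (-(v.second + 2)))
    (fun N M hN hM q hq => ?_) fun C hC l N M q P H hq hd => ?_
  · cases s <;> obtain ⟨h₁, h₂, h₃⟩ := hq <;> omega
  · cases s
    · have hq' : ∀ t, (q t).1 = 2 ∧ 3 ≤ (q t).2 ∧ (q t).2 ≤ M t - 2 := fun t => (hq t).2.2
      have h₁ : LinePosition l v (fun t => N t) (fun t => (q t).1) (v.second + 2) :=
        Or.inr (Or.inl ⟨rfl, Eventually.of_forall fun t => ⟨(hq' t).1, by have := hq t; dsimp only; omega⟩⟩)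
      have h₂ : LinePosition l v (fun t => M t) (fun t => (q t).2) 0 :=
        Or.inl ⟨rfl, Eventually.of_forall fun t => (hq' t).2⟩
      have h₃ : ∀ t, (q t).1 ≠ 1 := fun t => by have := hq' t; omega
      convert H.tendsto_discreteAdjoint hγ hk₄ hC h₁ h₂ (Eventually.of_forall h₃) hd using 2
      simp only [defect]
      module
    · have hq' : ∀ t, (q t).1 = N t - 1 ∧ 3 ≤ (q t).2 ∧ (q t).2 ≤ M t - 2 := fun t => (hq t).2.2
      -- The mirrored formula changes the sign of the coefficient sum; this matches the inward
      -- derivative `-∂_ξ` in `defect`.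
      have h₁ : LinePosition l v (fun t => N t) (fun t => (q t).1) (-(v.second + 2)) :=
        Or.inr (Or.inr ⟨rfl, Eventually.of_forall fun t => ⟨(hq' t).1, by have := hq t; dsimp only; omega⟩⟩)
      have h₂ : LinePosition l v (fun t => M t) (fun t => (q t).2) 0 :=
        Or.inl ⟨rfl, Eventually.of_forall fun t => (hq' t).2⟩
      have h₃ : ∀ t, (q t).1 ≠ 1 := fun t => by have := hq' t; have := hq t; omega
      convert H.tendsto_discreteAdjoint hγ hk₄ hC h₁ h₂ (Eventually.of_forall h₃) hd using 2
      simp only [defect]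
      module
    · have hq' : ∀ t, (q t).2 = 2 ∧ 3 ≤ (q t).1 ∧ (q t).1 ≤ N t - 2 := fun t => (hq t).2.2
      have h₁ : LinePosition l v (fun t => N t) (fun t => (q t).1) 0 :=
        Or.inl ⟨rfl, Eventually.of_forall fun t => (hq' t).2⟩
      have h₂ : LinePosition l v (fun t => M t) (fun t => (q t).2) (v.second + 2) :=
        Or.inr (Or.inl ⟨rfl, Eventually.of_forall fun t => ⟨(hq' t).1, by have := hq t; dsimp only; omega⟩⟩)
      have h₃ : ∀ t, (q t).1 ≠ 1 := fun t => by have := hq' t; omega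
      convert H.tendsto_discreteAdjoint hγ hk₄ hC h₁ h₂ (Eventually.of_forall h₃) hd using 2
      simp only [defect]
      module
    · have hq' : ∀ t, (q t).2 = M t - 1 ∧ 3 ≤ (q t).1 ∧ (q t).1 ≤ N t - 2 := fun t => (hq t).2.2
      have h₁ : LinePosition l v (fun t => N t) (fun t => (q t).1) 0 :=
        Or.inl ⟨rfl, Eventually.of_forall fun t => (hq' t).2⟩
      have h₂ : LinePosition l v (fun t => M t) (fun t => (q t).2) (-(v.second + 2)) :=
        Or.inr (Or.inr ⟨rfl, Eventually.of_forall fun t => ⟨(hq' t).1, by have := hq t; dsimp only; omega⟩⟩)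
      have h₃ : ∀ t, (q t).1 ≠ 1 := fun t => by have := hq' t; omega
      convert H.tendsto_discreteAdjoint hγ hk₄ hC h₁ h₂ (Eventually.of_forall h₃) hd using 2
      simp only [defect]
      module

theorem dualConsistent_penultimate (hγ : 1 < γ) (hk₄ : 0 ≤ D.k₄) (s : Side) :
    DualConsistent D .b (penultimate s) := by
  simpa [DualConsistent, Closure.second] using
    truncationErrorTendsTo_penultimate hγ hk₄ .b s

theorem truncationErrorTendsTo_defect (hγ : 1 < γ) (hk₄ : 0 ≤ D.k₄) {v : Closure}
    (hv : v = .a ∨ v = .c) (s : Side) :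
    TruncationErrorTendsTo D v (penultimate s) (defect D s) := by
  have h := truncationErrorTendsTo_penultimate hγ hk₄ v s
  have e : -(v.second + 2) = 1 := by
    rcases hv with rfl | rfl <;> norm_num [Closure.second]
  simpa only [e, one_smul] using h

end Consistency

/-! ### The wall condition -/

/-- Pressure of the boundary state, as a function of the state and the normal. -/
noncomputable def BoundaryState.pressureAt {γ : ℝ} (B : BoundaryState γ) (q : State × (ℝ × ℝ)) : ℝ :=
  pressure γ (B.state q.1 q.2)

namespace BoundaryState

variable {γ : ℝ} (B : BoundaryState γ)

theorem contDiffAt_pressureAt {W : State} (h : W ∈ physical γ) {n : ℝ × ℝ} (hn : n ≠ 0) :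
    ContDiffAt ℝ 1 B.pressureAt (W, n) :=
  (contDiffAt_pressure (γ := γ) (B.physical_mem W h n hn).1.ne').comp (W, n) (B.contDiffAt h hn)

/-- Derivative of the boundary pressure with respect to the state. -/
noncomputable def pressureDeriv (W : State) (n : ℝ × ℝ) : State →L[ℝ] ℝ :=
  (fderiv ℝ B.pressureAt (W, n)).comp (ContinuousLinearMap.inl ℝ State (ℝ × ℝ))

theorem hasFDerivAt_pressureAt {W : State} (h : W ∈ physical γ) {n : ℝ × ℝ} (hn : n ≠ 0) :
    HasFDerivAt (fun w => pressure γ (B.state w n)) (B.pressureDeriv W n) W :=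
  HasFDerivAt.comp (g := B.pressureAt) (f := fun w => (w, n)) W
    ((B.contDiffAt_pressureAt h hn).differentiableAt one_ne_zero).hasFDerivAt
    (hasFDerivAt_prodMk_left W n)

/-- On slip states the boundary pressure is the pressure, whose derivative with respect to the total
energy is `γ - 1`. -/
theorem pressureDeriv_energy (hB : B.IsWall) {W : State} (h : W ∈ physical γ) {n : ℝ × ℝ}
    (hn : n ≠ 0) (hW : dot (velocity W) n = 0) :
    B.pressureDeriv W n (Pi.single 3 1) = γ - 1 := by
  have hline : HasDerivAt (fun s : ℝ => W + s • (Pi.single 3 1 : State)) (Pi.single 3 1) 0 := by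
    simpa using ((hasDerivAt_id (0 : ℝ)).smul_const (Pi.single 3 1 : State)).const_add W
  have h₁ : HasDerivAt (fun s : ℝ => pressure γ (B.state (W + s • (Pi.single 3 1 : State)) n))
      (B.pressureDeriv W n (Pi.single 3 1)) 0 := by
    have := B.hasFDerivAt_pressureAt h hn
    rw [show W = W + (0 : ℝ) • (Pi.single 3 1 : State) by simp] at this
    have h' := this.comp_hasDerivAt (0 : ℝ) hline
    rw [zero_smul, add_zero] at h'
    exact h'
  have h₂ : HasDerivAt (fun s : ℝ => pressure γ W + (γ - 1) * s) (γ - 1) 0 := by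
    simpa using ((hasDerivAt_id (0 : ℝ)).const_mul (γ - 1)).const_add (pressure γ W)
  refine h₁.unique (h₂.congr_of_eventuallyEq ?_)
  have hc : Tendsto (fun s : ℝ => W + s • (Pi.single 3 1 : State)) (𝓝 0) (𝓝 W) := by
    simpa using hline.continuousAt.tendsto
  filter_upwards [hc (isOpen_physical.mem_nhds h)] with s hs
  -- Adding energy changes neither density nor momentum, so slip persists and the boundary state is
  -- the state itself.
  have hmem : W + s • (Pi.single 3 1 : State) ∈ B.conditions n := by
    rw [hB n hn]
    simpa [velocity] using hW
  rw [B.state_eq_self _ hs n hn hmem]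
  simp [pressure]
  ring

end BoundaryState

section Wall

variable {ι : Type*} {l : Filter ι} {x₀ : ι → State} {γ : ℝ}

/-- The discrete normal varies with the mesh, so strict differentiability jointly in state and
normal is used, on pairs with the same normal. -/
theorem der_pressureAt (B : BoundaryState γ) {W : State} (h : W ∈ physical γ) {n : ι → ℝ × ℝ}
    {n₀ : ℝ × ℝ} (hn₀ : n₀ ≠ 0) (hx : Tendsto x₀ l (𝓝 W)) (hn : Tendsto n l (𝓝 n₀)) :
    Der l x₀ (fun p => pressure γ (B.state p.2 (n p.1))) (B.pressureDeriv W n₀) := by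
  have hs := (B.contDiffAt_pressureAt h hn₀).hasStrictFDerivAt one_ne_zero
  have hn' := hn.comp (tendsto_fst (l := l) (x₀ := x₀))
  have h₁ := hs.isLittleO.comp_tendsto
    (((tendsto_snd hx).prodMk_nhds hn').prodMk_nhds
      ((hx.comp (tendsto_fst (l := l) (x₀ := x₀))).prodMk_nhds hn'))
  rw [Der, ← isLittleO_norm_right]
  refine h₁.norm_right.congr (fun p => ?_) fun p => ?_
  · simp only [Function.comp, BoundaryState.pressureAt, BoundaryState.pressureDeriv, incr, base,
      ContinuousLinearMap.comp_apply, ContinuousLinearMap.inl_apply, Prod.mk_sub_mk, sub_self]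
  · simp [incr]

end Wall

namespace MeshLimit

variable {l : Ultrafilter ℕ} {N M : ℕ → ℕ} {j : ℕ → ℤ} {P : ℝ × ℝ} {γ : ℝ}
  {C : Config γ} {D : Scheme γ}

/-- The wall faces next to the cells `(1, j)`. -/
theorem tendsto_wallFace (H : MeshLimit l N M (fun t => (1, j t)) P) (hC : C.Admissible D) :
    Tendsto (fun t => (1 / (M t : ℝ))⁻¹ • C.faceξ (N t) (M t) 0 (j t)) l (𝓝 (C.normalξ P)) := by
  have h₁ := H.tendsto_node (-1) 0
  have h₂ := H.tendsto_node (-1) (-1)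
  simp only [add_zero] at h₁
  exact Config.tendsto_faceξ hC H.M_pos h₁ h₂

theorem tendsto_wallNormal (H : MeshLimit l N M (fun t => (1, j t)) P) (hC : C.Admissible D) :
    Tendsto (fun t => unit (C.faceξ (N t) (M t) 0 (j t))) l (𝓝 (unit (C.normalξ P))) :=
  Config.tendsto_unit_of_smul (Config.normalξ_ne_zero hC H.mem_square) H.M_pos
    (H.tendsto_wallFace hC)

theorem tendsto_wallState (H : MeshLimit l N M (fun t => (1, j t)) P) (hC : C.Admissible D) :
    Tendsto (fun t => C.sampledFlow (N t) (M t) (1, j t)) l (𝓝 (C.W P)) :=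
  (hC.smooth_W.continuous.tendsto P).comp H.centre

theorem wall_point (H : MeshLimit l N M (fun t => (1, j t)) P) : P = (0, P.2) :=
  Prod.ext (H.fst_eq_zero (Eventually.of_forall fun _ => by norm_num)) rfl

theorem eventually_wall_regular (H : MeshLimit l N M (fun t => (1, j t)) P)
    (hC : C.Admissible D) : ∀ᶠ t in (l : Filter ℕ),
      C.sampledFlow (N t) (M t) (1, j t) ∈ physical γ ∧ C.faceξ (N t) (M t) 0 (j t) ≠ 0 := by
  have hn := Config.normalξ_ne_zero hC H.mem_square
  filter_upwards [H.tendsto_wallState hC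
    (isOpen_physical.mem_nhds (hC.physical_W P H.mem_square)),
    (H.tendsto_wallFace hC).eventually_ne hn] with t h₁ h₂
  refine ⟨h₁, fun h => h₂ ?_⟩
  rw [h, smul_zero]

theorem tendsto_wallPressureGrad (H : MeshLimit l N M (fun t => (1, j t)) P)
    (hC : C.Admissible D) :
    Tendsto (fun t => C.wallPressureGrad D (N t) (M t) (j t)) l
      (𝓝 fun b => D.wall.pressureDeriv (C.W P) (unit (C.normalξ P)) (Pi.single b 1)) := by
  have h := der_pressureAt D.wall (hC.physical_W P H.mem_square)
    (unit_ne_zero (Config.normalξ_ne_zero hC H.mem_square)) (H.tendsto_wallState hC)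
    (H.tendsto_wallNormal hC)
  refine h.tendsto_grad ?_
  filter_upwards [H.eventually_wall_regular hC] with t ht
  exact (D.wall.hasFDerivAt_pressureAt ht.1 (unit_ne_zero ht.2)).differentiableAt

theorem force_update_wall (C : Config γ) (D : Scheme γ) {N M : ℕ} (U : ℤ × ℤ → State) {j : ℤ}
    (hj : 1 ≤ j ∧ j ≤ M) (x : State) :
    C.force D N M (Function.update U (1, j) x) =
      pressure γ (D.wall.state x (unit (C.faceξ N M 0 j))) * -dot (C.faceξ N M 0 j) C.d
      + ∑ k ∈ (Finset.Icc (1 : ℤ) M).erase j,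
        pressure γ (D.wall.state (U (1, k)) (unit (C.faceξ N M 0 k))) * -dot (C.faceξ N M 0 k) C.d := by
  rw [Config.force, ← Finset.add_sum_erase _ _ (Finset.mem_Icc.2 hj), Function.update_self]
  congr 1
  refine Finset.sum_congr rfl fun k hk => ?_
  rw [Function.update_of_ne fun h => (Finset.mem_erase.1 hk).1 (congrArg Prod.snd h)]

/-- The boundary state slips exactly along the discrete face, even when `x` does not, so no
convective part remains on any mesh. -/
theorem numFlux_wall (C : Config γ) {D : Scheme γ} (hB : D.wall.IsWall) (v : Closure) (N M : ℕ)
    (j : ℤ) (w : ℤ → State) {x : State} (hx : x ∈ physical γ) (hS : C.faceξ N M 0 j ≠ 0) :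
    (C.row D v N M j).numFlux (Function.update w 1 x) 0 =
      pressure γ (D.wall.state x (unit (C.faceξ N M 0 j))) •
        ![0, (C.faceξ N M 0 j).1, (C.faceξ N M 0 j).2, 0] := by
  have hn := unit_ne_zero hS
  have h := D.wall.state_mem x hx _ hn
  rw [hB _ hn, Set.mem_ofPred_eq, dot_unit_eq_zero hS] at h
  have h' := flux_of_slip (γ := γ) (D.wall.physical_mem x hx _ hn).1.ne' h
  simpa [Line.numFlux, Line.firstState, Config.row] using h'

/-- Change of the functional that defines the discrete adjoint when the state of a cell at the wall
changes from `y` to `x`. -/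
theorem wall_functional_sub (C : Config γ) {D : Scheme γ} (hB : D.wall.IsWall) (v : Closure)
    {N M : ℕ} (U : ℤ × ℤ → State) {j : ℤ} (hN : 1 ≤ N) (hj : 1 ≤ j ∧ j ≤ M) (a : ℝ) {x y : State}
    (hx : x ∈ physical γ) (hy : y ∈ physical γ) (hS : C.faceξ N M 0 j ≠ 0) :
    (a * ((C.row D v N M j).balance (fun i => C.Λ (Config.centre N M (i, j)))
          (Function.update (fun i => U (i, j)) 1 x)
        + C.Λ (Config.centre N M (1, j)) ⬝ᵥ
          (C.row D v N M j).numFlux (Function.update (fun i => U (i, j)) 1 x) 0)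
      + (1 / (N : ℝ)) • (a * (1 / (N : ℝ))⁻¹ *
        (C.column D v N M 1).balance (fun k => C.Λ (Config.centre N M (1, k)))
          (Function.update (fun k => U (1, k)) j x))
      + -(C.Λ (Config.centre N M (1, j)) 1 * (a • C.faceξ N M 0 j).1
        + C.Λ (Config.centre N M (1, j)) 2 * (a • C.faceξ N M 0 j).2
        + dot C.d (a • C.faceξ N M 0 j)) •
          pressure γ (D.wall.state x (unit (C.faceξ N M 0 j))))
    - (a * ((C.row D v N M j).balance (fun i => C.Λ (Config.centre N M (i, j)))
          (Function.update (fun i => U (i, j)) 1 y)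
        + C.Λ (Config.centre N M (1, j)) ⬝ᵥ
          (C.row D v N M j).numFlux (Function.update (fun i => U (i, j)) 1 y) 0)
      + (1 / (N : ℝ)) • (a * (1 / (N : ℝ))⁻¹ *
        (C.column D v N M 1).balance (fun k => C.Λ (Config.centre N M (1, k)))
          (Function.update (fun k => U (1, k)) j y))
      + -(C.Λ (Config.centre N M (1, j)) 1 * (a • C.faceξ N M 0 j).1
        + C.Λ (Config.centre N M (1, j)) 2 * (a • C.faceξ N M 0 j).2
        + dot C.d (a • C.faceξ N M 0 j)) •
          pressure γ (D.wall.state y (unit (C.faceξ N M 0 j)))) =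
    a * (C.weightedResidual D v N M (Function.update U (1, j) x)
        + C.force D N M (Function.update U (1, j) x))
    - a * (C.weightedResidual D v N M (Function.update U (1, j) y)
        + C.force D N M (Function.update U (1, j) y)) := by
  have hN' : (1 : ℤ) ≤ N := by exact_mod_cast hN
  have e := C.weightedResidual_update_sub D v U (q := (1, j)) ⟨⟨le_refl 1, hN'⟩, hj⟩ x y
  dsimp only at e
  -- This cancels the factors inserted to give the column its natural scaling `1 / (Δξ Δη)`.
  have hN1 : (1 / (N : ℝ)) * (1 / (N : ℝ))⁻¹ = 1 :=
    mul_inv_cancel₀ (one_div_ne_zero (by positivity))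
  rw [numFlux_wall C hB v N M j _ hx hS, numFlux_wall C hB v N M j _ hy hS,
    force_update_wall C D U hj x, force_update_wall C D U hj y]
  simp only [dotProduct_smul, smul_eq_mul, dot_smul_right, Prod.smul_fst, Prod.smul_snd]
  have h4 : ∀ c : State, c ⬝ᵥ ![0, (C.faceξ N M 0 j).1, (C.faceξ N M 0 j).2, 0] =
      c 1 * (C.faceξ N M 0 j).1 + c 2 * (C.faceξ N M 0 j).2 := fun c => by
    simp [dotProduct, Fin.sum_univ_four]
  have h5 : dot (C.faceξ N M 0 j) C.d = dot C.d (C.faceξ N M 0 j) := by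
    simp only [dot]; ring
  rw [h4, h5]
  generalize hcx : (C.column D v N M 1).balance (fun k => C.Λ (Config.centre N M (1, k)))
    (Function.update (fun k => U (1, k)) j x) = cx at e ⊢
  generalize hcy : (C.column D v N M 1).balance (fun k => C.Λ (Config.centre N M (1, k)))
    (Function.update (fun k => U (1, k)) j y) = cy at e ⊢
  linear_combination (-a) * e + a * (cx - cy) * hN1

/-- Three contributions are separated: the row without its wall flux, which has derivative `0`; the
column, which is smaller by a factor `Δξ`; and the wall flux together with the force, both multiples
of the boundary pressure, with total coefficient tending to `-contWall`. -/
theorem tendsto_wallAdjoint (H : MeshLimit l N M (fun t => (1, j t)) P) (hγ : 1 < γ)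
    (hk₄ : 0 ≤ D.k₄) (hB : D.wall.IsWall) (hC : C.Admissible D) {v : Closure}
    (hj : ∀ t, 3 ≤ j t ∧ j t ≤ M t - 2)
    (hd : ∀ᶠ t in (l : Filter ℕ), C.DifferentiableInCell D v (N t) (M t) (1, j t)) :
    Tendsto (fun t => (1 / M t : ℝ)⁻¹ • C.discreteAdjoint D v (N t) (M t) (1, j t)) l
      (𝓝 (-C.contWall P • fun b =>
        D.wall.pressureDeriv (C.W P) (unit (C.normalξ P)) (Pi.single b 1))) := by
  have hΛ : ∀ o : ℤ, Tendsto (fun t => C.Λ (Config.centre (N t) (M t) (1 + o + 1, j t))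
      - C.Λ (Config.centre (N t) (M t) (1 + o, j t))) l (𝓝 0) := fun o => by
    have h₁ := (hC.smooth_Λ.continuous.tendsto P).comp (H.tendsto_centre (o + 1) 0)
    have h₂ := (hC.smooth_Λ.continuous.tendsto P).comp (H.tendsto_centre o 0)
    simpa [Function.comp_def, ← add_assoc] using h₁.sub h₂
  have hrow := (H.lineLimit_row hγ hk₄ hC v).der_balance_first
    (by filter_upwards [H.le_N 2] with t ht using ⟨rfl, ht⟩)
    (Λ := fun t i => C.Λ (Config.centre (N t) (M t) (i, j t))) hΛ
  have hcol := (H.der_column hγ hk₄ hC (v := v)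
    (Or.inl ⟨rfl, Eventually.of_forall hj⟩)).smul_of_tendsto H.inv_N
  have ha : Tendsto (fun t => C.Λ (Config.centre (N t) (M t) (1, j t)) 1 *
        ((1 / (M t : ℝ))⁻¹ • C.faceξ (N t) (M t) 0 (j t)).1
      + C.Λ (Config.centre (N t) (M t) (1, j t)) 2 *
        ((1 / (M t : ℝ))⁻¹ • C.faceξ (N t) (M t) 0 (j t)).2
      + dot C.d ((1 / (M t : ℝ))⁻¹ • C.faceξ (N t) (M t) 0 (j t))) l (𝓝 (C.contWall P)) := by
    have h₁ := tendsto_pi_nhds.1 ((hC.smooth_Λ.continuous.tendsto P).comp H.centre)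
    have h₂ := (continuous_fst.tendsto _).comp (H.tendsto_wallFace hC)
    have h₃ := (continuous_snd.tendsto _).comp (H.tendsto_wallFace hC)
    convert (((h₁ 1).mul h₂).add ((h₁ 2).mul h₃)).add
      ((h₂.const_mul C.d.1).add (h₃.const_mul C.d.2)) using 2
    · rfl
    · simp only [Config.contWall, Config.normalξ]
      ring
  have hp := (der_pressureAt D.wall (hC.physical_W P H.mem_square)
    (unit_ne_zero (Config.normalξ_ne_zero hC H.mem_square)) (H.tendsto_wallState hC)
    (H.tendsto_wallNormal hC)).smul_of_tendsto ha.neg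
  have hf := Der.congr_sub
    (g := fun p : ℕ × State => (1 / M p.1 : ℝ)⁻¹ *
        (C.weightedResidual D v (N p.1) (M p.1)
          (Function.update (C.sampledFlow (N p.1) (M p.1)) (1, j p.1) p.2)
        + C.force D (N p.1) (M p.1)
          (Function.update (C.sampledFlow (N p.1) (M p.1)) (1, j p.1) p.2)))
    ((hrow.add hcol).add hp) <| by
      -- The pressure form of the wall flux holds for physical states, so the perturbed state `x`
      -- must itself be close to the limit.
      filter_upwards [JST.tendsto_fst.eventually H.mem, JST.tendsto_fst.eventually H.N_pos,
        JST.tendsto_fst.eventually (H.eventually_wall_regular hC),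
        JST.tendsto_snd (H.tendsto_wallState hC)
          (isOpen_physical.mem_nhds (hC.physical_W P H.mem_square))] with ⟨t, x⟩ ht hN hr hx
      dsimp only at ht hN hr hx
      exact wall_functional_sub C hB v (C.sampledFlow (N t) (M t)) (by exact_mod_cast ht.1.2) ht.2 _
        hx hr.1 hr.2
  have hJ : ∀ᶠ t in (l : Filter ℕ), DifferentiableAt ℝ
      (fun x => C.force D (N t) (M t) (Function.update (C.sampledFlow (N t) (M t)) (1, j t) x))
      (C.sampledFlow (N t) (M t) (1, j t)) := by
    filter_upwards [H.mem, H.eventually_wall_regular hC] with t ht hr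
    simp only [force_update_wall C D _ ht.2]
    exact ((D.wall.hasFDerivAt_pressureAt hr.1 (unit_ne_zero hr.2)).differentiableAt.mul_const
      _).add_const _
  have hdiff : ∀ᶠ t in (l : Filter ℕ), DifferentiableAt ℝ
      (fun x => C.weightedResidual D v (N t) (M t)
          (Function.update (C.sampledFlow (N t) (M t)) (1, j t) x)
        + C.force D (N t) (M t) (Function.update (C.sampledFlow (N t) (M t)) (1, j t) x))
      (C.sampledFlow (N t) (M t) (1, j t)) := by
    filter_upwards [hd, hJ] with t h₁ h₂
    exact (Config.differentiableAt_weightedResidual h₁).add h₂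
  have key := hf.tendsto_grad (hdiff.mono fun t ht => ht.const_mul (1 / M t : ℝ)⁻¹)
  refine (key.congr' ?_).trans (le_of_eq ?_)
  · filter_upwards [hd, hJ, hdiff] with t h₁ h₂ h₃
    rw [grad_const_mul _ h₃, Config.discreteAdjoint_eq_grad h₁ h₂]
  · congr 1
    ext b
    simp

end MeshLimit

theorem wallConsistent {γ : ℝ} {D : Scheme γ} (hγ : 1 < γ) (hk₄ : 0 ≤ D.k₄)
    (hB : D.wall.IsWall) (v : Closure) : WallConsistent D v := by
  intro C hC r
  -- The energy component of the pressure gradient tends to `γ - 1`; half of it is a lower bound on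
  -- fine meshes.
  refine ⟨(γ - 1) / 2, by linarith, fun ε hε => ?_⟩
  by_contra! hcon
  choose N M hN hM _ _ j hj hj' hd herr using fun t => hcon (t + 5)
  obtain ⟨P, H⟩ := exists_meshLimit (N := N) (M := M) (q := fun t => (1, j t)) (fun t => by have := hN t; omega)
    (fun t => by have := hM t; omega) fun t => by
      have := hN t; have := hj t; have := hj' t; dsimp only; omega
  have hg := H.tendsto_wallPressureGrad (D := D) hC
  have hA := H.tendsto_wallAdjoint hγ hk₄ hB hC (v := v) (fun t => ⟨hj t, hj' t⟩)
    (Eventually.of_forall hd)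
  have hP := H.wall_point
  have hn := Config.normalξ_ne_zero hC H.mem_square
  have h3 : D.wall.pressureDeriv (C.W P) (unit (C.normalξ P)) (Pi.single 3 1) = γ - 1 := by
    refine D.wall.pressureDeriv_energy hB (hC.physical_W P H.mem_square) (unit_ne_zero hn) ?_
    have := hC.wall_cond P.2 H.mem_square.2
    rw [← hP, hB _ (unit_ne_zero hn)] at this
    exact this
  have hβ : ∀ᶠ t in (hyperfilter ℕ : Filter ℕ),
      (γ - 1) / 2 ≤ ‖C.wallPressureGrad D (N t) (M t) (j t)‖ := by
    have h := tendsto_pi_nhds.1 hg 3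
    rw [h3] at h
    filter_upwards [h.eventually_const_lt (show (γ - 1) / 2 < γ - 1 by linarith)] with t ht
    exact ht.le.trans ((le_abs_self _).trans (norm_le_pi_norm (C.wallPressureGrad D (N t) (M t) (j t)) 3))
  have hw : Tendsto (fun t => C.contWall (0, (Config.centre (N t) (M t) (1, j t)).2))
      (hyperfilter ℕ : Filter ℕ) (𝓝 (C.contWall P)) := by
    have hc : Continuous C.contWall := by
      have h₁ := Config.continuous_dη hC.smooth_x
      have h₂ := Config.continuous_dη hC.smooth_y
      have h₃ := hC.smooth_Λ.continuous
      unfold Config.contWall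
      fun_prop
    refine (hc.tendsto P).comp ?_
    rw [hP]
    exact tendsto_const_nhds.prodMk_nhds ((continuous_snd.tendsto P).comp H.centre)
  have hlim := (hA.sub (hw.smul hg.neg)).norm
  rw [neg_smul, smul_neg, sub_self, norm_zero] at hlim
  obtain ⟨t, h₁, h₂⟩ := (hβ.and (hlim.eventually_lt_const hε)).exists
  exact lt_irrefl _ ((herr t h₁).trans h₂)

/-! ### Inconsistency: a uniform flow at rest -/

/-- A continuous factor does not destroy differentiability at a zero. -/
theorem differentiableAt_smul_of_zero {E : Type*} [NormedAddCommGroup E] [NormedSpace ℝ E]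
    {f : State → ℝ} {g : State → E} {W : State} (hf : ContinuousAt f W)
    (hg : DifferentiableAt ℝ g W) (h0 : g W = 0) : DifferentiableAt ℝ (fun x => f x • g x) W := by
  have h : HasFDerivAt (fun x => (f x - f W) • g x) (0 : State →L[ℝ] E) W := by
    rw [hasFDerivAt_iff_isLittleO]
    have h₁ : (fun x => f x - f W) =o[𝓝 W] fun _ => (1 : ℝ) := by
      rw [isLittleO_one_iff]
      simpa using hf.tendsto.sub_const (f W)
    have h₂ := hg.isBigO_sub
    simp only [h0, sub_zero] at h₂
    have h₃ := (h₁.smul_isBigO h₂.norm_right).norm_right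
    rw [← isLittleO_norm_right]
    simpa [h0] using h₃
  refine (h.differentiableAt.add (hg.const_smul (f W))).congr_of_eventuallyEq
    (Eventually.of_forall fun x => ?_)
  simp only [Pi.add_apply, Pi.smul_apply]
  module

/-! ### Differentiability of the scheme at a uniform flow -/

namespace Line

variable {γ : ℝ} (L : Line γ) {W₀ : State}

/-- A uniform flow with one perturbed cell. -/
def uniform (W₀ : State) (m : ℤ) (x : State) : ℤ → State := Function.update (fun _ => W₀) m x

theorem uniform_self (m : ℤ) : uniform W₀ m W₀ = fun _ => W₀ := Function.update_eq_self m _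

theorem differentiableAt_uniform (m i : ℤ) : DifferentiableAt ℝ (fun x => uniform W₀ m x i) W₀ := by
  by_cases h : i = m
  · subst h
    simp [uniform]
  · simp [uniform, h]

/-- The uniform flow `W₀` satisfies the boundary conditions at both ends of the line. -/
structure Compatible (W₀ : State) : Prop where
  physical : W₀ ∈ physical γ
  first_ne : unit (L.S 0) ≠ 0
  first : W₀ ∈ L.first.conditions (unit (L.S 0))
  last_ne : unit (L.S L.n) ≠ 0
  last : W₀ ∈ L.last.conditions (unit (L.S L.n))

variable {L}

namespace Compatible

theorem firstState_eq (H : L.Compatible W₀) : L.firstState (fun _ => W₀) = W₀ :=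
  L.first.state_eq_self _ H.physical _ H.first_ne H.first

theorem lastState_eq (H : L.Compatible W₀) : L.lastState (fun _ => W₀) = W₀ :=
  L.last.state_eq_self _ H.physical _ H.last_ne H.last

theorem differentiableAt_boundary (H : L.Compatible W₀) (B : BoundaryState γ) {n : ℝ × ℝ}
    (hn : n ≠ 0) (m i : ℤ) : DifferentiableAt ℝ (fun x => B.state (uniform W₀ m x i) n) W₀ := by
  have h : DifferentiableAt ℝ (fun w => B.state w n) W₀ :=
    ((B.contDiffAt H.physical hn).differentiableAt one_ne_zero).comp
      (f := fun w : State => (w, n)) W₀ (by fun_prop)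
  have h' : DifferentiableAt ℝ (fun w => B.state w n) (uniform W₀ m W₀ i) := by
    rwa [uniform_self]
  exact h'.comp W₀ (differentiableAt_uniform m i)

theorem differentiableAt_firstState (H : L.Compatible W₀) (m : ℤ) :
    DifferentiableAt ℝ (fun x => L.firstState (uniform W₀ m x)) W₀ :=
  H.differentiableAt_boundary L.first H.first_ne m 1

theorem differentiableAt_lastState (H : L.Compatible W₀) (m : ℤ) :
    DifferentiableAt ℝ (fun x => L.lastState (uniform W₀ m x)) W₀ :=
  H.differentiableAt_boundary L.last H.last_ne m L.n

theorem differentiableAt_flux (H : L.Compatible W₀) {f : State → State}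
    (hf : DifferentiableAt ℝ f W₀) (h0 : f W₀ = W₀) (S : ℝ × ℝ) :
    DifferentiableAt ℝ (fun x => flux γ (f x) S) W₀ := by
  have hp : f W₀ 0 ≠ 0 := by rw [h0]; exact H.physical.1.ne'
  exact ((((contDiffAt_fluxX hp).differentiableAt one_ne_zero).comp W₀ hf).const_smul S.1).add
    ((((contDiffAt_fluxY hp).differentiableAt one_ne_zero).comp W₀ hf).const_smul S.2)

theorem continuousAt_pressure (H : L.Compatible W₀) {f : State → State}
    (hf : ContinuousAt f W₀) (h0 : f W₀ = W₀) :
    ContinuousAt (fun x => pressure γ (f x)) W₀ := by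
  have hp : f W₀ 0 ≠ 0 := by rw [h0]; exact H.physical.1.ne'
  exact (contDiffAt_pressure hp).continuousAt.comp hf

theorem continuousAt_press (H : L.Compatible W₀) (m i : ℤ) :
    ContinuousAt (fun x => L.press (uniform W₀ m x) i) W₀ := by
  have hu := fun k => H.continuousAt_pressure (differentiableAt_uniform m k).continuousAt
    (congrFun (uniform_self m) k)
  have h₁ := H.continuousAt_pressure (H.differentiableAt_firstState m).continuousAt
    (by rw [uniform_self, H.firstState_eq])
  have h₂ := H.continuousAt_pressure (H.differentiableAt_lastState m).continuousAt
    (by rw [uniform_self, H.lastState_eq])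
  unfold press
  split_ifs
  · exact (h₁.const_mul 2).sub (hu 1)
  · exact (h₂.const_mul 2).sub (hu L.n)
  · exact hu i

theorem press_uniform (H : L.Compatible W₀) (i : ℤ) :
    L.press (fun _ => W₀) i = pressure γ W₀ := by
  unfold press
  rw [H.firstState_eq, H.lastState_eq]
  split_ifs <;> ring

/-- A uniform flow sits on the kink of the absolute value. Continuity is nevertheless enough,
because the dissipation coefficients multiply differences that vanish there. -/
theorem continuousAt_sensor (H : L.Compatible W₀) (m i : ℤ) :
    ContinuousAt (fun x => L.sensor (uniform W₀ m x) i) W₀ := by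
  have h := H.continuousAt_press m
  refine ((((h (i + 1)).sub ((h i).const_mul 2)).add (h (i - 1))).abs).div
    (((h (i + 1)).add ((h i).const_mul 2)).add (h (i - 1))) ?_
  have := H.physical.2
  simp only [uniform_self, H.press_uniform]
  positivity

theorem continuousAt_faceSensor (H : L.Compatible W₀) (m k : ℤ) :
    ContinuousAt (fun x => L.faceSensor (uniform W₀ m x) k) W₀ :=
  (H.continuousAt_sensor m k).max (H.continuousAt_sensor m (k + 1))

theorem continuousAt_kBar (H : L.Compatible W₀) (m k : ℤ) :
    ContinuousAt (fun x => L.kBar (uniform W₀ m x) k) W₀ :=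
  continuousAt_const.max (continuousAt_const.sub ((H.continuousAt_faceSensor m k).mul_const _))

theorem continuousAt_kappa (H : L.Compatible W₀) (hγ : 1 < γ) (m k : ℤ) :
    ContinuousAt (fun x => L.kappa (uniform W₀ m x) k) W₀ := by
  have hu := fun k => (differentiableAt_uniform (W₀ := W₀) m k).continuousAt
  have hm : ContinuousAt (fun x => L.mean.toFun (uniform W₀ m x k) (uniform W₀ m x (k + 1))) W₀ := by
    have h : ContinuousAt (fun q : State × State => L.mean.toFun q.1 q.2)
        (uniform W₀ m W₀ k, uniform W₀ m W₀ (k + 1)) := by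
      rw [uniform_self]
      exact (L.mean.contDiffAt H.physical).continuousAt
    exact h.comp (f := fun x => (uniform W₀ m x k, uniform W₀ m x (k + 1)))
      ((hu k).prodMk (hu (k + 1)))
  have hmem : L.mean.toFun (uniform W₀ m W₀ k) (uniform W₀ m W₀ (k + 1)) ∈ JST.physical γ := by
    rw [uniform_self, L.mean.self _ H.physical]
    exact H.physical
  have hv := (contDiffAt_velocity hmem.1.ne').continuousAt.comp (f := fun x =>
    L.mean.toFun (uniform W₀ m x k) (uniform W₀ m x (k + 1))) hm
  have hc := (contDiffAt_soundSpeed hγ hmem).continuousAt.comp (f := fun x =>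
    L.mean.toFun (uniform W₀ m x k) (uniform W₀ m x (k + 1))) hm
  exact ((hv.fst.mul_const _).add (hv.snd.mul_const _)).abs.add (hc.mul_const _)

theorem differentiableAt_closure {v : Closure} {a b c d : State → State}
    (ha : DifferentiableAt ℝ a W₀) (hb : DifferentiableAt ℝ b W₀) (hc : DifferentiableAt ℝ c W₀)
    (hd : DifferentiableAt ℝ d W₀) :
    DifferentiableAt ℝ (fun x => v.difference (a x) (b x) (c x) (d x)) W₀ := by
  cases v <;> simp only [Closure.difference] <;> fun_prop

theorem differentiableAt_difference (H : L.Compatible W₀) (m k : ℤ) :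
    DifferentiableAt ℝ (fun x => L.difference (uniform W₀ m x) k) W₀ := by
  have hu := differentiableAt_uniform (W₀ := W₀) m
  unfold difference
  split_ifs
  · exact differentiableAt_closure (hu _) (hu _) (hu _)
      (((H.differentiableAt_firstState m).const_smul (2 : ℝ)).sub (hu 1))
  · exact (differentiableAt_closure (hu _) (hu _) (hu _)
      (((H.differentiableAt_lastState m).const_smul (2 : ℝ)).sub (hu L.n))).neg
  · exact (((hu _).sub ((hu _).const_smul (3 : ℝ))).add ((hu _).const_smul (3 : ℝ))).sub (hu _)

theorem difference_uniform (H : L.Compatible W₀) (k : ℤ) : L.difference (fun _ => W₀) k = 0 := by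
  have h : ∀ v : Closure, v.difference W₀ W₀ W₀ W₀ = 0 := fun v => by
    cases v <;> simp only [Closure.difference] <;> module
  have h' : (2 : ℝ) • W₀ - W₀ = W₀ := by module
  unfold difference
  rw [H.firstState_eq, H.lastState_eq, h', h]
  split_ifs
  · rfl
  · exact neg_zero
  · module

/-- The numerical fluxes are differentiable at a uniform flow. -/
theorem differentiableAt_numFlux (H : L.Compatible W₀) (hγ : 1 < γ) (m k : ℤ) :
    DifferentiableAt ℝ (fun x => L.numFlux (uniform W₀ m x) k) W₀ := by
  have hu := differentiableAt_uniform (W₀ := W₀) m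
  have hF := fun i => H.differentiableAt_flux (hu i) (congrFun (uniform_self m) i)
  unfold numFlux
  split_ifs
  · exact H.differentiableAt_flux (H.differentiableAt_firstState m)
      (by rw [uniform_self, H.firstState_eq]) _
  · exact H.differentiableAt_flux (H.differentiableAt_lastState m)
      (by rw [uniform_self, H.lastState_eq]) _
  · refine ((((hF _ _).add (hF _ _)).const_smul (1 / 2 : ℝ)).sub (differentiableAt_smul_of_zero
      (((H.continuousAt_faceSensor m k).const_mul _).mul (H.continuousAt_kappa hγ m k))
      ((hu _).sub (hu _)) ?_)).add (differentiableAt_smul_of_zero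
      ((H.continuousAt_kBar m k).mul (H.continuousAt_kappa hγ m k))
      (H.differentiableAt_difference m k) ?_)
    · simp only [Pi.sub_apply, uniform_self, sub_self]
    · rw [uniform_self, H.difference_uniform]

end Compatible

end Line

/-! ### The counterexample: gas at rest -/

/-- The boundary treatment without boundary conditions. -/
def BoundaryState.free (γ : ℝ) : BoundaryState γ where
  conditions _ := Set.univ
  state W _ := W
  contDiffOn := contDiff_fst.contDiffOn
  physical_mem _ h _ _ := h
  state_mem _ _ _ _ := Set.mem_univ _
  state_eq_self _ _ _ _ _ := rfl

/-- A uniform gas at rest. -/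
noncomputable def restState (γ : ℝ) : State := ![1, 0, 0, 1 / (γ - 1)]

theorem restState_physical {γ : ℝ} (hγ : 1 < γ) : restState γ ∈ physical γ := by
  have : γ - 1 ≠ 0 := by linarith
  constructor
  · simp [restState]
  · simp [restState, pressure, this]

/-- A uniform gas at rest in the unit square, with a linear adjoint field. -/
noncomputable def Config.rest (γ : ℝ) : Config γ where
  x P := P.1
  y P := P.2
  W _ := restState γ
  Λ P := (P.1 + P.2) • (Pi.single 0 1 : State)
  d := 0
  right := BoundaryState.free γ
  bottom := BoundaryState.free γ
  top := BoundaryState.free γ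

namespace Config

variable {γ : ℝ} {D : Scheme γ}

theorem rest_dx (P v : ℝ × ℝ) : fderiv ℝ (rest γ).x P v = v.1 := by
  change fderiv ℝ Prod.fst P v = v.1
  rw [fderiv_fst]; rfl

theorem rest_dy (P v : ℝ × ℝ) : fderiv ℝ (rest γ).y P v = v.2 := by
  change fderiv ℝ Prod.snd P v = v.2
  rw [fderiv_snd]; rfl

theorem rest_dΛ (P v : ℝ × ℝ) :
    fderiv ℝ (rest γ).Λ P v = (v.1 + v.2) • (Pi.single 0 1 : State) := by
  have h : HasFDerivAt (rest γ).Λ ((ContinuousLinearMap.fst ℝ ℝ ℝ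
      + ContinuousLinearMap.snd ℝ ℝ ℝ).smulRight (Pi.single 0 1 : State)) P :=
    (hasFDerivAt_fst.add hasFDerivAt_snd).smul_const _
  rw [h.fderiv]
  rfl

theorem rest_normalξ (P : ℝ × ℝ) : (rest γ).normalξ P = (1, 0) := by
  simp [normalξ, dη, rest_dx, rest_dy]

theorem rest_normalη (P : ℝ × ℝ) : (rest γ).normalη P = (0, 1) := by
  simp [normalη, dξ, rest_dx, rest_dy]

theorem rest_slip (n : ℝ × ℝ) : dot (velocity (restState γ)) n = 0 := by
  simp [dot, velocity, restState]

theorem rest_admissible (hγ : 1 < γ) (hB : D.wall.IsWall) : (rest γ).Admissible D where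
  smooth_x := contDiff_fst
  smooth_y := contDiff_snd
  smooth_W := contDiff_const
  smooth_Λ := (contDiff_fst.add contDiff_snd).smul contDiff_const
  jacobian_pos P _ := by simp [dξ, dη, rest_dx, rest_dy]
  physical_W _ _ := restState_physical hγ
  wall_cond η _ := by
    rw [hB _ (unit_ne_zero (by rw [rest_normalξ]; simp))]
    exact rest_slip _
  right_cond _ _ := Set.mem_univ _
  bottom_cond _ _ := Set.mem_univ _
  top_cond _ _ := Set.mem_univ _

theorem rest_faceξ (N M : ℕ) (k j : ℤ) : (rest γ).faceξ N M k j = (1 / (M : ℝ), 0) := by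
  simp [faceξ, node, rest, sub_div]

theorem rest_faceη (N M : ℕ) (i k : ℤ) : (rest γ).faceη N M i k = (0, 1 / (N : ℝ)) := by
  simp [faceη, node, rest, sub_div]

theorem rest_row_compatible (hγ : 1 < γ) (hB : D.wall.IsWall) (v : Closure) {N M : ℕ} (hM : 0 < M)
    (j : ℤ) : ((rest γ).row D v N M j).Compatible (restState γ) := by
  have h : ∀ k, unit ((rest γ).faceξ N M k j) ≠ 0 := fun k => unit_ne_zero (by
    rw [rest_faceξ]
    simp [hM.ne'])
  refine ⟨restState_physical hγ, h _, ?_, h _, Set.mem_univ _⟩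
  change restState γ ∈ D.wall.conditions (unit ((rest γ).faceξ N M 0 j))
  rw [hB _ (h 0)]
  exact rest_slip _

theorem rest_column_compatible (hγ : 1 < γ) (v : Closure) {N M : ℕ} (hN : 0 < N) (i : ℤ) :
    ((rest γ).column D v N M i).Compatible (restState γ) := by
  have h : ∀ k, unit ((rest γ).faceη N M i k) ≠ 0 := fun k => unit_ne_zero (by
    rw [rest_faceη]
    simp [hN.ne'])
  exact ⟨restState_physical hγ, h _, Set.mem_univ _, h _, Set.mem_univ _⟩

/-- Consistency speaks only of cells where the scheme is differentiable, so without this the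
counterexample would say nothing. Lines that miss `q` carry constant fluxes; the others are uniform
flows with one perturbed cell. -/
theorem rest_differentiable (hγ : 1 < γ) (hB : D.wall.IsWall) (v : Closure) {N M : ℕ} (hN : 0 < N)
    (hM : 0 < M) (q : ℤ × ℤ) : (rest γ).DifferentiableInCell D v N M q := by
  have hr : ∀ j k, DifferentiableAt ℝ (fun x => ((rest γ).row D v N M j).numFlux
      (fun i => Function.update ((rest γ).sampledFlow N M) q x (i, j)) k) (restState γ) := by
    intro j k
    by_cases hj : j = q.2
    · have e : ∀ x, (fun i => Function.update ((rest γ).sampledFlow N M) q x (i, j)) =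
          Line.uniform (restState γ) q.1 x := fun x => by
        ext1 i
        simp [Line.uniform, Function.update_apply, Prod.ext_iff, hj, sampledFlow, rest]
      simp only [e]
      exact (rest_row_compatible hγ hB v hM j).differentiableAt_numFlux hγ _ _
    · have e : ∀ x, (fun i => Function.update ((rest γ).sampledFlow N M) q x (i, j)) =
          fun _ => restState γ := fun x => by
        ext1 i
        simp [Prod.ext_iff, hj, sampledFlow, rest]
      simp only [e]
      exact differentiableAt_const _
  have hc : ∀ i k, DifferentiableAt ℝ (fun x => ((rest γ).column D v N M i).numFlux
      (fun j => Function.update ((rest γ).sampledFlow N M) q x (i, j)) k) (restState γ) := by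
    intro i k
    by_cases hi : i = q.1
    · have e : ∀ x, (fun j => Function.update ((rest γ).sampledFlow N M) q x (i, j)) =
          Line.uniform (restState γ) q.2 x := fun x => by
        ext1 j
        simp [Line.uniform, Function.update_apply, Prod.ext_iff, hi, sampledFlow, rest]
      simp only [e]
      exact (rest_column_compatible hγ v hN i).differentiableAt_numFlux hγ _ _
    · have e : ∀ x, (fun j => Function.update ((rest γ).sampledFlow N M) q x (i, j)) =
          fun _ => restState γ := fun x => by
        ext1 j
        simp [Prod.ext_iff, hi, sampledFlow, rest]
      simp only [e]
      exact differentiableAt_const _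
  intro k _
  exact (((hr _ _).sub (hr _ _)).add (hc _ _)).sub (hc _ _)

theorem spectralRadius_pos (hγ : 1 < γ) {W : State} (h : W ∈ physical γ) {S : ℝ × ℝ} (hS : S ≠ 0) :
    0 < spectralRadius γ W S := by
  have h₁ := h.1
  have h₂ := h.2
  have hc : 0 < soundSpeed γ W := Real.sqrt_pos.2 (by positivity)
  exact add_pos_of_nonneg_of_pos (abs_nonneg _) (mul_pos hc (len_pos hS))

/-- `Λ` has slope one in both coordinates, so the same field serves all four sides: its defect is `±
k⁴ κ` in the first component, with `κ > 0` constant since the sound speed is positive. -/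
theorem norm_defect_rest (hγ : 1 < γ) (hk₄ : 0 < D.k₄) (s : Side) :
    ∃ δ > 0, ∀ P, δ ≤ ‖defect D s (rest γ) P‖ := by
  have hW := restState_physical hγ
  have hξ := mul_pos hk₄ (spectralRadius_pos hγ hW (S := (1, 0)) (by simp))
  have hη := mul_pos hk₄ (spectralRadius_pos hγ hW (S := (0, 1)) (by simp))
  have key : ∀ z : ℝ, 0 < z → ∀ V : State, |V 0| = z → z ≤ ‖V‖ := fun z _ V hV => by
    rw [← hV]
    exact norm_le_pi_norm V 0
  cases s
  · refine ⟨_, hξ, fun P => key _ hξ _ ?_⟩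
    simp [defect, dξ, rest_dΛ, rest_normalξ, -abs_mul]
    exact abs_of_pos hξ
  · refine ⟨_, hξ, fun P => key _ hξ _ ?_⟩
    simp [defect, dξ, rest_dΛ, rest_normalξ, -abs_mul]
    exact abs_of_pos hξ
  · refine ⟨_, hη, fun P => key _ hη _ ?_⟩
    simp [defect, dη, rest_dΛ, rest_normalη, -abs_mul]
    exact abs_of_pos hη
  · refine ⟨_, hη, fun P => key _ hη _ ?_⟩
    simp [defect, dη, rest_dΛ, rest_normalη, -abs_mul]
    exact abs_of_pos hη

end Config

theorem exists_mem_penultimate (s : Side) {n : ℕ} (hn : 5 ≤ n) : ∃ q, q ∈ penultimate s n n := by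
  cases s
  · exact ⟨(2, 3), rfl, le_refl _, by dsimp only; omega⟩
  · exact ⟨(n - 1, 3), rfl, le_refl _, by dsimp only; omega⟩
  · exact ⟨(3, 2), rfl, le_refl _, by dsimp only; omega⟩
  · exact ⟨(3, n - 1), rfl, le_refl _, by dsimp only; omega⟩

theorem not_dualConsistent_penultimate {γ : ℝ} {D : Scheme γ} (hγ : 1 < γ) (hk₄ : 0 < D.k₄)
    (hB : D.wall.IsWall) {v : Closure} (hv : v = .a ∨ v = .c) (s : Side) :
    ¬ DualConsistent D v (penultimate s) := by
  intro hcon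
  have hC := Config.rest_admissible (D := D) hγ hB
  obtain ⟨δ, hδ, hle⟩ := Config.norm_defect_rest (D := D) hγ hk₄ s
  -- On fine square meshes (ratio bound `1`) the truncation error would be within `δ / 3` both of
  -- `0` and of a vector of norm at least `δ`.
  obtain ⟨n₁, h₁⟩ := hcon _ hC 1 (δ / 3) (by positivity)
  obtain ⟨n₂, h₂⟩ := truncationErrorTendsTo_defect hγ hk₄.le hv s _ hC 1 (δ / 3) (by positivity)
  obtain ⟨n, hn⟩ : ∃ n, n = n₁ + n₂ + 5 := ⟨_, rfl⟩
  obtain ⟨q, hq⟩ := exists_mem_penultimate s (show 5 ≤ n by omega)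
  have hd := Config.rest_differentiable (N := n) (M := n) hγ hB v (by omega) (by omega) q
  have e₁ := h₁ n n (by omega) (by omega) (by simp) (by simp) q hq hd
  have e₂ := h₂ n n (by omega) (by omega) (by simp) (by simp) q hq hd
  rw [sub_zero] at e₁
  have := norm_sub_norm_le (defect D s (Config.rest γ) (Config.centre n n q))
    ((Config.rest γ).truncationError D v n n q)
  rw [norm_sub_rev] at this
  linarith [hle (Config.centre n n q)]

end JST

theorem mainTheorem1 (γ : ℝ) (hγ : 1 < γ) (D : JST.Scheme γ)
    (hk₂ : 0 ≤ D.k₂) (hk₄ : 0 ≤ D.k₄) (hwall : D.wall.IsWall) :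
    (∀ v : JST.Closure, JST.DualConsistent D v JST.interior) ∧
    (∀ s : JST.Side, JST.DualConsistent D .b (JST.penultimate s)) ∧
    (∀ v : JST.Closure, v = .a ∨ v = .c → ∀ s : JST.Side,
      JST.TruncationErrorTendsTo D v (JST.penultimate s) (JST.defect D s) ∧
      (0 < D.k₄ → ¬ JST.DualConsistent D v (JST.penultimate s))) ∧
    (∀ v : JST.Closure, JST.WallConsistent D v) :=
  ⟨JST.dualConsistent_interior hγ hk₄, JST.dualConsistent_penultimate hγ hk₄,
    fun _ hv s => ⟨JST.truncationErrorTendsTo_defect hγ hk₄ hv s,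
      fun hk => JST.not_dualConsistent_penultimate hγ hk hwall hv s⟩,
    JST.wallConsistent hγ hk₄ hwall⟩
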